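/- **Setting.** Let $\Omega$ be a Polish space with its Borel $\sigma$-algebra and a probability measure $\mu$. Let $(\kappa_t)_{t\ge 0}$ be the transition kernels of a time-homogeneous Markov process $(Z_t)_{t\ge0}$ on $\Omega$ (Markov kernels with $\kappa_0(z,\cdot)=\delta_z$ and the Chapman–Kolmogorov property), and let $(P_tf)(z)=\mathbb E[f(Z_t)\mid Z_0=z]=\int f\,d\kappa_t(z,\cdot)$. Assume that * $\mu$ is stationary; * the semigroup is reversible: $\mathbb E_\mu[(P_tf)g]=\mathbb E_\mu[f(P_tg)]$ for all $t\ge 0$ and all real $f,g\in L_2(\mu)$; * the semigroup is ergodic: $P_tf\to\mathbb E_\mu f$ in $L_2(\mu)$ as $t\to\infty$ for all real $f\in L_2(\mu)$. The generator is $(\mathcal Lf)(z)=\lim_{t\downarrow0}t^{-1}\big((P_tf)(z)-f(z)\big)$ (set to $0$ where the limit does not exist); it and $\mathbb E_\mu$ act on matrix-valued functions entrywise. Fix an algebra $\mathcal A$ of *suitable* functions: a complex algebra of measurable functions $\Omega\to\mathbb C$ that contains the constants, is closed under complex conjugation, consists of functions in $L_2(\mu)$, is stable under every $P_t$ and under $\mathcal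 L$, and is such that for each of its members the limit defining $\mathcal L$ exists $\mu$-almost everywhere and also holds in $L_2(\mu)$. (Members of $\mathcal A$ need not be bounded.) For $d\ge1$, let $\mathbb H_d$ be the set of $d\times d$ complex Hermitian matrices; a function $f:\Omega\to\mathbb H_d$ is suitable if all of its entries belong to $\mathcal A$. Write $$\Gamma(f,g)=\tfrac12\big[\mathcal L(fg)-f\mathcal L(g)-\mathcal L(f)g\big],\qquad \Gamma_2(f,g)=\tfrac12\big[\mathcal L\Gamma(f,g)-\Gamma(f,\mathcal Lg)-\Gamma(\mathcal Lf,g)\big],$$ with $\Gamma(f)=\Gamma(f,f)$ and $\Gamma_2(f)=\Gamma_2(f,f)$. Assume that the Bakry–Émery criterion holds with a constant $c>0$: $\Gamma(f)\preccurlyeq c\,\Gamma_2(f)$ $\mu$-almost everywhere, in the positive-semidefinite order, for every suitable $f:\Omega\to\mathbb H_d$. Let $\bar{\mathrm{tr}}=d^{-1}\mathrm{tr}$. For suitable $f:\Omega\to\mathbb H_d$ put $$r_f(\beta)=\frac1\beta\log\mathbb E_\mu\,\bar{\mathrm{tr}}\,e^{\beta\Gamma(f)}\in[0,+\infty]\quad(\beta>0),\qquad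 v_f=\big\|\,\|\Gamma(f)\|\,\big\|_{L_\infty(\mu)}\in[0,+\infty],$$ where $\|\cdot\|$ is the $\ell_2$ operator norm. **Theorem (Exponential moments).** For every suitable $f:\Omega\to\mathbb H_d$, every $\beta>0$ and every $\theta\in(-\sqrt{\beta/c},\sqrt{\beta/c})$, $$\log\mathbb E_\mu\,\bar{\mathrm{tr}}\,e^{\theta(f-\mathbb E_\mu f)}\le\frac{c\,\theta^2\,r_f(\beta)}{2(1-c\theta^2/\beta)},$$ where $0\cdot(+\infty)=0$; in particular, the left side is finite whenever $r_f(\beta)$ is. Moreover, if $v_f<+\infty$, then for every $\theta\in\mathbb R$, $$\log\mathbb E_\mu\,\bar{\mathrm{tr}}\,e^{\theta(f-\mathbb E_\mu f)}\le\frac{c\,v_f\,\theta^2}{2}.$$ -/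

import Mathlib

open MeasureTheory ProbabilityTheory Filter Topology
open scoped NNReal ENNReal ComplexOrder

namespace MatrixMarkov

variable {Ω : Type*} [MeasurableSpace Ω] {d : ℕ}

/-- `κ t z` is the law of `Z_t` given `Z_0 = z`, for a time-homogeneous Markov process `Z`:
Markov kernels with `κ 0 = id` that satisfy the Chapman--Kolmogorov equations. -/
structure IsMarkovSemigroup (κ : ℝ≥0 → Kernel Ω Ω) : Prop where
  markov : ∀ t, IsMarkovKernel (κ t)
  zero : κ 0 = Kernel.id
  add : ∀ s t, κ (s + t) = κ t ∘ₖ κ s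

/-- The semigroup `(P_t f)(z) = 𝔼[f(Z_t) | Z_0 = z]`. -/
noncomputable def semigroup {E : Type*} [NormedAddCommGroup E] [NormedSpace ℝ E]
    (κ : ℝ≥0 → Kernel Ω Ω) (t : ℝ≥0) (f : Ω → E) (z : Ω) : E :=
  ∫ y, f y ∂(κ t z)

/-- `μ` is stationary: if `Z_0 ∼ μ` then `Z_t ∼ μ` for every `t`. -/
def IsStationary (κ : ℝ≥0 → Kernel Ω Ω) (μ : Measure Ω) : Prop :=
  ∀ t, μ.bind (κ t) = μ

/-- Each `P_t` is symmetric on (real) `L₂(μ)`. -/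
def IsReversible (κ : ℝ≥0 → Kernel Ω Ω) (μ : Measure Ω) : Prop :=
  ∀ (t : ℝ≥0) (f g : Ω → ℝ), MemLp f 2 μ → MemLp g 2 μ →
    ∫ z, semigroup κ t f z * g z ∂μ = ∫ z, f z * semigroup κ t g z ∂μ

/-- `P_t f → 𝔼_μ f` in `L₂(μ)` as `t → ∞`, for every real `f` in `L₂(μ)`. -/
def IsErgodic (κ : ℝ≥0 → Kernel Ω Ω) (μ : Measure Ω) : Prop :=
  ∀ f : Ω → ℝ, MemLp f 2 μ →
    Tendsto (fun t : ℝ≥0 => eLpNorm (fun z => semigroup κ t f z - ∫ y, f y ∂μ) 2 μ)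
      atTop (𝓝 0)

/-- The difference quotient `((P_t f)(z) - f(z)) / t`. -/
noncomputable def diffQuot (κ : ℝ≥0 → Kernel Ω Ω) (f : Ω → ℂ) (t : ℝ≥0) (z : Ω) : ℂ :=
  (semigroup κ t f z - f z) / ((t : ℝ) : ℂ)

open Classical in
/-- The infinitesimal generator on scalar functions,
`(𝓛 f)(z) = lim_{t ↓ 0} ((P_t f)(z) - f(z)) / t`, with value `0` where the limit does not exist. -/
noncomputable def generator (κ : ℝ≥0 → Kernel Ω Ω) (f : Ω → ℂ) (z : Ω) : ℂ :=
  if h : ∃ a : ℂ, Tendsto (fun t : ℝ≥0 => diffQuot κ f t z) (𝓝[>] 0) (𝓝 a) then h.choose else 0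

/-- An algebra of suitable functions for the semigroup: an algebra `𝒜` of complex functions on `Ω`
that contains the constants and is closed under complex conjugation (this is part of
`StarSubalgebra`), consists of square-integrable functions in the domain of the generator, and is
stable under the semigroup and the generator. -/
structure IsSuitableAlgebra (κ : ℝ≥0 → Kernel Ω Ω) (μ : Measure Ω)
    (𝒜 : StarSubalgebra ℂ (Ω → ℂ)) : Prop where
  measurable : ∀ f ∈ 𝒜, Measurable f
  memLp : ∀ f ∈ 𝒜, MemLp f 2 μ
  semigroup_mem : ∀ f ∈ 𝒜, ∀ t, semigroup κ t f ∈ 𝒜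
  generator_mem : ∀ f ∈ 𝒜, generator κ f ∈ 𝒜
  /-- the limit that defines `𝓛 f` exists almost everywhere -/
  tendsto_ae : ∀ f ∈ 𝒜, ∀ᵐ z ∂μ,
    Tendsto (fun t : ℝ≥0 => diffQuot κ f t z) (𝓝[>] 0) (𝓝 (generator κ f z))
  /-- the limit that defines `𝓛 f` also holds in `L₂(μ)` -/
  tendsto_L2 : ∀ f ∈ 𝒜,
    Tendsto (fun t : ℝ≥0 => eLpNorm (fun z => diffQuot κ f t z - generator κ f z) 2 μ)
      (𝓝[>] 0) (𝓝 0)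

/-- A suitable function `f : Ω → ℍ_d`: Hermitian values, entries in `𝒜`. -/
def IsSuitable (𝒜 : StarSubalgebra ℂ (Ω → ℂ)) (f : Ω → Matrix (Fin d) (Fin d) ℂ) : Prop :=
  (∀ z, (f z).IsHermitian) ∧ ∀ i j, (fun z => f z i j) ∈ 𝒜

/-- The generator on matrix-valued functions, which acts entry by entry. -/
noncomputable def matGenerator (κ : ℝ≥0 → Kernel Ω Ω) (f : Ω → Matrix (Fin d) (Fin d) ℂ) :
    Ω → Matrix (Fin d) (Fin d) ℂ :=
  fun z => Matrix.of fun i j => generator κ (fun y => f y i j) z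

/-- The matrix carré du champ
`Γ(f, g) = ½ [𝓛(f g) - f 𝓛(g) - 𝓛(f) g]`. -/
noncomputable def carre (κ : ℝ≥0 → Kernel Ω Ω) (f g : Ω → Matrix (Fin d) (Fin d) ℂ) :
    Ω → Matrix (Fin d) (Fin d) ℂ :=
  (1 / 2 : ℂ) • (matGenerator κ (f * g) - f * matGenerator κ g - matGenerator κ f * g)

/-- The iterated carré du champ
`Γ₂(f, g) = ½ [𝓛Γ(f, g) - Γ(f, 𝓛 g) - Γ(𝓛 f, g)]`. -/
noncomputable def carre₂ (κ : ℝ≥0 → Kernel Ω Ω) (f g : Ω → Matrix (Fin d) (Fin d) ℂ) :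
    Ω → Matrix (Fin d) (Fin d) ℂ :=
  (1 / 2 : ℂ) •
    (matGenerator κ (carre κ f g) - carre κ f (matGenerator κ g) - carre κ (matGenerator κ f) g)

/-- The matrix Bakry--Émery criterion in dimension `d`: `Γ(f) ≼ c · Γ₂(f)` almost everywhere, for
all suitable `f : Ω → ℍ_d`. -/
def BakryEmery (κ : ℝ≥0 → Kernel Ω Ω) (μ : Measure Ω) (𝒜 : StarSubalgebra ℂ (Ω → ℂ)) (d : ℕ)
    (c : ℝ) : Prop :=
  ∀ f : Ω → Matrix (Fin d) (Fin d) ℂ, IsSuitable 𝒜 f →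
    ∀ᵐ z ∂μ, ((c : ℂ) • carre₂ κ f f z - carre κ f f z).PosSemidef

/-- The entrywise expectation `𝔼_μ f` of a matrix-valued function. -/
noncomputable def matMean (μ : Measure Ω) (f : Ω → Matrix (Fin d) (Fin d) ℂ) :
    Matrix (Fin d) (Fin d) ℂ :=
  Matrix.of fun i j => ∫ z, f z i j ∂μ

/-- The normalized trace `d⁻¹ tr A` (real part; it is used for Hermitian `A`). -/
noncomputable def normTrace (A : Matrix (Fin d) (Fin d) ℂ) : ℝ :=
  A.trace.re / d

/-- `𝔼_μ tr̄ e^{g}` for a Hermitian-valued `g`, as an element of `[0, ∞]`. -/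
noncomputable def expMoment (μ : Measure Ω) (g : Ω → Matrix (Fin d) (Fin d) ℂ) : ℝ≥0∞ :=
  ∫⁻ z, ENNReal.ofReal (normTrace (NormedSpace.exp (g z))) ∂μ

/-- The logarithm `log 𝔼_μ tr̄ e^{θ (f - 𝔼_μ f)}` of the normalized trace mgf. -/
noncomputable def logTraceMgf (μ : Measure Ω) (f : Ω → Matrix (Fin d) (Fin d) ℂ) (θ : ℝ) : EReal :=
  ENNReal.log (expMoment μ fun z => (θ : ℂ) • (f z - matMean μ f))

/-- The exponential mean `r_f(β) = β⁻¹ log 𝔼_μ tr̄ e^{β Γ(f)}` of the carré du champ, which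
is `+∞` if the expectation is infinite. -/
noncomputable def expMean (κ : ℝ≥0 → Kernel Ω Ω) (μ : Measure Ω)
    (f : Ω → Matrix (Fin d) (Fin d) ℂ) (β : ℝ) : EReal :=
  ((β⁻¹ : ℝ) : EReal) * ENNReal.log (expMoment μ fun z => (β : ℂ) • carre κ f f z)

/-- The variance proxy `v_f = ‖ ‖Γ(f)‖ ‖_{L_∞(μ)}` in `[0, ∞]`, with the `ℓ₂` operator norm
inside. -/
noncomputable def varianceProxy (κ : ℝ≥0 → Kernel Ω Ω) (μ : Measure Ω)
    (f : Ω → Matrix (Fin d) (Fin d) ℂ) : ℝ≥0∞ :=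
  eLpNorm (fun z => ‖Matrix.toEuclideanCLM (𝕜 := ℂ) (carre κ f f z)‖) ∞ μ

end MatrixMarkov

/-! Put H = f - E f and M(θ) = E tr e^{θH}. The derivative M'(θ) = E tr[H e^{θH}] is the covariance
of f with φ(H), where φ(x) = e^{θx}. The proof bounds it by M and M' themselves and solves the
resulting differential inequality.

Covariance. By ergodicity it is the total decrease over s in [0, ∞) of E tr[f(Z_s) φ(H(Z_0))]. With
g = P_s f, stationarity and reversibility turn the decrease over a further time t into half of E
tr[(g(Z_t) - g(Z_0)) (φ(H(Z_t)) - φ(H(Z_0)))]. The matrices do not commute, but in the two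
eigenbases of H(Z_t) and H(Z_0) this trace is a double sum of scalars, and a scalar mean value bound
for φ with weight ψ = θφ controls it by the ψ(H)-weighted energies of f and g
(`trace_mul_cfc_sub_cfc_le`). As t tends to 0 these become E tr[Γ(f) ψ(H)] and E tr[Γ(P_s f) ψ(H)].

Curvature. The interpolation P_{t-s} Γ(P_s f) has right derivative -2 P_{t-s} Γ₂(P_s f), so the
Bakry–Émery criterion and Grönwall's inequality give, tested against positive weights, Γ(P_s f) ≼
e^{-2s/c} P_s Γ(f). Balancing the two energies leaves the rate e^{-s/c}, whose integral is c: the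
covariance is at most c times any bound, uniform in r, for E tr[Γ(f)(Z_r) ψ(H(Z_0))]
(`corr_zero_sub_le`).

Entropy. Young's inequality under the trace decouples Γ(f)(Z_r) from H(Z_0), and both marginals are
μ, so r disappears (`mul_corr_carre_le`). With Z = E tr e^{βΓ(f)} this gives (1 - cθ²/β) (log M)' ≤
(cθ/β) (log Z - log M), which the integrating factor (1 - cθ²/β)^{-1/2} solves. The bound by v_f
follows from r_f(β) ≤ v_f as β tends to infinity.

Analysis. Suitable functions are unbounded, so φ(x) = e^{θ min(x, N)} is used until N tends to
infinity, and every weight is a bounded matrix function. Identities for P_t, the generator and Γ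
hold only almost everywhere; they are stated for classes in L₂ or, for products, in L₁. -/

namespace MatrixMarkov

/-! ### The joint law of (Z_0, Z_t) and its symmetry -/

variable {Ω : Type*} [MeasurableSpace Ω]

/-- The law of `(Z_0, Z_t)` when `Z_0 ∼ μ`. -/
noncomputable abbrev jointLaw (κ : ℝ≥0 → Kernel Ω Ω) (μ : Measure Ω) (t : ℝ≥0) : Measure (Ω × Ω) :=
  μ ⊗ₘ κ t

/-- The standing assumptions: a reversible stationary Markov semigroup with an algebra of
suitable functions. -/
structure ReversibleAlgebra (κ : ℝ≥0 → Kernel Ω Ω) (μ : Measure Ω)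
    (𝒜 : StarSubalgebra ℂ (Ω → ℂ)) : Prop where
  prob : IsProbabilityMeasure μ
  markovSemigroup : IsMarkovSemigroup κ
  stationary : IsStationary κ μ
  reversible : IsReversible κ μ
  suitable : IsSuitableAlgebra κ μ 𝒜

namespace ReversibleAlgebra

variable {κ : ℝ≥0 → Kernel Ω Ω} {μ : Measure Ω} {𝒜 : StarSubalgebra ℂ (Ω → ℂ)}

theorem isMarkovKernel (h : ReversibleAlgebra κ μ 𝒜) (t : ℝ≥0) : IsMarkovKernel (κ t) :=
  h.markovSemigroup.markov t

theorem isProbabilityMeasure_jointLaw (h : ReversibleAlgebra κ μ 𝒜) (t : ℝ≥0) :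
    IsProbabilityMeasure (jointLaw κ μ t) := by
  have := h.prob
  have := h.isMarkovKernel t
  infer_instance

theorem measurePreserving_fst (h : ReversibleAlgebra κ μ 𝒜) (t : ℝ≥0) :
    MeasurePreserving Prod.fst (jointLaw κ μ t) μ := by
  have := h.prob
  have := h.isMarkovKernel t
  exact ⟨measurable_fst, Measure.fst_compProd μ (κ t)⟩

theorem measurePreserving_snd (h : ReversibleAlgebra κ μ 𝒜) (t : ℝ≥0) :
    MeasurePreserving Prod.snd (jointLaw κ μ t) μ := by
  have := h.prob
  have := h.isMarkovKernel t
  refine ⟨measurable_snd, ?_⟩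
  have := Measure.snd_compProd μ (κ t)
  rw [Measure.snd] at this
  rw [this]
  exact h.stationary t

/-- Rectangles determine the law, and on A × B the claim is the symmetry of P_t tested on two
indicator functions. In this form reversibility also applies to unbounded and matrix-valued
functions. -/
theorem map_swap_jointLaw (h : ReversibleAlgebra κ μ 𝒜) (t : ℝ≥0) :
    (jointLaw κ μ t).map Prod.swap = jointLaw κ μ t := by
  have := h.prob
  have := h.isMarkovKernel t
  symm
  refine Measure.ext_prod fun {A B} hA hB => ?_
  rw [Measure.map_apply measurable_swap (hA.prod hB), Set.preimage_swap_prod,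
    Measure.compProd_apply_prod hA hB, Measure.compProd_apply_prod hB hA]
  have key : ∀ {A B : Set Ω}, MeasurableSet A → MeasurableSet B →
      ∫ z, semigroup κ t (B.indicator 1) z * A.indicator (1 : Ω → ℝ) z ∂μ =
        (∫⁻ z in A, κ t z B ∂μ).toReal := by
    intro A B hA hB
    have h1 : ∀ z, semigroup κ t (B.indicator (1 : Ω → ℝ)) z = (κ t z B).toReal := by
      intro z
      simp only [semigroup]
      rw [integral_indicator_one hB]
      rfl
    rw [← integral_toReal ((κ t).measurable_coe hB).aemeasurable
      (ae_of_all _ fun z => measure_lt_top _ _), ← integral_indicator hA]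
    refine integral_congr_ae (ae_of_all _ fun z => ?_)
    by_cases hz : z ∈ A <;> simp [h1, hz]
  have h2 := h.reversible t (B.indicator 1) (A.indicator 1)
    (memLp_indicator_const 2 hB 1 (Or.inr (measure_ne_top _ _)))
    (memLp_indicator_const 2 hA 1 (Or.inr (measure_ne_top _ _)))
  have fin : ∀ A B : Set Ω, ∫⁻ z in A, κ t z B ∂μ ≠ ∞ := by
    intro A B
    refine ne_top_of_le_ne_top (measure_ne_top μ A) ?_
    calc ∫⁻ z in A, κ t z B ∂μ ≤ ∫⁻ z in A, 1 ∂μ := lintegral_mono fun z => prob_le_one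
      _ = μ A := by simp
  rw [key hA hB] at h2
  simp_rw [mul_comm (B.indicator (1 : Ω → ℝ) _)] at h2
  rw [key hB hA] at h2
  exact (ENNReal.toReal_eq_toReal_iff' (fin _ _) (fin _ _)).1 h2

theorem measurePreserving_swap (h : ReversibleAlgebra κ μ 𝒜) (t : ℝ≥0) :
    MeasurePreserving Prod.swap (jointLaw κ μ t) (jointLaw κ μ t) :=
  ⟨measurable_swap, h.map_swap_jointLaw t⟩

theorem integral_swap (h : ReversibleAlgebra κ μ 𝒜) (t : ℝ≥0) {E : Type*} [NormedAddCommGroup E]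
    [NormedSpace ℝ E] (F : Ω × Ω → E) :
    ∫ p, F p.swap ∂(jointLaw κ μ t) = ∫ p, F p ∂(jointLaw κ μ t) :=
  (h.measurePreserving_swap t).integral_comp MeasurableEquiv.prodComm.measurableEmbedding F

/-- Integration of `u(Z_t) v(Z_0)`. -/
theorem integral_semigroup_mul (h : ReversibleAlgebra κ μ 𝒜) (t : ℝ≥0) {u v : Ω → ℂ}
    (huv : Integrable (fun p : Ω × Ω => u p.2 * v p.1) (jointLaw κ μ t)) :
    ∫ z, semigroup κ t u z * v z ∂μ = ∫ p, u p.2 * v p.1 ∂(jointLaw κ μ t) := by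
  have := h.prob
  have := h.isMarkovKernel t
  rw [Measure.integral_compProd huv]
  simp only [semigroup, integral_mul_const]

/-- Stationarity makes u(Z_t) integrable under the joint law, and Fubini passes this to almost every
fibre. Since P_t is a Bochner integral with default value 0, its linearity is available only at such
points. -/
theorem ae_integrable (h : ReversibleAlgebra κ μ 𝒜) (t : ℝ≥0) {u : Ω → ℂ} (hu : Integrable u μ) :
    ∀ᵐ z ∂μ, Integrable u (κ t z) := by
  have := h.prob
  have := h.isMarkovKernel t
  have h1 := ((h.measurePreserving_snd t).integrable_comp hu.1).2 hu
  rw [Measure.integrable_compProd_iff h1.1] at h1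
  exact h1.1

end ReversibleAlgebra

end MatrixMarkov

/-! ### The semigroup and the generator on L₂ and L₁ classes -/

namespace MatrixMarkov

namespace ReversibleAlgebra

variable {Ω : Type*} [MeasurableSpace Ω]
variable {κ : ℝ≥0 → Kernel Ω Ω} {μ : Measure Ω} {𝒜 : StarSubalgebra ℂ (Ω → ℂ)}

theorem memLp_two (h : ReversibleAlgebra κ μ 𝒜) (u : 𝒜) : MemLp (u : Ω → ℂ) 2 μ :=
  h.suitable.memLp u u.2

theorem memLp_one (h : ReversibleAlgebra κ μ 𝒜) (u : 𝒜) : MemLp (u : Ω → ℂ) 1 μ :=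
  have := h.prob
  (h.memLp_two u).mono_exponent (by norm_num)

theorem integrable (h : ReversibleAlgebra κ μ 𝒜) (u : 𝒜) : Integrable (u : Ω → ℂ) μ :=
  memLp_one_iff_integrable.1 (h.memLp_one u)

theorem measurable (h : ReversibleAlgebra κ μ 𝒜) (u : 𝒜) : Measurable (u : Ω → ℂ) :=
  h.suitable.measurable u u.2

/-- The semigroup acting on the algebra of suitable functions. -/
noncomputable def P (h : ReversibleAlgebra κ μ 𝒜) (t : ℝ≥0) (u : 𝒜) : 𝒜 :=
  ⟨semigroup κ t u, h.suitable.semigroup_mem u u.2 t⟩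

/-- The generator acting on the algebra of suitable functions. -/
noncomputable def gen (h : ReversibleAlgebra κ μ 𝒜) (u : 𝒜) : 𝒜 :=
  ⟨generator κ u, h.suitable.generator_mem u u.2⟩

@[simp] theorem coe_P (h : ReversibleAlgebra κ μ 𝒜) (t : ℝ≥0) (u : 𝒜) :
    (h.P t u : Ω → ℂ) = semigroup κ t (u : Ω → ℂ) := rfl

@[simp] theorem coe_gen (h : ReversibleAlgebra κ μ 𝒜) (u : 𝒜) :
    (h.gen u : Ω → ℂ) = generator κ (u : Ω → ℂ) := rfl

/-- The class of a suitable function in `L₂(μ)`. -/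
noncomputable def toL2 (h : ReversibleAlgebra κ μ 𝒜) : 𝒜 →ₗ[ℂ] Lp ℂ 2 μ where
  toFun u := (h.memLp_two u).toLp u
  map_add' _ _ := rfl
  map_smul' _ _ := rfl

/-- The class of a suitable function in `L₁(μ)`. -/
noncomputable def toL1 (h : ReversibleAlgebra κ μ 𝒜) : 𝒜 →ₗ[ℂ] Lp ℂ 1 μ where
  toFun u := (h.memLp_one u).toLp u
  map_add' _ _ := rfl
  map_smul' _ _ := rfl

theorem toL2_eq_iff (h : ReversibleAlgebra κ μ 𝒜) {u v : 𝒜} :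
    h.toL2 u = h.toL2 v ↔ (u : Ω → ℂ) =ᵐ[μ] v :=
  MemLp.toLp_eq_toLp_iff (h.memLp_two u) (h.memLp_two v)

theorem toL1_eq_iff (h : ReversibleAlgebra κ μ 𝒜) {u v : 𝒜} :
    h.toL1 u = h.toL1 v ↔ (u : Ω → ℂ) =ᵐ[μ] v :=
  MemLp.toLp_eq_toLp_iff (h.memLp_one u) (h.memLp_one v)

theorem toL1_eq_of_toL2_eq (h : ReversibleAlgebra κ μ 𝒜) {u v : 𝒜} (huv : h.toL2 u = h.toL2 v) :
    h.toL1 u = h.toL1 v :=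
  h.toL1_eq_iff.2 (h.toL2_eq_iff.1 huv)

theorem norm_toL1 (h : ReversibleAlgebra κ μ 𝒜) (u : 𝒜) : ‖h.toL1 u‖ = ∫ z, ‖(u : Ω → ℂ) z‖ ∂μ := by
  have h1 : ‖h.toL1 u‖ = (eLpNorm (u : Ω → ℂ) 1 μ).toReal := Lp.norm_toLp _ (h.memLp_one u)
  rw [h1, toReal_eLpNorm (h.memLp_one u).1, lpNorm_one_eq_integral_norm (h.memLp_one u).1]

theorem norm_toL2_eq (h : ReversibleAlgebra κ μ 𝒜) (u : 𝒜) :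
    ‖h.toL2 u‖ = (eLpNorm (u : Ω → ℂ) 2 μ).toReal :=
  Lp.norm_toLp _ (h.memLp_two u)

theorem norm_toL2_sq (h : ReversibleAlgebra κ μ 𝒜) (u : 𝒜) :
    ‖h.toL2 u‖ ^ 2 = ∫ z, ‖(u : Ω → ℂ) z‖ ^ 2 ∂μ := by
  rw [norm_toL2_eq, toReal_eLpNorm (h.memLp_two u).1,
    lpNorm_eq_integral_norm_rpow_toReal (by norm_num) (by norm_num) (h.memLp_two u).1]
  rw [← Real.rpow_natCast, ← Real.rpow_mul (integral_nonneg fun z => by positivity)]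
  simp

theorem norm_toL1_le (h : ReversibleAlgebra κ μ 𝒜) (u : 𝒜) : ‖h.toL1 u‖ ≤ ‖h.toL2 u‖ := by
  have := h.prob
  have h1 : ‖h.toL1 u‖ = (eLpNorm (u : Ω → ℂ) 1 μ).toReal := Lp.norm_toLp _ (h.memLp_one u)
  rw [h1, norm_toL2_eq]
  exact ENNReal.toReal_mono (h.memLp_two u).2.ne
    (eLpNorm_le_eLpNorm_of_exponent_le (by norm_num) (h.memLp_two u).1)

theorem norm_toL1_mul_le (h : ReversibleAlgebra κ μ 𝒜) (u v : 𝒜) :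
    ‖h.toL1 (u * v)‖ ≤ ‖h.toL2 u‖ * ‖h.toL2 v‖ := by
  have h1 : ‖h.toL1 (u * v)‖ = (eLpNorm ((u : Ω → ℂ) * (v : Ω → ℂ)) 1 μ).toReal :=
    Lp.norm_toLp _ (h.memLp_one (u * v))
  rw [h1, norm_toL2_eq, norm_toL2_eq, ← ENNReal.toReal_mul]
  refine ENNReal.toReal_mono (ENNReal.mul_ne_top (h.memLp_two u).2.ne (h.memLp_two v).2.ne) ?_
  have := eLpNorm_smul_le_mul_eLpNorm (p := 2) (q := 2) (r := 1) (h.memLp_two v).1 (h.memLp_two u).1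
  simpa using this

theorem memLp_fst (h : ReversibleAlgebra κ μ 𝒜) (t : ℝ≥0) (u : 𝒜) :
    MemLp (fun p : Ω × Ω => (u : Ω → ℂ) p.1) 2 (jointLaw κ μ t) :=
  (h.memLp_two u).comp_measurePreserving (h.measurePreserving_fst t)

theorem memLp_snd (h : ReversibleAlgebra κ μ 𝒜) (t : ℝ≥0) (u : 𝒜) :
    MemLp (fun p : Ω × Ω => (u : Ω → ℂ) p.2) 2 (jointLaw κ μ t) :=
  (h.memLp_two u).comp_measurePreserving (h.measurePreserving_snd t)

theorem integral_P_mul (h : ReversibleAlgebra κ μ 𝒜) (t : ℝ≥0) (u v : 𝒜) :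
    ∫ z, (h.P t u : Ω → ℂ) z * (v : Ω → ℂ) z ∂μ =
      ∫ p, (u : Ω → ℂ) p.2 * (v : Ω → ℂ) p.1 ∂(jointLaw κ μ t) :=
  h.integral_semigroup_mul t ((h.memLp_snd t u).integrable_mul (h.memLp_fst t v))

theorem integral_comp_fst (h : ReversibleAlgebra κ μ 𝒜) (t : ℝ≥0) {E : Type*} [NormedAddCommGroup E]
    [NormedSpace ℝ E] {F : Ω → E} (hF : AEStronglyMeasurable F μ) :
    ∫ p, F p.1 ∂(jointLaw κ μ t) = ∫ z, F z ∂μ := by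
  have := (h.measurePreserving_fst t).map_eq
  conv_rhs => rw [← this]
  rw [integral_map measurable_fst.aemeasurable (by rwa [this])]

theorem integral_comp_snd (h : ReversibleAlgebra κ μ 𝒜) (t : ℝ≥0) {E : Type*} [NormedAddCommGroup E]
    [NormedSpace ℝ E] {F : Ω → E} (hF : AEStronglyMeasurable F μ) :
    ∫ p, F p.2 ∂(jointLaw κ μ t) = ∫ z, F z ∂μ := by
  have := (h.measurePreserving_snd t).map_eq
  conv_rhs => rw [← this]
  rw [integral_map measurable_snd.aemeasurable (by rwa [this])]

theorem norm_toL1_P_le (h : ReversibleAlgebra κ μ 𝒜) (t : ℝ≥0) (u : 𝒜) :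
    ‖h.toL1 (h.P t u)‖ ≤ ‖h.toL1 u‖ := by
  have := h.prob
  have := h.isMarkovKernel t
  have hi : Integrable (fun p : Ω × Ω => ‖(u : Ω → ℂ) p.2‖) (jointLaw κ μ t) :=
    ((h.memLp_snd t u).integrable (by norm_num)).norm
  rw [norm_toL1, norm_toL1, ← h.integral_comp_snd t (h.integrable u).norm.1,
    Measure.integral_compProd hi]
  exact integral_mono (h.integrable _).norm hi.integral_compProd fun z =>
    norm_integral_le_integral_norm _

/-- With q = P_t u, the square of the norm of q is Re E[u(Z_t) conj q(Z_0)]. Both marginals are μ,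
so this is at most half of ‖u‖² + ‖q‖², and the last term is absorbed. -/
theorem norm_toL2_P_le (h : ReversibleAlgebra κ μ 𝒜) (t : ℝ≥0) (u : 𝒜) :
    ‖h.toL2 (h.P t u)‖ ≤ ‖h.toL2 u‖ := by
  refine (sq_le_sq₀ (norm_nonneg _) (norm_nonneg _)).1 ?_
  set q := h.P t u with hq
  have h1 : (∫ z, ‖(q : Ω → ℂ) z‖ ^ 2 ∂μ : ℝ) =
      (∫ p, (u : Ω → ℂ) p.2 * (star q : 𝒜).1 p.1 ∂(jointLaw κ μ t)).re := by
    rw [← h.integral_P_mul t u (star q)]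
    have : ∀ z, (h.P t u : Ω → ℂ) z * (star q : 𝒜).1 z = ((‖(q : Ω → ℂ) z‖ ^ 2 : ℝ) : ℂ) := by
      intro z
      rw [← hq]
      have := Complex.mul_conj' ((q : Ω → ℂ) z)
      simpa using this
    simp_rw [this]
    rw [integral_complex_ofReal, Complex.ofReal_re]
  have hi1 : Integrable (fun p : Ω × Ω => ‖(u : Ω → ℂ) p.2‖ ^ 2) (jointLaw κ μ t) :=
    (h.memLp_snd t u).integrable_norm_pow (by norm_num)
  have hi2 : Integrable (fun p : Ω × Ω => ‖(q : Ω → ℂ) p.1‖ ^ 2) (jointLaw κ μ t) :=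
    (h.memLp_fst t q).integrable_norm_pow (by norm_num)
  have h2 : (∫ p, (u : Ω → ℂ) p.2 * (star q : 𝒜).1 p.1 ∂(jointLaw κ μ t)).re ≤
      ∫ p : Ω × Ω, (2⁻¹ * ‖(u : Ω → ℂ) p.2‖ ^ 2 + 2⁻¹ * ‖(q : Ω → ℂ) p.1‖ ^ 2) ∂(jointLaw κ μ t) := by
    refine (Complex.re_le_norm _).trans ((norm_integral_le_integral_norm _).trans ?_)
    refine integral_mono ((h.memLp_snd t u).integrable_mul (h.memLp_fst t (star q))).norm
      ((hi1.const_mul _).add (hi2.const_mul _)) fun p => ?_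
    have : ‖(star q : 𝒜).1 p.1‖ = ‖(q : Ω → ℂ) p.1‖ := by simp
    simp only [norm_mul, this]
    nlinarith [sq_nonneg (‖(u : Ω → ℂ) p.2‖ - ‖(q : Ω → ℂ) p.1‖)]
  rw [integral_add (hi1.const_mul _) (hi2.const_mul _), integral_const_mul, integral_const_mul,
    h.integral_comp_snd t (F := fun z => ‖(u : Ω → ℂ) z‖ ^ 2)
      ((h.measurable u).norm.pow_const 2).aestronglyMeasurable,
    h.integral_comp_fst t (F := fun z => ‖(q : Ω → ℂ) z‖ ^ 2)
      ((h.measurable q).norm.pow_const 2).aestronglyMeasurable,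
    ← h.norm_toL2_sq u, ← h.norm_toL2_sq q] at h2
  rw [← h.norm_toL2_sq q] at h1
  linarith

theorem toL2_P_add (h : ReversibleAlgebra κ μ 𝒜) (t : ℝ≥0) (u v : 𝒜) :
    h.toL2 (h.P t (u + v)) = h.toL2 (h.P t u) + h.toL2 (h.P t v) := by
  rw [← map_add, toL2_eq_iff]
  filter_upwards [h.ae_integrable t (h.integrable u), h.ae_integrable t (h.integrable v)]
    with z hu hv
  exact integral_add hu hv

theorem toL2_P_smul (h : ReversibleAlgebra κ μ 𝒜) (t : ℝ≥0) (a : ℂ) (u : 𝒜) :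
    h.toL2 (h.P t (a • u)) = a • h.toL2 (h.P t u) := by
  rw [← map_smul, toL2_eq_iff]
  refine ae_of_all _ fun z => ?_
  exact integral_smul a _

/-- `P_t` as a linear map from suitable functions to `L₂(μ)`. -/
noncomputable def semiL2 (h : ReversibleAlgebra κ μ 𝒜) (t : ℝ≥0) : 𝒜 →ₗ[ℂ] Lp ℂ 2 μ where
  toFun u := h.toL2 (h.P t u)
  map_add' := h.toL2_P_add t
  map_smul' := h.toL2_P_smul t

theorem toL2_P (h : ReversibleAlgebra κ μ 𝒜) (t : ℝ≥0) (u : 𝒜) :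
    h.toL2 (h.P t u) = h.semiL2 t u := rfl

theorem toL2_P_zero (h : ReversibleAlgebra κ μ 𝒜) (u : 𝒜) : h.P 0 u = u := by
  apply Subtype.ext
  ext z
  simp only [coe_P, semigroup, h.markovSemigroup.zero, Kernel.id_apply]
  exact integral_dirac' _ _ (h.measurable u).stronglyMeasurable

/-- Chapman–Kolmogorov needs u to be integrable for κ_{s+t}(z, ·), so the semigroup law holds only
almost everywhere. -/
theorem toL2_P_P (h : ReversibleAlgebra κ μ 𝒜) (s t : ℝ≥0) (u : 𝒜) :
    h.toL2 (h.P s (h.P t u)) = h.toL2 (h.P (s + t) u) := by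
  rw [toL2_eq_iff]
  filter_upwards [h.ae_integrable (s + t) (h.integrable u)] with z hz
  simp only [coe_P, semigroup]
  rw [h.markovSemigroup.add] at hz ⊢
  exact (Kernel.integral_comp hz).symm

theorem norm_toL2_P_sub_le (h : ReversibleAlgebra κ μ 𝒜) (t : ℝ≥0) (u v : 𝒜) :
    ‖h.toL2 (h.P t u) - h.toL2 (h.P t v)‖ ≤ ‖h.toL2 u - h.toL2 v‖ := by
  have := h.norm_toL2_P_le t (u - v)
  rwa [toL2_P, map_sub, map_sub, ← toL2_P, ← toL2_P] at this

theorem toL2_P_congr (h : ReversibleAlgebra κ μ 𝒜) (t : ℝ≥0) {u v : 𝒜}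
    (huv : h.toL2 u = h.toL2 v) : h.toL2 (h.P t u) = h.toL2 (h.P t v) := by
  have := h.norm_toL2_P_sub_le t u v
  rw [huv, sub_self, norm_zero] at this
  exact sub_eq_zero.1 (norm_le_zero_iff.1 this)

/-! ### The generator -/

theorem tendsto_gen (h : ReversibleAlgebra κ μ 𝒜) (u : 𝒜) :
    Tendsto (fun t : ℝ≥0 => ((t : ℝ) : ℂ)⁻¹ • (h.toL2 (h.P t u) - h.toL2 u)) (𝓝[>] 0)
      (𝓝 (h.toL2 (h.gen u))) := by
  rw [tendsto_iff_norm_sub_tendsto_zero]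
  have h1 : ∀ t : ℝ≥0, ‖((t : ℝ) : ℂ)⁻¹ • (h.toL2 (h.P t u) - h.toL2 u) - h.toL2 (h.gen u)‖ =
      (eLpNorm (fun z => diffQuot κ u t z - generator κ u z) 2 μ).toReal := by
    intro t
    rw [← map_sub, ← map_smul, ← map_sub, norm_toL2_eq]
    congr 2
    ext z
    simp [diffQuot, div_eq_inv_mul]
  simp_rw [h1]
  have := h.suitable.tendsto_L2 u u.2
  exact (ENNReal.tendsto_toReal ENNReal.zero_ne_top).comp this

theorem toL2_gen_unique (h : ReversibleAlgebra κ μ 𝒜) (u : 𝒜) {x : Lp ℂ 2 μ}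
    (hx : Tendsto (fun t : ℝ≥0 => ((t : ℝ) : ℂ)⁻¹ • (h.toL2 (h.P t u) - h.toL2 u)) (𝓝[>] 0) (𝓝 x)) :
    h.toL2 (h.gen u) = x :=
  tendsto_nhds_unique (h.tendsto_gen u) hx

/-- The generator as a linear map from suitable functions to `L₂(μ)`. -/
noncomputable def genL2 (h : ReversibleAlgebra κ μ 𝒜) : 𝒜 →ₗ[ℂ] Lp ℂ 2 μ where
  toFun u := h.toL2 (h.gen u)
  -- The pointwise generator takes the value 0 where the limit fails and need not be additive
  -- everywhere; linearity of its class comes from uniqueness of limits in L₂.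
  map_add' u v := by
    refine h.toL2_gen_unique _ (((h.tendsto_gen u).add (h.tendsto_gen v)).congr fun t => ?_)
    simp only [toL2_P, map_add, ← smul_add]
    congr 1
    abel
  map_smul' a u := by
    refine h.toL2_gen_unique _ (((h.tendsto_gen u).const_smul a).congr fun t => ?_)
    simp only [toL2_P, map_smul, ← smul_sub]
    exact smul_comm _ _ _

theorem toL2_gen (h : ReversibleAlgebra κ μ 𝒜) (u : 𝒜) : h.toL2 (h.gen u) = h.genL2 u := rfl

theorem toL2_gen_congr (h : ReversibleAlgebra κ μ 𝒜) {u v : 𝒜}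
    (huv : h.toL2 u = h.toL2 v) : h.toL2 (h.gen u) = h.toL2 (h.gen v) := by
  refine h.toL2_gen_unique u ((h.tendsto_gen v).congr fun t => ?_)
  rw [h.toL2_P_congr t huv, huv]

/-- P_t commutes with the difference quotients of u in L₂ and is a contraction, so it carries their
convergence along. -/
theorem toL2_gen_P (h : ReversibleAlgebra κ μ 𝒜) (t : ℝ≥0) (u : 𝒜) :
    h.toL2 (h.gen (h.P t u)) = h.toL2 (h.P t (h.gen u)) := by
  refine h.toL2_gen_unique _ ?_
  rw [tendsto_iff_norm_sub_tendsto_zero]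
  refine squeeze_zero (fun _ => norm_nonneg _) (fun s => ?_)
    (tendsto_iff_norm_sub_tendsto_zero.1 (h.tendsto_gen u))
  have h1 : ((s : ℝ) : ℂ)⁻¹ • (h.toL2 (h.P s (h.P t u)) - h.toL2 (h.P t u)) -
      h.toL2 (h.P t (h.gen u)) =
      h.toL2 (h.P t (((s : ℝ) : ℂ)⁻¹ • (h.P s u - u) - h.gen u)) := by
    rw [toL2_P_P, add_comm, ← toL2_P_P]
    simp only [toL2_P, map_sub, map_smul]
  rw [h1]
  refine (h.norm_toL2_P_le t _).trans (le_of_eq ?_)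
  simp only [map_sub, map_smul]

/-- Cut [0, t] into n equal steps. Each increment is a contraction of the first one, so the total is
at most n ‖P_{t/n} u - u‖, which tends to t ‖𝓛u‖. No integration of the semigroup is needed. -/
theorem norm_toL2_P_sub_le_mul (h : ReversibleAlgebra κ μ 𝒜) (t : ℝ≥0) (u : 𝒜) :
    ‖h.toL2 (h.P t u) - h.toL2 u‖ ≤ t * ‖h.toL2 (h.gen u)‖ := by
  rcases eq_or_ne t 0 with rfl | ht
  · simp [toL2_P_zero]
  have step : ∀ (s : ℝ≥0) (n : ℕ),
      ‖h.toL2 (h.P (n * s) u) - h.toL2 u‖ ≤ n * ‖h.toL2 (h.P s u) - h.toL2 u‖ := by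
    intro s n
    induction n with
    | zero => simp [toL2_P_zero]
    | succ n ih =>
      have h1 : h.toL2 (h.P ((n + 1 : ℕ) * s) u) = h.toL2 (h.P s (h.P (n * s) u)) := by
        rw [toL2_P_P]
        congr 2
        push_cast
        ring
      calc ‖h.toL2 (h.P ((n + 1 : ℕ) * s) u) - h.toL2 u‖
          ≤ ‖h.toL2 (h.P s (h.P (n * s) u)) - h.toL2 (h.P s u)‖ +
            ‖h.toL2 (h.P s u) - h.toL2 u‖ := by
            rw [h1]; exact norm_sub_le_norm_sub_add_norm_sub _ _ _
        _ ≤ n * ‖h.toL2 (h.P s u) - h.toL2 u‖ + ‖h.toL2 (h.P s u) - h.toL2 u‖ := by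
            gcongr
            exact (h.norm_toL2_P_sub_le s _ _).trans ih
        _ = _ := by push_cast; ring
  have hlim : Tendsto (fun n : ℕ => t / ((n : ℝ≥0) + 1)) atTop (𝓝[>] 0) := by
    refine tendsto_nhdsWithin_iff.2 ⟨?_, Eventually.of_forall fun n => ?_⟩
    · rw [← NNReal.tendsto_coe]
      have := (tendsto_const_div_atTop_nhds_zero_nat (t : ℝ)).comp (tendsto_add_atTop_nat 1)
      simpa [Function.comp_def] using this
    · exact div_pos (pos_iff_ne_zero.2 ht) (by positivity)
  have h2 := ((h.tendsto_gen u).norm.comp hlim).const_mul (t : ℝ)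
  refine ge_of_tendsto h2 (Eventually.of_forall fun n => ?_)
  have h3 := step (t / ((n : ℝ≥0) + 1)) (n + 1)
  have h4 : ((n + 1 : ℕ) : ℝ≥0) * (t / ((n : ℝ≥0) + 1)) = t := by
    push_cast
    field_simp
  rw [h4] at h3
  refine h3.trans (le_of_eq ?_)
  have ht' : (t : ℝ) ≠ 0 := by exact_mod_cast ht
  have hn : (0 : ℝ) < (n : ℝ) + 1 := by positivity
  have h5 : |(t : ℝ) / ((n : ℝ) + 1)| = t / (n + 1) := abs_of_nonneg (by positivity)
  simp only [Function.comp_apply, norm_smul, norm_inv, Complex.norm_real, NNReal.coe_div,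
    NNReal.coe_add, NNReal.coe_natCast, NNReal.coe_one, Real.norm_eq_abs, h5, Nat.cast_add,
    Nat.cast_one]
  field_simp

theorem norm_toL2_P_sub_P_le (h : ReversibleAlgebra κ μ 𝒜) (s t : ℝ≥0) (u : 𝒜) :
    ‖h.toL2 (h.P s u) - h.toL2 (h.P t u)‖ ≤ |(s : ℝ) - t| * ‖h.toL2 (h.gen u)‖ := by
  wlog hst : t ≤ s generalizing s t
  · rw [norm_sub_rev, abs_sub_comm]
    exact this t s (le_of_not_ge hst)
  obtain ⟨r, rfl⟩ := exists_add_of_le hst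
  rw [← toL2_P_P]
  refine (h.norm_toL2_P_sub_le t _ _).trans ((h.norm_toL2_P_sub_le_mul r u).trans (le_of_eq ?_))
  simp

end ReversibleAlgebra

end MatrixMarkov

/-! ### The scalar carré du champ in L₁ -/

namespace MatrixMarkov

theorem integral_norm_mul_le_sqrt {α : Type*} [MeasurableSpace α] {ν : Measure α} {f g : α → ℂ}
    (hf : MemLp f 2 ν) (hg : MemLp g 2 ν) :
    ∫ x, ‖f x * g x‖ ∂ν ≤ √(∫ x, ‖f x‖ ^ 2 ∂ν) * √(∫ x, ‖g x‖ ^ 2 ∂ν) := by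
  have key : ∀ {f : α → ℂ}, MemLp f 2 ν → (eLpNorm f 2 ν).toReal = √(∫ x, ‖f x‖ ^ 2 ∂ν) := by
    intro f hf
    rw [toReal_eLpNorm hf.1, lpNorm_eq_integral_norm_rpow_toReal (by norm_num) (by norm_num) hf.1,
      Real.sqrt_eq_rpow]
    simp
  have h1 : ∫ x, ‖f x * g x‖ ∂ν = (eLpNorm (f * g) 1 ν).toReal := by
    rw [toReal_eLpNorm (hf.1.mul hg.1), lpNorm_one_eq_integral_norm (hf.1.mul hg.1)]
    rfl
  rw [h1, ← key hf, ← key hg, ← ENNReal.toReal_mul]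
  refine ENNReal.toReal_mono (ENNReal.mul_ne_top hf.2.ne hg.2.ne) ?_
  simpa using eLpNorm_smul_le_mul_eLpNorm (p := 2) (q := 2) (r := 1) hg.1 hf.1

namespace ReversibleAlgebra

variable {Ω : Type*} [MeasurableSpace Ω]
variable {κ : ℝ≥0 → Kernel Ω Ω} {μ : Measure Ω} {𝒜 : StarSubalgebra ℂ (Ω → ℂ)}

theorem toL1_P_add (h : ReversibleAlgebra κ μ 𝒜) (t : ℝ≥0) (u v : 𝒜) :
    h.toL1 (h.P t (u + v)) = h.toL1 (h.P t u) + h.toL1 (h.P t v) := by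
  rw [← map_add]
  exact h.toL1_eq_of_toL2_eq (by simp only [toL2_P, map_add])

theorem toL1_P_smul (h : ReversibleAlgebra κ μ 𝒜) (t : ℝ≥0) (a : ℂ) (u : 𝒜) :
    h.toL1 (h.P t (a • u)) = a • h.toL1 (h.P t u) := by
  rw [← map_smul]
  exact h.toL1_eq_of_toL2_eq (by simp only [toL2_P, map_smul])

/-- `P_t` as a linear map from suitable functions to `L₁(μ)`. -/
noncomputable def semiL1 (h : ReversibleAlgebra κ μ 𝒜) (t : ℝ≥0) : 𝒜 →ₗ[ℂ] Lp ℂ 1 μ where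
  toFun u := h.toL1 (h.P t u)
  map_add' := h.toL1_P_add t
  map_smul' := h.toL1_P_smul t

theorem toL1_P (h : ReversibleAlgebra κ μ 𝒜) (t : ℝ≥0) (u : 𝒜) :
    h.toL1 (h.P t u) = h.semiL1 t u := rfl

theorem norm_semiL1_le (h : ReversibleAlgebra κ μ 𝒜) (t : ℝ≥0) (u : 𝒜) :
    ‖h.semiL1 t u‖ ≤ ‖h.toL1 u‖ := h.norm_toL1_P_le t u

theorem semiL1_congr (h : ReversibleAlgebra κ μ 𝒜) (t : ℝ≥0) {u v : 𝒜}
    (huv : h.toL1 u = h.toL1 v) : h.semiL1 t u = h.semiL1 t v := by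
  have := h.norm_semiL1_le t (u - v)
  rw [map_sub, map_sub, huv, sub_self, norm_zero] at this
  exact sub_eq_zero.1 (norm_le_zero_iff.1 this)

theorem semiL1_P (h : ReversibleAlgebra κ μ 𝒜) (s t : ℝ≥0) (u : 𝒜) :
    h.semiL1 s (h.P t u) = h.semiL1 (s + t) u :=
  h.toL1_eq_of_toL2_eq (h.toL2_P_P s t u)

theorem norm_semiL1_sub_semiL1_le (h : ReversibleAlgebra κ μ 𝒜) (s t : ℝ≥0) (u : 𝒜) :
    ‖h.semiL1 s u - h.semiL1 t u‖ ≤ |(s : ℝ) - t| * ‖h.toL2 (h.gen u)‖ := by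
  refine le_trans ?_ (h.norm_toL2_P_sub_P_le s t u)
  rw [← toL1_P, ← toL1_P, ← map_sub, ← map_sub]
  exact h.norm_toL1_le _

/-- The generator as a linear map from suitable functions to `L₁(μ)`. -/
noncomputable def genL1 (h : ReversibleAlgebra κ μ 𝒜) : 𝒜 →ₗ[ℂ] Lp ℂ 1 μ where
  toFun u := h.toL1 (h.gen u)
  map_add' u v := by
    rw [← map_add]
    exact h.toL1_eq_of_toL2_eq (by simp only [toL2_gen, map_add])
  map_smul' a u := by
    rw [RingHom.id_apply, ← map_smul]
    exact h.toL1_eq_of_toL2_eq (by simp only [toL2_gen, map_smul])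

theorem toL1_gen (h : ReversibleAlgebra κ μ 𝒜) (u : 𝒜) : h.toL1 (h.gen u) = h.genL1 u := rfl

theorem tendsto_genL1 (h : ReversibleAlgebra κ μ 𝒜) (u : 𝒜) :
    Tendsto (fun t : ℝ≥0 => ((t : ℝ) : ℂ)⁻¹ • (h.semiL1 t u - h.toL1 u)) (𝓝[>] 0)
      (𝓝 (h.genL1 u)) := by
  rw [tendsto_iff_norm_sub_tendsto_zero]
  refine squeeze_zero (fun _ => norm_nonneg _) (fun t => ?_)
    (tendsto_iff_norm_sub_tendsto_zero.1 (h.tendsto_gen u))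
  rw [← toL1_P, ← toL1_gen, ← map_sub, ← map_smul, ← map_sub, ← map_sub, ← map_smul, ← map_sub]
  exact h.norm_toL1_le _

theorem toL1_mul_congr (h : ReversibleAlgebra κ μ 𝒜) {u v : 𝒜} (w : 𝒜)
    (huv : h.toL1 u = h.toL1 v) : h.toL1 (u * w) = h.toL1 (v * w) := by
  rw [toL1_eq_iff] at *
  filter_upwards [huv] with z hz
  simp [hz]

theorem norm_toL2_star (h : ReversibleAlgebra κ μ 𝒜) (u : 𝒜) : ‖h.toL2 (star u)‖ = ‖h.toL2 u‖ := by
  refine (sq_eq_sq₀ (norm_nonneg _) (norm_nonneg _)).1 ?_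
  rw [norm_toL2_sq, norm_toL2_sq]
  simp

theorem norm_integral_le_norm_toL1 (h : ReversibleAlgebra κ μ 𝒜) (u : 𝒜) :
    ‖∫ z, (u : Ω → ℂ) z ∂μ‖ ≤ ‖h.toL1 u‖ := by
  rw [norm_toL1]
  exact norm_integral_le_integral_norm _

/-- The carré du champ of scalar suitable functions. -/
noncomputable def Gam (h : ReversibleAlgebra κ μ 𝒜) (u v : 𝒜) : 𝒜 :=
  (1 / 2 : ℂ) • (h.gen (u * v) - u * h.gen v - h.gen u * v)

/-- The conditional expectation of `(u(Z_t) - u(Z_0)) (v(Z_t) - v(Z_0))` given `Z_0`. -/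
noncomputable def incr (h : ReversibleAlgebra κ μ 𝒜) (t : ℝ≥0) (u v : 𝒜) : 𝒜 :=
  (h.P t (u * v) - u * v) - u * (h.P t v - v) - (h.P t u - u) * v

theorem incr_ae (h : ReversibleAlgebra κ μ 𝒜) (t : ℝ≥0) (u v : 𝒜) :
    ∀ᵐ z ∂μ, (h.incr t u v : Ω → ℂ) z = ∫ y, ((u : Ω → ℂ) y - (u : Ω → ℂ) z) *
      ((v : Ω → ℂ) y - (v : Ω → ℂ) z) ∂(κ t z) := by
  have := h.isMarkovKernel t
  filter_upwards [h.ae_integrable t (h.integrable u), h.ae_integrable t (h.integrable v),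
    h.ae_integrable t (h.integrable (u * v))] with z hu hv huv
  have e : ∀ y, ((u : Ω → ℂ) y - (u : Ω → ℂ) z) * ((v : Ω → ℂ) y - (v : Ω → ℂ) z) =
      ((u * v : 𝒜) : Ω → ℂ) y - (u : Ω → ℂ) z * (v : Ω → ℂ) y - (v : Ω → ℂ) z * (u : Ω → ℂ) y +
        (u : Ω → ℂ) z * (v : Ω → ℂ) z := by
    intro y
    simp only [MulMemClass.coe_mul, Pi.mul_apply]
    ring
  simp_rw [e]
  have i1 : Integrable (fun y => ((u * v : 𝒜) : Ω → ℂ) y - (u : Ω → ℂ) z * (v : Ω → ℂ) y) (κ t z) :=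
    huv.sub (hv.const_mul _)
  have i2 : Integrable (fun y => ((u * v : 𝒜) : Ω → ℂ) y - (u : Ω → ℂ) z * (v : Ω → ℂ) y -
      (v : Ω → ℂ) z * (u : Ω → ℂ) y) (κ t z) := i1.sub (hu.const_mul _)
  rw [integral_add i2 (integrable_const _), integral_sub i1 (hu.const_mul _),
    integral_sub huv (hv.const_mul _), integral_const_mul, integral_const_mul]
  simp [incr, semigroup]
  ring

theorem memLp_sub (h : ReversibleAlgebra κ μ 𝒜) (t : ℝ≥0) (u : 𝒜) :
    MemLp (fun p : Ω × Ω => (u : Ω → ℂ) p.2 - (u : Ω → ℂ) p.1) 2 (jointLaw κ μ t) :=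
  (h.memLp_snd t u).sub (h.memLp_fst t u)

theorem integral_incr_mul (h : ReversibleAlgebra κ μ 𝒜) (t : ℝ≥0) (u v : 𝒜) {w : Ω → ℂ}
    (hw : Measurable w) {K : ℝ} (hK : ∀ z, ‖w z‖ ≤ K) :
    ∫ z, (h.incr t u v : Ω → ℂ) z * w z ∂μ =
      ∫ p, ((u : Ω → ℂ) p.2 - (u : Ω → ℂ) p.1) * ((v : Ω → ℂ) p.2 - (v : Ω → ℂ) p.1) * w p.1
        ∂(jointLaw κ μ t) := by
  have := h.prob
  have := h.isMarkovKernel t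
  have hi : Integrable (fun p : Ω × Ω => ((u : Ω → ℂ) p.2 - (u : Ω → ℂ) p.1) *
      ((v : Ω → ℂ) p.2 - (v : Ω → ℂ) p.1) * w p.1) (jointLaw κ μ t) :=
    ((h.memLp_sub t u).integrable_mul (h.memLp_sub t v)).mul_bdd (c := K)
      (hw.comp measurable_fst).aestronglyMeasurable (ae_of_all _ fun p => hK p.1)
  rw [Measure.integral_compProd hi]
  refine integral_congr_ae ?_
  filter_upwards [h.incr_ae t u v] with z hz
  rw [hz, integral_mul_const]

theorem norm_toL1_incr_le (h : ReversibleAlgebra κ μ 𝒜) (t : ℝ≥0) (u v : 𝒜) :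
    ‖h.toL1 (h.incr t u v)‖ ≤
      ∫ p, ‖((u : Ω → ℂ) p.2 - (u : Ω → ℂ) p.1) * ((v : Ω → ℂ) p.2 - (v : Ω → ℂ) p.1)‖
        ∂(jointLaw κ μ t) := by
  have := h.prob
  have := h.isMarkovKernel t
  have hi : Integrable (fun p : Ω × Ω => ‖((u : Ω → ℂ) p.2 - (u : Ω → ℂ) p.1) *
      ((v : Ω → ℂ) p.2 - (v : Ω → ℂ) p.1)‖) (jointLaw κ μ t) :=
    ((h.memLp_sub t u).integrable_mul (h.memLp_sub t v)).norm
  rw [norm_toL1, Measure.integral_compProd hi]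
  refine integral_mono_ae (h.integrable _).norm hi.integral_compProd ?_
  filter_upwards [h.incr_ae t u v] with z hz
  simp only [hz]
  exact norm_integral_le_integral_norm _

/-- By stationarity the left side is 2 Re ⟨u - P_t u, u⟩, and u - P_t u has L₂ norm at most t ‖𝓛u‖.
-/
theorem integral_norm_sub_sq_le (h : ReversibleAlgebra κ μ 𝒜) (t : ℝ≥0) (u : 𝒜) :
    ∫ p, ‖(u : Ω → ℂ) p.2 - (u : Ω → ℂ) p.1‖ ^ 2 ∂(jointLaw κ μ t) ≤
      2 * t * (‖h.toL2 u‖ * ‖h.toL2 (h.gen u)‖) := by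
  have i1 : Integrable (fun p : Ω × Ω => ‖(u : Ω → ℂ) p.2‖ ^ 2) (jointLaw κ μ t) :=
    (h.memLp_snd t u).integrable_norm_pow (by norm_num)
  have i2 : Integrable (fun p : Ω × Ω => ‖(u : Ω → ℂ) p.1‖ ^ 2) (jointLaw κ μ t) :=
    (h.memLp_fst t u).integrable_norm_pow (by norm_num)
  have i3 : Integrable (fun p : Ω × Ω => (u : Ω → ℂ) p.2 * (star u : 𝒜).1 p.1) (jointLaw κ μ t) :=
    (h.memLp_snd t u).integrable_mul (h.memLp_fst t (star u))
  have e : ∀ p : Ω × Ω, ‖(u : Ω → ℂ) p.2 - (u : Ω → ℂ) p.1‖ ^ 2 = ‖(u : Ω → ℂ) p.2‖ ^ 2 +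
      ‖(u : Ω → ℂ) p.1‖ ^ 2 - 2 * ((u : Ω → ℂ) p.2 * (star u : 𝒜).1 p.1).re := by
    intro p
    have := Complex.normSq_sub ((u : Ω → ℂ) p.2) ((u : Ω → ℂ) p.1)
    simpa [Complex.normSq_eq_norm_sq] using this
  have i3' : Integrable (fun p : Ω × Ω => 2 * ((u : Ω → ℂ) p.2 * (star u : 𝒜).1 p.1).re)
      (jointLaw κ μ t) := i3.re.const_mul 2
  simp_rw [e]
  have i12 : Integrable (fun p : Ω × Ω => ‖(u : Ω → ℂ) p.2‖ ^ 2 + ‖(u : Ω → ℂ) p.1‖ ^ 2)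
      (jointLaw κ μ t) := i1.add i2
  rw [integral_sub i12 i3', integral_add i1 i2,
    h.integral_comp_snd t (F := fun z => ‖(u : Ω → ℂ) z‖ ^ 2)
      ((h.measurable u).norm.pow_const 2).aestronglyMeasurable,
    h.integral_comp_fst t (F := fun z => ‖(u : Ω → ℂ) z‖ ^ 2)
      ((h.measurable u).norm.pow_const 2).aestronglyMeasurable, integral_const_mul]
  have e2 : ∫ p : Ω × Ω, ((u : Ω → ℂ) p.2 * (star u : 𝒜).1 p.1).re ∂(jointLaw κ μ t) =
      (∫ z, (h.P t u : Ω → ℂ) z * (star u : 𝒜).1 z ∂μ).re := by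
    rw [h.integral_P_mul t u (star u)]
    exact integral_re i3
  have e3 : (∫ z, ‖(u : Ω → ℂ) z‖ ^ 2 ∂μ) = (∫ z, (u : Ω → ℂ) z * (star u : 𝒜).1 z ∂μ).re := by
    have : ∀ z, (u : Ω → ℂ) z * (star u : 𝒜).1 z = ((‖(u : Ω → ℂ) z‖ ^ 2 : ℝ) : ℂ) := by
      intro z
      simpa using Complex.mul_conj' ((u : Ω → ℂ) z)
    simp_rw [this]
    rw [integral_complex_ofReal, Complex.ofReal_re]
  have e4 : (∫ z, (u : Ω → ℂ) z * (star u : 𝒜).1 z ∂μ) - ∫ z, (h.P t u : Ω → ℂ) z * (star u : 𝒜).1 z ∂μ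
      = ∫ z, ((u - h.P t u) * star u : 𝒜).1 z ∂μ := by
    refine (integral_sub (h.integrable (u * star u)) (h.integrable (h.P t u * star u))).symm.trans ?_
    refine integral_congr_ae (ae_of_all _ fun z => ?_)
    simp [sub_mul]
  have e5 : ‖∫ z, ((u - h.P t u) * star u : 𝒜).1 z ∂μ‖ ≤
      t * (‖h.toL2 u‖ * ‖h.toL2 (h.gen u)‖) := by
    calc _ ≤ ‖h.toL2 (u - h.P t u)‖ * ‖h.toL2 (star u)‖ :=
          (h.norm_integral_le_norm_toL1 _).trans (h.norm_toL1_mul_le _ _)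
      _ ≤ (t * ‖h.toL2 (h.gen u)‖) * ‖h.toL2 u‖ := by
          rw [norm_toL2_star, map_sub, norm_sub_rev]
          gcongr
          exact h.norm_toL2_P_sub_le_mul t u
      _ = _ := by ring
  rw [e2, e3]
  have e6 := (Complex.re_le_norm _).trans e5
  rw [← e4, Complex.sub_re] at e6
  linarith

/-- `incr` is twice the expression for Γ with each 𝓛w replaced by P_t w - w. The products with an
unbounded factor converge by Cauchy–Schwarz, which is why the limit is taken in L₁. -/
theorem tendsto_incr (h : ReversibleAlgebra κ μ 𝒜) (u v : 𝒜) :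
    Tendsto (fun t : ℝ≥0 => ((2 * t : ℝ) : ℂ)⁻¹ • h.toL1 (h.incr t u v)) (𝓝[>] 0)
      (𝓝 (h.toL1 (h.Gam u v))) := by
  have mulR : ∀ u v : 𝒜, Tendsto (fun t : ℝ≥0 => h.toL1 ((((t : ℝ) : ℂ)⁻¹ • (h.P t u - u)) * v))
      (𝓝[>] 0) (𝓝 (h.toL1 (h.gen u * v))) := by
    intro u v
    rw [tendsto_iff_norm_sub_tendsto_zero]
    refine squeeze_zero (fun _ => norm_nonneg _) (fun t => ?_)
      (by simpa using (tendsto_iff_norm_sub_tendsto_zero.1 (h.tendsto_gen u)).mul_const ‖h.toL2 v‖)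
    rw [← map_sub, ← sub_mul, ← map_sub, ← map_smul, ← map_sub]
    exact h.norm_toL1_mul_le _ _
  have h1 := (((h.tendsto_genL1 (u * v)).sub (mulR v u)).sub (mulR u v)).const_smul (1 / 2 : ℂ)
  have e : h.toL1 (h.Gam u v) = (1 / 2 : ℂ) • (h.genL1 (u * v) - h.toL1 (h.gen v * u) -
      h.toL1 (h.gen u * v)) := by
    rw [Gam, map_smul, map_sub, map_sub, mul_comm u (h.gen v), toL1_gen]
  rw [e]
  refine h1.congr fun t => ?_
  rw [← toL1_P, ← map_sub, ← map_smul, ← map_sub, ← map_sub, ← map_smul, ← map_smul]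
  congr 1
  simp only [incr, smul_mul_assoc, ← smul_sub, smul_smul]
  rw [mul_comm u (h.P t v - v)]
  congr 1
  push_cast
  rw [mul_inv]
  norm_num

/-- The graph norm of the generator. -/
noncomputable def graphNorm (h : ReversibleAlgebra κ μ 𝒜) (u : 𝒜) : ℝ :=
  ‖h.toL2 u‖ + ‖h.genL2 u‖

theorem graphNorm_nonneg (h : ReversibleAlgebra κ μ 𝒜) (u : 𝒜) : 0 ≤ h.graphNorm u := by
  unfold graphNorm; positivity

/-- The term 𝓛(uv) is not directly controlled by u and v. The increments are: Cauchy–Schwarz on the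
joint law gives 2t times the product of graph norms, and the bound passes to the limit. Continuity
and differentiation of s ↦ Γ(P_s u, P_s v) rest on it. -/
theorem norm_toL1_Gam_le (h : ReversibleAlgebra κ μ 𝒜) (u v : 𝒜) :
    ‖h.toL1 (h.Gam u v)‖ ≤ h.graphNorm u * h.graphNorm v := by
  refine le_of_tendsto (h.tendsto_incr u v).norm ?_
  filter_upwards [self_mem_nhdsWithin] with t ht
  have ht : (0 : ℝ) < t := by exact_mod_cast ht
  have h0 : ∀ u : 𝒜, √(∫ p, ‖(u : Ω → ℂ) p.2 - (u : Ω → ℂ) p.1‖ ^ 2 ∂(jointLaw κ μ t)) ≤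
      √(2 * t) * h.graphNorm u := by
    intro u
    rw [Real.sqrt_le_left (mul_nonneg (Real.sqrt_nonneg _) (h.graphNorm_nonneg u)), mul_pow,
      Real.sq_sqrt (by positivity)]
    refine (h.integral_norm_sub_sq_le t u).trans ?_
    gcongr
    unfold graphNorm
    rw [toL2_gen]
    nlinarith [norm_nonneg (h.toL2 u), norm_nonneg (h.genL2 u)]
  have h1 : ‖h.toL1 (h.incr t u v)‖ ≤ (2 * t) * (h.graphNorm u * h.graphNorm v) := by
    refine (h.norm_toL1_incr_le t u v).trans
      ((integral_norm_mul_le_sqrt (h.memLp_sub t u) (h.memLp_sub t v)).trans ?_)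
    calc _ ≤ (√(2 * t) * h.graphNorm u) * (√(2 * t) * h.graphNorm v) :=
          mul_le_mul (h0 u) (h0 v) (Real.sqrt_nonneg _)
            (mul_nonneg (Real.sqrt_nonneg _) (h.graphNorm_nonneg u))
      _ = (√(2 * t) * √(2 * t)) * (h.graphNorm u * h.graphNorm v) := by ring
      _ = _ := by rw [Real.mul_self_sqrt (by positivity)]
  rw [norm_smul, norm_inv, Complex.norm_real, Real.norm_eq_abs, abs_of_pos (by positivity),
    inv_mul_le_iff₀ (by positivity)]
  exact h1

theorem toL1_Gam_add_left (h : ReversibleAlgebra κ μ 𝒜) (u u' v : 𝒜) :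
    h.toL1 (h.Gam (u + u') v) = h.toL1 (h.Gam u v) + h.toL1 (h.Gam u' v) := by
  have e : h.toL1 (h.gen (u + u') * v) = h.toL1 ((h.gen u + h.gen u') * v) :=
    h.toL1_mul_congr v (by simp only [map_add, toL1_gen])
  simp only [Gam, map_smul, map_sub, e, toL1_gen, add_mul, map_add]
  rw [← smul_add]
  congr 1
  abel

theorem toL1_Gam_smul_left (h : ReversibleAlgebra κ μ 𝒜) (a : ℂ) (u v : 𝒜) :
    h.toL1 (h.Gam (a • u) v) = a • h.toL1 (h.Gam u v) := by
  have e : h.toL1 (h.gen (a • u) * v) = h.toL1 ((a • h.gen u) * v) :=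
    h.toL1_mul_congr v (by simp only [map_smul, toL1_gen])
  simp only [Gam, map_smul, map_sub, e, toL1_gen, smul_mul_assoc, smul_sub]
  simp only [smul_comm a]

theorem Gam_comm (h : ReversibleAlgebra κ μ 𝒜) (u v : 𝒜) : h.Gam u v = h.Gam v u := by
  unfold Gam
  rw [mul_comm u v, mul_comm u, mul_comm (h.gen u)]
  congr 1
  abel

/-- The carré du champ as a bilinear map into `L₁(μ)`. -/
noncomputable def GamL1 (h : ReversibleAlgebra κ μ 𝒜) : 𝒜 →ₗ[ℂ] 𝒜 →ₗ[ℂ] Lp ℂ 1 μ :=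
  LinearMap.mk₂ ℂ (fun u v => h.toL1 (h.Gam u v)) h.toL1_Gam_add_left h.toL1_Gam_smul_left
    (fun u v v' => by simp only [h.Gam_comm u, toL1_Gam_add_left])
    (fun a u v => by simp only [h.Gam_comm u, toL1_Gam_smul_left])

theorem toL1_Gam (h : ReversibleAlgebra κ μ 𝒜) (u v : 𝒜) :
    h.toL1 (h.Gam u v) = h.GamL1 u v := rfl

theorem norm_GamL1_le (h : ReversibleAlgebra κ μ 𝒜) (u v : 𝒜) :
    ‖h.GamL1 u v‖ ≤ h.graphNorm u * h.graphNorm v := h.norm_toL1_Gam_le u v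

/-- Needed because P_s P_t u and P_{s+t} u agree only almost everywhere, while Γ is defined through
pointwise limits. -/
theorem GamL1_congr (h : ReversibleAlgebra κ μ 𝒜) {u u' v v' : 𝒜} (hu : h.toL2 u = h.toL2 u')
    (hv : h.toL2 v = h.toL2 v') : h.GamL1 u v = h.GamL1 u' v' := by
  have h0 : ∀ {u u' : 𝒜}, h.toL2 u = h.toL2 u' → h.graphNorm (u - u') = 0 := by
    intro u u' hu
    have := h.toL2_gen_congr hu
    simp only [toL2_gen] at this
    simp [graphNorm, hu, this]
  have h1 : h.GamL1 (u - u') v = 0 := by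
    have := h.norm_GamL1_le (u - u') v
    rw [h0 hu, zero_mul] at this
    exact norm_le_zero_iff.1 this
  have h2 : h.GamL1 u' (v - v') = 0 := by
    have := h.norm_GamL1_le u' (v - v')
    rw [h0 hv, mul_zero] at this
    exact norm_le_zero_iff.1 this
  rw [map_sub, LinearMap.sub_apply] at h1
  rw [map_sub] at h2
  rw [sub_eq_zero.1 h1, sub_eq_zero.1 h2]

end ReversibleAlgebra

end MatrixMarkov

/-! ### The iterated carré du champ and the interpolation along the semigroup -/

namespace MatrixMarkov

namespace ReversibleAlgebra

variable {Ω : Type*} [MeasurableSpace Ω]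
variable {κ : ℝ≥0 → Kernel Ω Ω} {μ : Measure Ω} {𝒜 : StarSubalgebra ℂ (Ω → ℂ)}

theorem graphNorm_add_le (h : ReversibleAlgebra κ μ 𝒜) (u v : 𝒜) :
    h.graphNorm (u + v) ≤ h.graphNorm u + h.graphNorm v := by
  simp only [graphNorm, map_add]
  linarith [norm_add_le (h.toL2 u) (h.toL2 v), norm_add_le (h.genL2 u) (h.genL2 v)]

theorem graphNorm_P_sub_P_le (h : ReversibleAlgebra κ μ 𝒜) (s t : ℝ≥0) (u : 𝒜) :
    h.graphNorm (h.P s u - h.P t u) ≤ |(s : ℝ) - t| * h.graphNorm (h.gen u) := by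
  simp only [graphNorm, map_sub, mul_add]
  refine add_le_add (h.norm_toL2_P_sub_P_le s t u) ?_
  rw [← toL2_gen, ← toL2_gen, toL2_gen_P, toL2_gen_P]
  exact h.norm_toL2_P_sub_P_le s t (h.gen u)

theorem graphNorm_P_le (h : ReversibleAlgebra κ μ 𝒜) (t : ℝ≥0) (u : 𝒜) :
    h.graphNorm (h.P t u) ≤ h.graphNorm u := by
  simp only [graphNorm]
  refine add_le_add (h.norm_toL2_P_le t u) ?_
  rw [← toL2_gen, ← toL2_gen, toL2_gen_P]
  exact h.norm_toL2_P_le t _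

/-- Since 𝓛 commutes with P_t, the second part of the graph norm is the generator limit for 𝓛u,
which is again suitable. -/
theorem tendsto_graphNorm_sub (h : ReversibleAlgebra κ μ 𝒜) (u : 𝒜) :
    Tendsto (fun t : ℝ≥0 => h.graphNorm (((t : ℝ) : ℂ)⁻¹ • (h.P t u - u) - h.gen u)) (𝓝[>] 0)
      (𝓝 0) := by
  have h1 := (tendsto_iff_norm_sub_tendsto_zero.1 (h.tendsto_gen u)).add
    (tendsto_iff_norm_sub_tendsto_zero.1 (h.tendsto_gen (h.gen u)))
  rw [add_zero] at h1
  refine h1.congr fun t => ?_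
  simp only [graphNorm, map_sub, map_smul]
  rw [show h.genL2 (h.P t u) = h.toL2 (h.P t (h.gen u)) from h.toL2_gen_P t u]
  rfl

/-- The product rule for the bilinear map Γ: write P_t u = u + t a and P_t v = v + t b, where a and
b converge to 𝓛u and 𝓛v in graph norm; the term t Γ(a, b) vanishes in the limit. -/
theorem tendsto_GamL1_P (h : ReversibleAlgebra κ μ 𝒜) (u v : 𝒜) :
    Tendsto (fun t : ℝ≥0 => ((t : ℝ) : ℂ)⁻¹ • (h.GamL1 (h.P t u) (h.P t v) - h.GamL1 u v))
      (𝓝[>] 0) (𝓝 (h.GamL1 (h.gen u) v + h.GamL1 u (h.gen v))) := by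
  rw [tendsto_iff_norm_sub_tendsto_zero]
  have ht0 : Tendsto (fun t : ℝ≥0 => (t : ℝ)) (𝓝[>] 0) (𝓝 0) :=
    (NNReal.continuous_coe.tendsto' 0 0 rfl).mono_left nhdsWithin_le_nhds
  have hlim := (((h.tendsto_graphNorm_sub u).mul_const (h.graphNorm v)).add
    ((h.tendsto_graphNorm_sub v).const_mul (h.graphNorm u))).add
      (ht0.mul (((h.tendsto_graphNorm_sub u).add_const (h.graphNorm (h.gen u))).mul
        ((h.tendsto_graphNorm_sub v).add_const (h.graphNorm (h.gen v)))))
  simp only [zero_mul, mul_zero, add_zero] at hlim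
  refine squeeze_zero' (Eventually.of_forall fun _ => norm_nonneg _) ?_ hlim
  filter_upwards [self_mem_nhdsWithin] with t ht
  have ht : (0 : ℝ) < t := by exact_mod_cast ht
  have htc : ((t : ℝ) : ℂ) ≠ 0 := by exact_mod_cast ht.ne'
  set a := ((t : ℝ) : ℂ)⁻¹ • (h.P t u - u) with ha
  set b := ((t : ℝ) : ℂ)⁻¹ • (h.P t v - v) with hb
  have hu : h.P t u = u + ((t : ℝ) : ℂ) • a := by
    rw [ha, smul_smul, mul_inv_cancel₀ htc, one_smul]; abel
  have hv : h.P t v = v + ((t : ℝ) : ℂ) • b := by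
    rw [hb, smul_smul, mul_inv_cancel₀ htc, one_smul]; abel
  have e : ((t : ℝ) : ℂ)⁻¹ • (h.GamL1 (h.P t u) (h.P t v) - h.GamL1 u v) -
      (h.GamL1 (h.gen u) v + h.GamL1 u (h.gen v)) =
      h.GamL1 (a - h.gen u) v + h.GamL1 u (b - h.gen v) + ((t : ℝ) : ℂ) • h.GamL1 a b := by
    have e1 : h.GamL1 (h.P t u) (h.P t v) - h.GamL1 u v =
        ((t : ℝ) : ℂ) • (h.GamL1 a v + h.GamL1 u b + ((t : ℝ) : ℂ) • h.GamL1 a b) := by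
      rw [hu, hv]
      simp only [map_add, map_smul, LinearMap.add_apply, LinearMap.smul_apply, smul_add]
      abel
    rw [e1, smul_smul, inv_mul_cancel₀ htc, one_smul]
    simp only [map_sub, LinearMap.sub_apply]
    abel
  rw [e]
  refine (norm_add_le _ _).trans (add_le_add ((norm_add_le _ _).trans (add_le_add ?_ ?_)) ?_)
  · exact h.norm_GamL1_le _ _
  · exact h.norm_GamL1_le _ _
  · rw [norm_smul, Complex.norm_real, Real.norm_eq_abs, abs_of_pos ht]
    refine mul_le_mul_of_nonneg_left ((h.norm_GamL1_le _ _).trans ?_) ht.le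
    have h1 : h.graphNorm a ≤ h.graphNorm (a - h.gen u) + h.graphNorm (h.gen u) := by
      simpa using h.graphNorm_add_le (a - h.gen u) (h.gen u)
    have h2 : h.graphNorm b ≤ h.graphNorm (b - h.gen v) + h.graphNorm (h.gen v) := by
      simpa using h.graphNorm_add_le (b - h.gen v) (h.gen v)
    exact mul_le_mul h1 h2 (h.graphNorm_nonneg _) ((h.graphNorm_nonneg _).trans h1)

/-- The iterated carré du champ of scalar suitable functions. -/
noncomputable def Gam₂ (h : ReversibleAlgebra κ μ 𝒜) (u v : 𝒜) : 𝒜 :=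
  (1 / 2 : ℂ) • (h.gen (h.Gam u v) - h.Gam u (h.gen v) - h.Gam (h.gen u) v)

/-- To first order, Γ₂ is the failure of P_t to commute with Γ. This is where the curvature
condition meets the semigroup. -/
theorem tendsto_commutator (h : ReversibleAlgebra κ μ 𝒜) (u v : 𝒜) :
    Tendsto (fun t : ℝ≥0 => ((t : ℝ) : ℂ)⁻¹ •
      (h.semiL1 t (h.Gam u v) - h.GamL1 (h.P t u) (h.P t v)))
      (𝓝[>] 0) (𝓝 ((2 : ℂ) • h.toL1 (h.Gam₂ u v))) := by
  have e : (2 : ℂ) • h.toL1 (h.Gam₂ u v) =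
      h.genL1 (h.Gam u v) - (h.GamL1 (h.gen u) v + h.GamL1 u (h.gen v)) := by
    simp only [Gam₂, map_smul, map_sub, toL1_gen, toL1_Gam, smul_smul]
    norm_num
    abel
  rw [e]
  refine ((h.tendsto_genL1 (h.Gam u v)).sub (h.tendsto_GamL1_P u v)).congr fun t => ?_
  rw [← smul_sub, toL1_Gam]
  congr 1
  abel

/-- The interpolation `s ↦ P_{t - s} Γ(P_s u, P_s v)`. -/
noncomputable def interp (h : ReversibleAlgebra κ μ 𝒜) (t : ℝ) (u v : 𝒜) (s : ℝ) : Lp ℂ 1 μ :=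
  h.semiL1 (t - s).toNNReal (h.Gam (h.P s.toNNReal u) (h.P s.toNNReal v))

theorem norm_GamL1_sub_le (h : ReversibleAlgebra κ μ 𝒜) (a a' b b' : 𝒜) :
    ‖h.GamL1 a b - h.GamL1 a' b'‖ ≤
      h.graphNorm (a - a') * h.graphNorm b + h.graphNorm a' * h.graphNorm (b - b') := by
  have e : h.GamL1 a b - h.GamL1 a' b' = h.GamL1 (a - a') b + h.GamL1 a' (b - b') := by
    simp only [map_sub, LinearMap.sub_apply]
    abel
  rw [e]
  exact (norm_add_le _ _).trans (add_le_add (h.norm_GamL1_le _ _) (h.norm_GamL1_le _ _))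

theorem abs_toNNReal_sub_le (a b : ℝ) : |(a.toNNReal : ℝ) - b.toNNReal| ≤ |a - b| := by
  simpa using abs_max_sub_max_le_abs a b 0

/-- The inner functions move Lipschitz-continuously in graph norm and the outer P_{t-s} is an L₁
contraction, Lipschitz in time on a fixed suitable function. Clamping negative times to 0 is
1-Lipschitz and makes the path total. -/
theorem continuous_interp (h : ReversibleAlgebra κ μ 𝒜) (t : ℝ) (u v : 𝒜) :
    Continuous (h.interp t u v) := by
  rw [continuous_iff_continuousAt]
  intro s
  rw [ContinuousAt, tendsto_iff_norm_sub_tendsto_zero]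
  set q := h.Gam (h.P s.toNNReal u) (h.P s.toNNReal v) with hq
  have hlim : Tendsto (fun y : ℝ => (|y - s| * h.graphNorm (h.gen u)) * h.graphNorm v +
      h.graphNorm u * (|y - s| * h.graphNorm (h.gen v)) + |y - s| * ‖h.toL2 (h.gen q)‖) (𝓝 s)
      (𝓝 0) := by
    have : Tendsto (fun y : ℝ => |y - s|) (𝓝 s) (𝓝 0) :=
      Continuous.tendsto' (by fun_prop) _ _ (by simp)
    have := (((this.mul_const (h.graphNorm (h.gen u))).mul_const (h.graphNorm v)).add
      ((this.mul_const (h.graphNorm (h.gen v))).const_mul (h.graphNorm u))).add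
      (this.mul_const ‖h.toL2 (h.gen q)‖)
    simpa using this
  refine squeeze_zero (fun _ => norm_nonneg _) (fun y => ?_) hlim
  have e : h.interp t u v y - h.interp t u v s =
      h.semiL1 (t - y).toNNReal (h.Gam (h.P y.toNNReal u) (h.P y.toNNReal v) - q) +
        (h.semiL1 (t - y).toNNReal q - h.semiL1 (t - s).toNNReal q) := by
    simp only [interp, map_sub, hq]
    abel
  rw [e]
  refine (norm_add_le _ _).trans (add_le_add ?_ ?_)
  · refine (h.norm_semiL1_le _ _).trans ?_
    rw [map_sub, hq, toL1_Gam, toL1_Gam]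
    refine (h.norm_GamL1_sub_le _ _ _ _).trans (add_le_add ?_ ?_)
    · refine mul_le_mul ((h.graphNorm_P_sub_P_le _ _ _).trans ?_) (h.graphNorm_P_le _ _)
        (h.graphNorm_nonneg _) (mul_nonneg (abs_nonneg _) (h.graphNorm_nonneg _))
      exact mul_le_mul_of_nonneg_right (abs_toNNReal_sub_le _ _) (h.graphNorm_nonneg _)
    · refine mul_le_mul (h.graphNorm_P_le _ _) ((h.graphNorm_P_sub_P_le _ _ _).trans ?_)
        (h.graphNorm_nonneg _) (h.graphNorm_nonneg _)
      exact mul_le_mul_of_nonneg_right (abs_toNNReal_sub_le _ _) (h.graphNorm_nonneg _)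
  · refine (h.norm_semiL1_sub_semiL1_le _ _ _).trans ?_
    refine mul_le_mul_of_nonneg_right ((abs_toNNReal_sub_le _ _).trans (le_of_eq ?_)) (norm_nonneg _)
    rw [abs_sub_comm]
    congr 1
    ring

theorem tendsto_toNNReal_sub (s : ℝ) :
    Tendsto (fun y : ℝ => (y - s).toNNReal) (𝓝[>] s) (𝓝[>] 0) := by
  refine tendsto_nhdsWithin_iff.2 ⟨?_, ?_⟩
  · refine Tendsto.mono_left ?_ nhdsWithin_le_nhds
    exact Continuous.tendsto' (by fun_prop) _ _ (by simp)
  · filter_upwards [self_mem_nhdsWithin] with y hy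
    simpa using hy

/-- For y > s both values are P_{t-y} applied to something, and their difference is minus P_{t-y} of
the commutator of P_{y-s} and Γ at (P_s u, P_s v). A right derivative is enough for Grönwall's
inequality. -/
theorem hasDerivWithinAt_interp (h : ReversibleAlgebra κ μ 𝒜) (t : ℝ) (u v : 𝒜) {s : ℝ}
    (hs : s ∈ Set.Ico 0 t) :
    HasDerivWithinAt (h.interp t u v) (-((2 : ℂ) • h.semiL1 (t - s).toNNReal
      (h.Gam₂ (h.P s.toNNReal u) (h.P s.toNNReal v)))) (Set.Ici s) s := by
  rw [← hasDerivWithinAt_Ioi_iff_Ici, hasDerivWithinAt_iff_tendsto_slope' (by simp)]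
  set g := h.P s.toNNReal u with hg
  set g' := h.P s.toNNReal v with hg'
  set q := h.Gam₂ g g' with hq
  rw [tendsto_iff_norm_sub_tendsto_zero]
  have h1 := (tendsto_iff_norm_sub_tendsto_zero.1 (h.tendsto_commutator g g')).comp
    (tendsto_toNNReal_sub s)
  have h2 : Tendsto (fun y : ℝ => 2 * (|y - s| * ‖h.toL2 (h.gen q)‖)) (𝓝[>] s) (𝓝 0) := by
    refine Tendsto.mono_left ?_ nhdsWithin_le_nhds
    exact Continuous.tendsto' (by fun_prop) _ _ (by simp)
  have h3 := h1.add h2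
  rw [add_zero] at h3
  refine squeeze_zero' (Eventually.of_forall fun _ => norm_nonneg _) ?_ h3
  filter_upwards [Ioo_mem_nhdsGT hs.2] with y hy
  have hy0 : 0 < y - s := sub_pos.2 hy.1
  have c1 : ((y - s).toNNReal : ℝ) = y - s := Real.coe_toNNReal _ hy0.le
  have e0 : (t - s).toNNReal = (t - y).toNNReal + (y - s).toNNReal := by
    rw [← Real.toNNReal_add (by linarith [hy.2]) hy0.le]
    congr 1
    ring
  have e1 : y.toNNReal = (y - s).toNNReal + s.toNNReal := by
    rw [← Real.toNNReal_add hy0.le hs.1]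
    congr 1
    ring
  have e2 : h.interp t u v s = h.semiL1 (t - y).toNNReal (h.P (y - s).toNNReal (h.Gam g g')) := by
    rw [semiL1_P, ← e0]
    rfl
  have e3 : h.interp t u v y = h.semiL1 (t - y).toNNReal
      (h.Gam (h.P (y - s).toNNReal g) (h.P (y - s).toNNReal g')) := by
    refine h.semiL1_congr _ ?_
    rw [toL1_Gam, toL1_Gam]
    refine h.GamL1_congr ?_ ?_
    · rw [hg, toL2_P_P, ← e1]
    · rw [hg', toL2_P_P, ← e1]
  set r := (y - s).toNNReal with hr
  -- Two errors: convergence of the commutator quotient, not enlarged by the contraction P_{t-y},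
  -- and the replacement of P_{t-y} by P_{t-s} on the fixed function q = Γ₂(P_s u, P_s v).
  have e4 : slope (h.interp t u v) s y - -((2 : ℂ) • h.semiL1 (t - s).toNNReal q) =
      -h.semiL1 (t - y).toNNReal (((r : ℝ) : ℂ)⁻¹ • (h.P r (h.Gam g g') -
        h.Gam (h.P r g) (h.P r g')) - (2 : ℂ) • q) -
      (2 : ℂ) • (h.semiL1 (t - y).toNNReal q - h.semiL1 (t - s).toNNReal q) := by
    have e5 : ∀ (a : ℝ) (x : Lp ℂ 1 μ), a • x = (a : ℂ) • x := fun a x =>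
      (algebraMap_smul ℂ a x).symm
    rw [slope_def_module, e2, e3, c1, e5, Complex.ofReal_inv]
    simp only [map_sub, map_smul, smul_sub]
    abel
  rw [e4]
  refine (norm_sub_le _ _).trans (add_le_add ?_ ?_)
  · rw [norm_neg]
    refine (h.norm_semiL1_le _ _).trans (le_of_eq ?_)
    simp only [map_sub, map_smul, Function.comp_apply]
    rfl
  · rw [norm_smul, Complex.norm_two]
    refine mul_le_mul_of_nonneg_left ((h.norm_semiL1_sub_semiL1_le _ _ _).trans ?_) (by norm_num)
    refine mul_le_mul_of_nonneg_right ((abs_toNNReal_sub_le _ _).trans (le_of_eq ?_)) (norm_nonneg _)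
    rw [abs_sub_comm]
    congr 1
    ring

end ReversibleAlgebra

end MatrixMarkov

/-! ### Trace inequalities in a pair of eigenbases -/

namespace Matrix.IsHermitian

variable {n : Type*} [Fintype n] [DecidableEq n] {A B C : Matrix n n ℂ}

theorem cfc_eq_mul (hA : A.IsHermitian) (φ : ℝ → ℝ) :
    hA.cfc φ = (hA.eigenvectorUnitary : Matrix n n ℂ) *
      Matrix.diagonal (fun j => (φ (hA.eigenvalues j) : ℂ)) *
        star (hA.eigenvectorUnitary : Matrix n n ℂ) := by
  rw [Matrix.IsHermitian.cfc, Unitary.conjStarAlgAut_apply]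
  rfl

theorem cfc_id_eq (hA : A.IsHermitian) : hA.cfc id = A := by
  conv_rhs => rw [hA.spectral_theorem]
  rfl

theorem isHermitian_cfc (hA : A.IsHermitian) (φ : ℝ → ℝ) : (hA.cfc φ).IsHermitian := by
  rw [cfc_eq_mul, Matrix.IsHermitian, Matrix.star_eq_conjTranspose]
  simp only [Matrix.conjTranspose_mul, Matrix.conjTranspose_conjTranspose,
    Matrix.diagonal_conjTranspose, Matrix.mul_assoc]
  congr 3
  ext j
  simp

/-- The matrix `X` with respect to the eigenbases of `A` and `B`. -/
noncomputable def mixed (hA : A.IsHermitian) (hB : B.IsHermitian) (X : Matrix n n ℂ) :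
    Matrix n n ℂ :=
  star (hA.eigenvectorUnitary : Matrix n n ℂ) * X * (hB.eigenvectorUnitary : Matrix n n ℂ)

theorem star_mul_eigenvectorUnitary (hA : A.IsHermitian) :
    star (hA.eigenvectorUnitary : Matrix n n ℂ) * (hA.eigenvectorUnitary : Matrix n n ℂ) = 1 :=
  Unitary.coe_star_mul_self _

theorem eigenvectorUnitary_mul_star (hA : A.IsHermitian) :
    (hA.eigenvectorUnitary : Matrix n n ℂ) * star (hA.eigenvectorUnitary : Matrix n n ℂ) = 1 :=
  Unitary.coe_mul_star_self _

/-- Left multiplication by φ(A) scales rows and right multiplication by φ(B) scales columns.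
Functions of two noncommuting matrices thus become simultaneous scalar multipliers. -/
theorem mixed_cfc_mul (hA : A.IsHermitian) (hB : B.IsHermitian) (φ : ℝ → ℝ) (X : Matrix n n ℂ)
    (j k : n) :
    mixed hA hB (hA.cfc φ * X) j k = φ (hA.eigenvalues j) * mixed hA hB X j k := by
  have : mixed hA hB (hA.cfc φ * X) =
      Matrix.diagonal (fun j => (φ (hA.eigenvalues j) : ℂ)) * mixed hA hB X := by
    simp only [mixed, cfc_eq_mul, ← Matrix.mul_assoc, star_mul_eigenvectorUnitary, Matrix.one_mul]
  rw [this, Matrix.diagonal_mul]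

theorem mixed_mul_cfc (hA : A.IsHermitian) (hB : B.IsHermitian) (φ : ℝ → ℝ) (X : Matrix n n ℂ)
    (j k : n) :
    mixed hA hB (X * hB.cfc φ) j k = mixed hA hB X j k * φ (hB.eigenvalues k) := by
  have : mixed hA hB (X * hB.cfc φ) =
      mixed hA hB X * Matrix.diagonal (fun j => (φ (hB.eigenvalues j) : ℂ)) := by
    simp only [mixed, cfc_eq_mul, Matrix.mul_assoc, star_mul_eigenvectorUnitary, Matrix.mul_one]
  rw [this, Matrix.mul_diagonal]

theorem mixed_sub (hA : A.IsHermitian) (hB : B.IsHermitian) (X Y : Matrix n n ℂ) :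
    mixed hA hB (X - Y) = mixed hA hB X - mixed hA hB Y := by
  simp only [mixed, Matrix.mul_sub, Matrix.sub_mul]

theorem mixed_cfc_sub_cfc (hA : A.IsHermitian) (hB : B.IsHermitian) (φ : ℝ → ℝ) (j k : n) :
    mixed hA hB (hA.cfc φ - hB.cfc φ) j k =
      ((φ (hA.eigenvalues j) - φ (hB.eigenvalues k) : ℝ) : ℂ) * mixed hA hB 1 j k := by
  have h1 := mixed_cfc_mul hA hB φ 1 j k
  have h2 := mixed_mul_cfc hA hB φ 1 j k
  rw [Matrix.mul_one] at h1
  rw [Matrix.one_mul] at h2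
  rw [mixed_sub, Matrix.sub_apply, h1, h2]
  push_cast
  ring

/-- The trace pairing in mixed coordinates. -/
theorem trace_mul_eq_sum_mixed (hA : A.IsHermitian) (hB : B.IsHermitian) (hC : C.IsHermitian)
    (X : Matrix n n ℂ) :
    (C * X).trace = ∑ j, ∑ k, star (mixed hA hB C j k) * mixed hA hB X j k := by
  have h1 : ((mixed hA hB C)ᴴ * mixed hA hB X).trace = (C * X).trace := by
    rw [mixed, mixed, Matrix.conjTranspose_mul, Matrix.conjTranspose_mul, hC.eq,
      Matrix.star_eq_conjTranspose, Matrix.conjTranspose_conjTranspose,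
      ← Matrix.star_eq_conjTranspose, ← Matrix.star_eq_conjTranspose]
    rw [Matrix.trace_mul_comm, Matrix.mul_assoc]
    rw [← Matrix.mul_assoc (hB.eigenvectorUnitary : Matrix n n ℂ), eigenvectorUnitary_mul_star,
      Matrix.one_mul, Matrix.trace_mul_comm, Matrix.mul_assoc,
      ← Matrix.mul_assoc (hA.eigenvectorUnitary : Matrix n n ℂ), eigenvectorUnitary_mul_star,
      Matrix.one_mul]
  rw [← h1, Matrix.trace]
  simp only [Matrix.diag_apply, Matrix.mul_apply, Matrix.conjTranspose_apply]
  exact Finset.sum_comm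

theorem trace_cfc (hA : A.IsHermitian) (φ : ℝ → ℝ) :
    (hA.cfc φ).trace = ((∑ j, φ (hA.eigenvalues j) : ℝ) : ℂ) := by
  rw [cfc_eq_mul, Matrix.trace_mul_comm, ← Matrix.mul_assoc, star_mul_eigenvectorUnitary,
    Matrix.one_mul, Matrix.trace_diagonal]
  push_cast
  rfl

/-- The squared overlap of two eigenvectors. -/
noncomputable def overlap (hA : A.IsHermitian) (hB : B.IsHermitian) (j k : n) : ℝ :=
  ‖mixed hA hB 1 j k‖ ^ 2

theorem star_mul_self_re (z : ℂ) : (star z * z).re = ‖z‖ ^ 2 := by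
  have := Complex.conj_mul' z
  rw [Complex.star_def, this]
  norm_cast

/-- The overlaps are nonnegative weights, so a scalar inequality between functions of two
eigenvalues can be summed against them. -/
theorem trace_cfc_mul_cfc_re (hA : A.IsHermitian) (hB : B.IsHermitian) (p q : ℝ → ℝ) :
    (hA.cfc p * hB.cfc q).trace.re =
      ∑ j, ∑ k, p (hA.eigenvalues j) * q (hB.eigenvalues k) * overlap hA hB j k := by
  rw [trace_mul_eq_sum_mixed hA hB (hA.isHermitian_cfc p), Complex.re_sum]
  refine Finset.sum_congr rfl fun j _ => ?_
  rw [Complex.re_sum]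
  refine Finset.sum_congr rfl fun k _ => ?_
  have h1 := mixed_cfc_mul hA hB p 1 j k
  have h2 := mixed_mul_cfc hA hB q 1 j k
  rw [Matrix.mul_one] at h1
  rw [Matrix.one_mul] at h2
  rw [h1, h2, overlap, ← star_mul_self_re]
  simp only [star_mul', Complex.star_def, Complex.conj_ofReal]
  have : (p (hA.eigenvalues j) : ℂ) * (starRingEnd ℂ) (mixed hA hB 1 j k) *
      (mixed hA hB 1 j k * (q (hB.eigenvalues k) : ℂ)) =
      ((p (hA.eigenvalues j) * q (hB.eigenvalues k) : ℝ) : ℂ) *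
        ((starRingEnd ℂ) (mixed hA hB 1 j k) * mixed hA hB 1 j k) := by
    push_cast; ring
  rw [this, Complex.re_ofReal_mul]

theorem cfc_one_eq (hA : A.IsHermitian) : hA.cfc (fun _ => 1) = 1 := by
  rw [cfc_eq_mul]
  simp

/-- Klein's inequality: a scalar inequality `p a * q b ≤ r a + s b` lifts to traces. -/
theorem trace_cfc_mul_cfc_le (hA : A.IsHermitian) (hB : B.IsHermitian) {p q r s : ℝ → ℝ}
    (hpq : ∀ a b, p a * q b ≤ r a + s b) :
    (hA.cfc p * hB.cfc q).trace.re ≤ (hA.cfc r).trace.re + (hB.cfc s).trace.re := by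
  -- Inserting the constant function 1 of the other matrix writes a single trace as the same double
  -- sum.
  have h1 : (hA.cfc r).trace.re = ∑ j, ∑ k, r (hA.eigenvalues j) * 1 * overlap hA hB j k := by
    rw [← trace_cfc_mul_cfc_re hA hB r (fun _ => 1), cfc_one_eq, Matrix.mul_one]
  have h2 : (hB.cfc s).trace.re = ∑ j, ∑ k, 1 * s (hB.eigenvalues k) * overlap hA hB j k := by
    rw [← trace_cfc_mul_cfc_re hA hB (fun _ => 1) s, cfc_one_eq, Matrix.one_mul]
  rw [trace_cfc_mul_cfc_re, h1, h2, ← Finset.sum_add_distrib]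
  refine Finset.sum_le_sum fun j _ => ?_
  rw [← Finset.sum_add_distrib]
  refine Finset.sum_le_sum fun k _ => ?_
  rw [← add_mul]
  refine mul_le_mul_of_nonneg_right ?_ (sq_nonneg _)
  simpa using hpq (hA.eigenvalues j) (hB.eigenvalues k)

/-- The mean value trace inequality. -/
theorem trace_mul_cfc_sub_cfc_le (hA : A.IsHermitian) (hB : B.IsHermitian) (hC : C.IsHermitian)
    {φ ψ : ℝ → ℝ} (hψ : ∀ a, 0 ≤ ψ a) (hφ : ∀ a b, |φ a - φ b| ≤ |a - b| * ((ψ a + ψ b) / 2))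
    {σ : ℝ} (hσ : 0 < σ) :
    (C * (hA.cfc φ - hB.cfc φ)).trace.re ≤
      σ / 4 * (((A - B) * (A - B) * hA.cfc ψ).trace.re +
        ((A - B) * (A - B) * hB.cfc ψ).trace.re) +
      σ⁻¹ / 4 * ((C * C * hA.cfc ψ).trace.re + (C * C * hB.cfc ψ).trace.re) := by
  -- Cyclicity moves ψ(A) between the two factors M, where it scales row j; ψ(B) scales column k.
  -- The two traces together weight the squared entry (j, k) of M by ψ(a_j) + ψ(b_k).
  have quad : ∀ {M : Matrix n n ℂ}, M.IsHermitian →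
      (M * M * hA.cfc ψ).trace.re + (M * M * hB.cfc ψ).trace.re =
        ∑ j, ∑ k, (ψ (hA.eigenvalues j) + ψ (hB.eigenvalues k)) * ‖mixed hA hB M j k‖ ^ 2 := by
    intro M hM
    have e1 : (M * M * hA.cfc ψ).trace = (M * (hA.cfc ψ * M)).trace := by
      rw [Matrix.trace_mul_comm, ← Matrix.mul_assoc, Matrix.trace_mul_comm]
    rw [e1, Matrix.mul_assoc M M, trace_mul_eq_sum_mixed hA hB hM,
      trace_mul_eq_sum_mixed hA hB hM, ← Complex.add_re, ← Finset.sum_add_distrib, Complex.re_sum]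
    refine Finset.sum_congr rfl fun j _ => ?_
    rw [← Finset.sum_add_distrib, Complex.re_sum]
    refine Finset.sum_congr rfl fun k _ => ?_
    rw [mixed_cfc_mul, mixed_mul_cfc, ← star_mul_self_re]
    have : star (mixed hA hB M j k) * ((ψ (hA.eigenvalues j) : ℂ) * mixed hA hB M j k) +
        star (mixed hA hB M j k) * (mixed hA hB M j k * (ψ (hB.eigenvalues k) : ℂ)) =
        ((ψ (hA.eigenvalues j) + ψ (hB.eigenvalues k) : ℝ) : ℂ) *
          (star (mixed hA hB M j k) * mixed hA hB M j k) := by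
      push_cast; ring
    rw [this, Complex.re_ofReal_mul]
  rw [quad (hA.sub hB), quad hC, trace_mul_eq_sum_mixed hA hB hC, Complex.re_sum, Finset.mul_sum,
    Finset.mul_sum, ← Finset.sum_add_distrib]
  refine Finset.sum_le_sum fun j _ => ?_
  rw [Complex.re_sum, Finset.mul_sum, Finset.mul_sum, ← Finset.sum_add_distrib]
  refine Finset.sum_le_sum fun k _ => ?_
  -- A - B and φ(A) - φ(B) are scalar multiples of the same overlap entry, so the comparison reduces
  -- to the scalar hypothesis on φ.
  have hD : mixed hA hB (A - B) j k =
      ((hA.eigenvalues j - hB.eigenvalues k : ℝ) : ℂ) * mixed hA hB 1 j k := by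
    have := mixed_cfc_sub_cfc hA hB id j k
    rwa [cfc_id_eq, cfc_id_eq] at this
  rw [mixed_cfc_sub_cfc, hD]
  set a := hA.eigenvalues j
  set b := hB.eigenvalues k
  set w := mixed hA hB 1 j k
  set x := mixed hA hB C j k
  refine (Complex.re_le_norm _).trans ?_
  rw [norm_mul, norm_star, norm_mul, norm_mul, Complex.norm_real, Complex.norm_real,
    Real.norm_eq_abs, Real.norm_eq_abs]
  have hs : 0 ≤ (ψ a + ψ b) / 2 := by linarith [hψ a, hψ b]
  have h1 : ‖x‖ * (|φ a - φ b| * ‖w‖) ≤ ‖x‖ * (|a - b| * ‖w‖) * ((ψ a + ψ b) / 2) := by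
    calc _ ≤ ‖x‖ * ((|a - b| * ((ψ a + ψ b) / 2)) * ‖w‖) := by
          gcongr
          exact hφ a b
      _ = _ := by ring
  refine h1.trans ?_
  set y := |a - b| * ‖w‖
  -- Weighted arithmetic–geometric mean; σ remains free so that the two energies can be balanced
  -- later.
  have h2 : ‖x‖ * y ≤ σ / 2 * y ^ 2 + σ⁻¹ / 2 * ‖x‖ ^ 2 := by
    have h3 : σ / 2 * y ^ 2 + σ⁻¹ / 2 * ‖x‖ ^ 2 - ‖x‖ * y = σ / 2 * (y - σ⁻¹ * ‖x‖) ^ 2 := by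
      field_simp
      ring
    have h4 : 0 ≤ σ / 2 * (y - σ⁻¹ * ‖x‖) ^ 2 := by positivity
    linarith
  calc _ ≤ (σ / 2 * y ^ 2 + σ⁻¹ / 2 * ‖x‖ ^ 2) * ((ψ a + ψ b) / 2) :=
        mul_le_mul_of_nonneg_right h2 hs
    _ = _ := by ring

theorem norm_cfc_apply_le (hA : A.IsHermitian) {φ : ℝ → ℝ} {M : ℝ}
    (hM : ∀ j, |φ (hA.eigenvalues j)| ≤ M) (i j : n) :
    ‖hA.cfc φ i j‖ ≤ Fintype.card n * M := by
  rw [cfc_eq_mul, Matrix.mul_apply]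
  refine (norm_sum_le _ _).trans ?_
  rw [← nsmul_eq_mul, ← Finset.card_univ]
  refine Finset.sum_le_card_nsmul _ _ _ fun k _ => ?_
  rw [Matrix.mul_diagonal, norm_mul, norm_mul, Complex.norm_real, Real.norm_eq_abs]
  have h1 := entry_norm_bound_of_unitary hA.eigenvectorUnitary.2 i k
  have h2 : ‖star (hA.eigenvectorUnitary : Matrix n n ℂ) k j‖ ≤ 1 := by
    rw [Matrix.star_apply, norm_star]
    exact entry_norm_bound_of_unitary hA.eigenvectorUnitary.2 j k
  have h0 : 0 ≤ M := (abs_nonneg _).trans (hM k)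
  calc _ ≤ 1 * M * 1 :=
        mul_le_mul (mul_le_mul h1 (hM k) (abs_nonneg _) zero_le_one) h2 (norm_nonneg _) (by linarith)
    _ = M := by ring

/-- In the eigenbasis of A the trace is a sum of values of φ times diagonal entries of a positive
semidefinite matrix. -/
theorem trace_mul_cfc_re_nonneg (hA : A.IsHermitian) {X : Matrix n n ℂ} (hX : X.PosSemidef)
    {φ : ℝ → ℝ} (hφ : ∀ a, 0 ≤ φ a) : 0 ≤ (X * hA.cfc φ).trace.re := by
  rw [cfc_eq_mul, ← Matrix.mul_assoc, Matrix.trace_mul_comm, ← Matrix.mul_assoc, ← Matrix.mul_assoc,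
    Matrix.trace, Complex.re_sum]
  refine Finset.sum_nonneg fun j _ => ?_
  rw [Matrix.diag_apply, Matrix.mul_diagonal, mul_comm, Complex.re_ofReal_mul]
  have := (hX.conjTranspose_mul_mul_same (hA.eigenvectorUnitary : Matrix n n ℂ)).diag_nonneg (i := j)
  exact mul_nonneg (hφ _) (Complex.nonneg_iff.1 this).1

theorem exp_smul_eq_cfc (hA : A.IsHermitian) (t : ℝ) :
    NormedSpace.exp ((t : ℂ) • A) = hA.cfc fun x => Real.exp (t * x) := by
  have hU : (hA.eigenvectorUnitary : Matrix n n ℂ)⁻¹ = star (hA.eigenvectorUnitary : Matrix n n ℂ) :=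
    Matrix.inv_eq_right_inv hA.eigenvectorUnitary_mul_star
  have h1 : (t : ℂ) • A = (hA.eigenvectorUnitary : Matrix n n ℂ) *
      Matrix.diagonal (fun j => ((t * hA.eigenvalues j : ℝ) : ℂ)) *
        (hA.eigenvectorUnitary : Matrix n n ℂ)⁻¹ := by
    conv_lhs => rw [← hA.cfc_id_eq]
    rw [cfc_eq_mul, hU, ← Matrix.smul_mul, ← Matrix.mul_smul, ← Matrix.diagonal_smul]
    congr 3
    ext j
    simp
  rw [h1, Matrix.exp_conj _ _ (IsUnit.of_mul_eq_one _ hA.eigenvectorUnitary_mul_star),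
    Matrix.exp_diagonal, hU, cfc_eq_mul]
  congr 3
  ext j
  rw [Pi.coe_exp]
  simp [← Complex.exp_eq_exp_ℂ]

theorem cfc_polynomial_eq (hA : A.IsHermitian) (p : Polynomial ℝ) :
    hA.cfc (fun x => p.eval x) = Polynomial.aeval A p := by
  rw [← hA.cfc_eq]
  exact cfc_polynomial p A hA.isSelfAdjoint

end Matrix.IsHermitian

/-! ### Measurability of functions of a Hermitian-valued map -/

namespace MatrixMarkov

theorem measurable_aeval_apply {α n : Type*} [MeasurableSpace α] [Fintype n] [DecidableEq n]
    {F : α → Matrix n n ℂ} (hF : ∀ i j, Measurable fun z => F z i j) (p : Polynomial ℝ) (i j : n) :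
    Measurable fun z => (Polynomial.aeval (F z) p) i j := by
  induction p using Polynomial.induction_on' generalizing i j with
  | add p q hp hq =>
    simp only [map_add, Matrix.add_apply]
    exact (hp i j).add (hq i j)
  | monomial k a =>
    simp only [Polynomial.aeval_monomial, ← Algebra.smul_def, Matrix.smul_apply]
    refine Measurable.const_smul ?_ a
    induction k generalizing i j with
    | zero => simp only [pow_zero]; exact measurable_const
    | succ k ih =>
      simp only [pow_succ, Matrix.mul_apply]
      exact Finset.measurable_fun_sum _ fun l _ => (ih i l).mul (hF l j)

/-- The chosen eigenbasis carries no measurability in z, but polynomials in the matrix do.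
Polynomials within 1/(k+1) of φ on [-k, k] converge at each z once k exceeds all eigenvalues in
absolute value. -/
theorem measurable_cfc_apply {α n : Type*} [MeasurableSpace α] [Fintype n] [DecidableEq n]
    {F : α → Matrix n n ℂ} (hF : ∀ i j, Measurable fun z => F z i j)
    (hH : ∀ z, (F z).IsHermitian) {φ : ℝ → ℝ} (hφ : Continuous φ) (i j : n) :
    Measurable fun z => (hH z).cfc φ i j := by
  choose p hp using fun k : ℕ => exists_polynomial_near_of_continuousOn (-(k : ℝ)) k φ
    hφ.continuousOn (1 / ((k : ℝ) + 1)) (by positivity)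
  refine measurable_of_tendsto_metrizable (fun k => measurable_aeval_apply hF (p k) i j) ?_
  rw [tendsto_pi_nhds]
  intro z
  rw [tendsto_iff_norm_sub_tendsto_zero]
  have hlim : Tendsto (fun k : ℕ => (Fintype.card n : ℝ) * (1 / ((k : ℝ) + 1))) atTop (𝓝 0) := by
    simpa using tendsto_one_div_add_atTop_nhds_zero_nat.const_mul (Fintype.card n : ℝ)
  refine squeeze_zero' (Eventually.of_forall fun _ => norm_nonneg _) ?_ hlim
  obtain ⟨N, hN⟩ := exists_nat_ge (∑ l, |(hH z).eigenvalues l|)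
  filter_upwards [eventually_ge_atTop N] with k hk
  have e : (Polynomial.aeval (F z) (p k)) i j - (hH z).cfc φ i j =
      (hH z).cfc (fun x => (p k).eval x - φ x) i j := by
    rw [← (hH z).cfc_polynomial_eq, ← Matrix.sub_apply, Matrix.IsHermitian.cfc_eq_mul,
      Matrix.IsHermitian.cfc_eq_mul, Matrix.IsHermitian.cfc_eq_mul, ← Matrix.sub_mul,
      ← Matrix.mul_sub, Matrix.diagonal_sub]
    simp
  rw [e]
  refine (hH z).norm_cfc_apply_le (fun l => (hp k _ ?_).le) i j
  have h1 : |(hH z).eigenvalues l| ≤ k :=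
    (Finset.single_le_sum (f := fun l => |(hH z).eigenvalues l|) (fun _ _ => abs_nonneg _)
      (Finset.mem_univ l)).trans (hN.trans (by exact_mod_cast hk))
  exact abs_le.1 h1

end MatrixMarkov

/-! ### Bounded weights and the matrix carré du champ, entry by entry -/

namespace MatrixMarkov

variable {Ω : Type*} [MeasurableSpace Ω] {d : ℕ}
variable {κ : ℝ≥0 → Kernel Ω Ω} {μ : Measure Ω} {𝒜 : StarSubalgebra ℂ (Ω → ℂ)}

/-- Integration against a bounded measurable function, on `L₁(μ)`. -/
noncomputable def pairing (μ : Measure Ω) (w : Ω → ℂ) {K : ℝ} (hw : Measurable w)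
    (hK : ∀ z, ‖w z‖ ≤ K) : Lp ℂ 1 μ →L[ℝ] ℂ :=
  LinearMap.mkContinuous
    { toFun := fun x => ∫ z, x z * w z ∂μ
      map_add' := fun x y => by
        have hi : ∀ x : Lp ℂ 1 μ, Integrable (fun z => x z * w z) μ := fun x =>
          (L1.integrable_coeFn x).mul_bdd (c := K) hw.aestronglyMeasurable (ae_of_all _ hK)
        rw [← integral_add (hi x) (hi y)]
        refine integral_congr_ae ?_
        filter_upwards [Lp.coeFn_add x y] with z hz
        rw [hz, Pi.add_apply, add_mul]
      map_smul' := fun a x => by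
        rw [RingHom.id_apply, ← integral_smul]
        refine integral_congr_ae ?_
        filter_upwards [Lp.coeFn_smul a x] with z hz
        rw [hz, Pi.smul_apply, smul_mul_assoc] } K fun x => by
    have hi : Integrable (fun z => ‖x z‖) μ := (L1.integrable_coeFn x).norm
    refine (norm_integral_le_integral_norm _).trans ?_
    rw [L1.norm_eq_integral_norm, mul_comm, ← integral_mul_const]
    refine integral_mono_of_nonneg (ae_of_all _ fun z => norm_nonneg _) (hi.mul_const K)
      (ae_of_all _ fun z => ?_)
    simp only [norm_mul]
    exact mul_le_mul_of_nonneg_left (hK z) (norm_nonneg _)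

theorem ReversibleAlgebra.pairing_toL1 (h : ReversibleAlgebra κ μ 𝒜) (u : 𝒜) {w : Ω → ℂ} {K : ℝ}
    (hw : Measurable w) (hK : ∀ z, ‖w z‖ ≤ K) :
    pairing μ w hw hK (h.toL1 u) = ∫ z, (u : Ω → ℂ) z * w z ∂μ := by
  change ∫ z, (h.toL1 u : Ω → ℂ) z * w z ∂μ = _
  refine integral_congr_ae ?_
  filter_upwards [(h.memLp_one u).coeFn_toLp] with z hz
  exact congrArg (· * w z) hz

theorem ReversibleAlgebra.integrable_snd_mul (h : ReversibleAlgebra κ μ 𝒜) (t : ℝ≥0) (u : 𝒜)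
    {w : Ω → ℂ} {K : ℝ} (hw : Measurable w) (hK : ∀ z, ‖w z‖ ≤ K) :
    Integrable (fun p : Ω × Ω => (u : Ω → ℂ) p.2 * w p.1) (jointLaw κ μ t) :=
  have := h.isProbabilityMeasure_jointLaw t
  ((h.memLp_snd t u).integrable (by norm_num)).mul_bdd (c := K)
    (hw.comp measurable_fst).aestronglyMeasurable (ae_of_all _ fun p => hK p.1)

theorem ReversibleAlgebra.pairing_semiL1 (h : ReversibleAlgebra κ μ 𝒜) (t : ℝ≥0) (u : 𝒜)
    {w : Ω → ℂ} {K : ℝ} (hw : Measurable w) (hK : ∀ z, ‖w z‖ ≤ K) :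
    pairing μ w hw hK (h.semiL1 t u) = ∫ p, (u : Ω → ℂ) p.2 * w p.1 ∂(jointLaw κ μ t) := by
  rw [← h.toL1_P, h.pairing_toL1]
  exact h.integral_semigroup_mul t (h.integrable_snd_mul t u hw hK)

/-- A matrix-valued function with entries in `𝒜`. -/
def HasEntries (𝒜 : StarSubalgebra ℂ (Ω → ℂ)) (f : Ω → Matrix (Fin d) (Fin d) ℂ) : Prop :=
  ∀ i j, (fun z => f z i j) ∈ 𝒜

/-- The entries of a matrix-valued function, as elements of the algebra. -/
def HasEntries.entry {f : Ω → Matrix (Fin d) (Fin d) ℂ} (hf : HasEntries 𝒜 f) (i j : Fin d) : 𝒜 :=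
  ⟨fun z => f z i j, hf i j⟩

omit [MeasurableSpace Ω] in
theorem IsSuitable.hasEntries {f : Ω → Matrix (Fin d) (Fin d) ℂ} (hf : IsSuitable 𝒜 f) :
    HasEntries 𝒜 f := hf.2

/-- The entrywise semigroup on matrix-valued functions. -/
noncomputable def matSemigroup (κ : ℝ≥0 → Kernel Ω Ω) (t : ℝ≥0)
    (f : Ω → Matrix (Fin d) (Fin d) ℂ) : Ω → Matrix (Fin d) (Fin d) ℂ :=
  fun z => Matrix.of fun i j => semigroup κ t (fun y => f y i j) z

namespace ReversibleAlgebra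

variable {f g : Ω → Matrix (Fin d) (Fin d) ℂ}

theorem hasEntries_matSemigroup (h : ReversibleAlgebra κ μ 𝒜) (t : ℝ≥0) (hf : HasEntries 𝒜 f) :
    HasEntries 𝒜 (matSemigroup κ t f) := fun i j => (h.P t (hf.entry i j)).2

theorem hasEntries_matGenerator (h : ReversibleAlgebra κ μ 𝒜) (hf : HasEntries 𝒜 f) :
    HasEntries 𝒜 (matGenerator κ f) := fun i j => (h.gen (hf.entry i j)).2

theorem carre_apply (h : ReversibleAlgebra κ μ 𝒜) (hf : HasEntries 𝒜 f) (hg : HasEntries 𝒜 g)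
    (i j : Fin d) :
    (fun z => carre κ f g z i j) = (((1 / 2 : ℂ) • (h.gen (∑ k, hf.entry i k * hg.entry k j) -
      (∑ k, hf.entry i k * h.gen (hg.entry k j)) - ∑ k, h.gen (hf.entry i k) * hg.entry k j) : 𝒜) :
        Ω → ℂ) := by
  have e1 : ((∑ k, hf.entry i k * hg.entry k j : 𝒜) : Ω → ℂ) = fun y => (f * g) y i j := by
    ext z
    simp [Matrix.mul_apply, HasEntries.entry]
  ext z
  have e2 : (h.gen (∑ k, hf.entry i k * hg.entry k j) : Ω → ℂ) z =
      matGenerator κ (f * g) z i j := by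
    rw [coe_gen, e1]
    rfl
  simp only [SetLike.val_smul, AddSubgroupClass.coe_sub, Pi.smul_apply, Pi.sub_apply, e2]
  simp [carre, Matrix.mul_apply, matGenerator, HasEntries.entry]

theorem hasEntries_carre (h : ReversibleAlgebra κ μ 𝒜) (hf : HasEntries 𝒜 f)
    (hg : HasEntries 𝒜 g) : HasEntries 𝒜 (carre κ f g) := fun i j => by
  rw [h.carre_apply hf hg]
  exact Subtype.property _

/-- The generator is linear on classes, so it distributes over the sum in a matrix product. Every
property of the matrix Γ is then inherited from scalar Γ, as an identity in L₁ only. -/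
theorem toL1_carre (h : ReversibleAlgebra κ μ 𝒜) (hf : HasEntries 𝒜 f) (hg : HasEntries 𝒜 g)
    (i j : Fin d) :
    h.toL1 ((h.hasEntries_carre hf hg).entry i j) =
      ∑ k, h.GamL1 (hf.entry i k) (hg.entry k j) := by
  have e : (h.hasEntries_carre hf hg).entry i j =
      (1 / 2 : ℂ) • (h.gen (∑ k, hf.entry i k * hg.entry k j) -
      (∑ k, hf.entry i k * h.gen (hg.entry k j)) - ∑ k, h.gen (hf.entry i k) * hg.entry k j) :=
    Subtype.ext (h.carre_apply hf hg i j)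
  rw [e]
  simp only [map_smul, map_sub, map_sum, toL1_gen]
  rw [← Finset.sum_sub_distrib, ← Finset.sum_sub_distrib, Finset.smul_sum]
  refine Finset.sum_congr rfl fun k _ => ?_
  rw [← toL1_Gam, Gam, map_smul, map_sub, map_sub, toL1_gen]

theorem hasEntries_carre₂ (h : ReversibleAlgebra κ μ 𝒜) (hf : HasEntries 𝒜 f)
    (hg : HasEntries 𝒜 g) : HasEntries 𝒜 (carre₂ κ f g) := fun i j =>
  𝒜.smul_mem (𝒜.sub_mem (𝒜.sub_mem (h.hasEntries_matGenerator (h.hasEntries_carre hf hg) i j)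
    (h.hasEntries_carre hf (h.hasEntries_matGenerator hg) i j))
    (h.hasEntries_carre (h.hasEntries_matGenerator hf) hg i j)) _

theorem toL1_gen_congr (h : ReversibleAlgebra κ μ 𝒜) {u v : 𝒜} (huv : h.toL1 u = h.toL1 v) :
    h.genL1 u = h.genL1 v :=
  h.toL1_eq_of_toL2_eq (h.toL2_gen_congr (h.toL2_eq_iff.2 (h.toL1_eq_iff.1 huv)))

/-- Γ₂ applies 𝓛 to entries of Γ(f, g) that are known only almost everywhere; `toL1_gen_congr` makes
this harmless. -/
theorem toL1_carre₂ (h : ReversibleAlgebra κ μ 𝒜) (hf : HasEntries 𝒜 f) (hg : HasEntries 𝒜 g)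
    (i j : Fin d) :
    h.toL1 ((h.hasEntries_carre₂ hf hg).entry i j) =
      ∑ k, h.toL1 (h.Gam₂ (hf.entry i k) (hg.entry k j)) := by
  have e : (h.hasEntries_carre₂ hf hg).entry i j = (1 / 2 : ℂ) •
      (h.gen ((h.hasEntries_carre hf hg).entry i j) -
        (h.hasEntries_carre hf (h.hasEntries_matGenerator hg)).entry i j -
        (h.hasEntries_carre (h.hasEntries_matGenerator hf) hg).entry i j) := rfl
  rw [e]
  have e2 : h.genL1 ((h.hasEntries_carre hf hg).entry i j) =
      h.genL1 (∑ k, h.Gam (hf.entry i k) (hg.entry k j)) := by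
    refine h.toL1_gen_congr ?_
    rw [toL1_carre, map_sum]
    rfl
  simp only [map_smul, map_sub, toL1_gen, e2]
  rw [h.toL1_carre hf (h.hasEntries_matGenerator hg), h.toL1_carre (h.hasEntries_matGenerator hf) hg,
    map_sum, ← Finset.sum_sub_distrib, ← Finset.sum_sub_distrib, Finset.smul_sum]
  refine Finset.sum_congr rfl fun k _ => ?_
  rw [Gam₂, map_smul, map_sub, map_sub, toL1_gen]
  rfl

end ReversibleAlgebra

/-! ### Hermitian symmetry -/

theorem semigroup_conj (t : ℝ≥0) (u : Ω → ℂ) (z : Ω) :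
    semigroup κ t (fun y => star (u y)) z = star (semigroup κ t u z) :=
  integral_conj

theorem generator_eq_of_tendsto {u : Ω → ℂ} {z : Ω} {a : ℂ}
    (ha : Tendsto (fun t : ℝ≥0 => diffQuot κ u t z) (𝓝[>] 0) (𝓝 a)) : generator κ u z = a := by
  have hex : ∃ a : ℂ, Tendsto (fun t : ℝ≥0 => diffQuot κ u t z) (𝓝[>] 0) (𝓝 a) := ⟨a, ha⟩
  rw [generator, dif_pos hex]
  exact tendsto_nhds_unique hex.choose_spec ha

/-- Because L is a continuous involution, the two limits exist together, and L 0 = 0 matches the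
default values. The identity thus holds at every point, as needed for `IsSuitable`, which asks for
Hermitian values everywhere. -/
theorem generator_comp (L : ℂ → ℂ) (hL : Continuous L) (hinv : ∀ z, L (L z) = z) (h0 : L 0 = 0)
    {u v : Ω → ℂ} {z : Ω} (huv : ∀ t, diffQuot κ v t z = L (diffQuot κ u t z)) :
    generator κ v z = L (generator κ u z) := by
  by_cases hex : ∃ a : ℂ, Tendsto (fun t : ℝ≥0 => diffQuot κ u t z) (𝓝[>] 0) (𝓝 a)
  · obtain ⟨a, ha⟩ := hex
    rw [generator_eq_of_tendsto ha]
    refine generator_eq_of_tendsto ?_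
    simp_rw [huv]
    exact (hL.tendsto a).comp ha
  · have hex' : ¬∃ a : ℂ, Tendsto (fun t : ℝ≥0 => diffQuot κ v t z) (𝓝[>] 0) (𝓝 a) := by
      rintro ⟨a, ha⟩
      refine hex ⟨L a, ?_⟩
      have := (hL.tendsto a).comp ha
      simpa only [Function.comp_def, huv, hinv] using this
    rw [generator, generator, dif_neg hex, dif_neg hex', h0]

theorem generator_conj (u : Ω → ℂ) (z : Ω) :
    generator κ (fun y => star (u y)) z = star (generator κ u z) := by
  refine generator_comp star continuous_star star_star (star_zero _) fun t => ?_
  simp only [diffQuot, semigroup_conj]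
  simp

theorem generator_neg (u : Ω → ℂ) (z : Ω) :
    generator κ (fun y => -u y) z = -generator κ u z := by
  refine generator_comp (fun z => -z) continuous_neg neg_neg neg_zero fun t => ?_
  simp only [diffQuot, semigroup, integral_neg]
  ring

variable {f : Ω → Matrix (Fin d) (Fin d) ℂ}

theorem isHermitian_matSemigroup (t : ℝ≥0) (hf : ∀ z, (f z).IsHermitian) (z : Ω) :
    (matSemigroup κ t f z).IsHermitian := by
  ext i j
  simp only [Matrix.conjTranspose_apply, matSemigroup, Matrix.of_apply]
  rw [← semigroup_conj]
  congr 1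
  ext y
  exact (hf y).apply i j

theorem isHermitian_matGenerator (hf : ∀ z, (f z).IsHermitian) (z : Ω) :
    (matGenerator κ f z).IsHermitian := by
  ext i j
  simp only [Matrix.conjTranspose_apply, matGenerator, Matrix.of_apply]
  rw [← generator_conj]
  congr 1
  ext y
  exact (hf y).apply i j

theorem isHermitian_carre (hf : ∀ z, (f z).IsHermitian) (z : Ω) :
    (carre κ f f z).IsHermitian := by
  have h1 : (matGenerator κ (f * f) z).IsHermitian := isHermitian_matGenerator (fun y => by
    change (f y * f y).conjTranspose = f y * f y
    rw [Matrix.conjTranspose_mul, (hf y).eq]) z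
  have h2 := isHermitian_matGenerator (κ := κ) hf z
  change ((1 / 2 : ℂ) • (matGenerator κ (f * f) z - f z * matGenerator κ f z -
    matGenerator κ f z * f z)).conjTranspose = (1 / 2 : ℂ) • (matGenerator κ (f * f) z - f z * matGenerator κ f z -
    matGenerator κ f z * f z)
  rw [Matrix.conjTranspose_smul, Matrix.conjTranspose_sub, Matrix.conjTranspose_sub,
    Matrix.conjTranspose_mul, Matrix.conjTranspose_mul, h1.eq, h2.eq, (hf z).eq]
  have : star (1 / 2 : ℂ) = 1 / 2 := by simp
  rw [this]
  congr 1
  abel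

theorem matGenerator_neg : matGenerator κ (-f) = -matGenerator κ f := by
  ext z i j
  exact generator_neg _ z

theorem carre_neg : carre κ (-f) (-f) = carre κ f f := by
  simp only [carre, matGenerator_neg, mul_neg, neg_mul, neg_neg]

theorem ReversibleAlgebra.isSuitable_matSemigroup (h : ReversibleAlgebra κ μ 𝒜) (t : ℝ≥0)
    (hf : IsSuitable 𝒜 f) : IsSuitable 𝒜 (matSemigroup κ t f) :=
  ⟨isHermitian_matSemigroup t hf.1, h.hasEntries_matSemigroup t hf.hasEntries⟩

end MatrixMarkov

/-! ### Correlations and the decay of the carré du champ -/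

namespace MatrixMarkov

variable {Ω : Type*} [MeasurableSpace Ω] {d : ℕ}
variable {κ : ℝ≥0 → Kernel Ω Ω} {μ : Measure Ω} {𝒜 : StarSubalgebra ℂ (Ω → ℂ)}
variable {f : Ω → Matrix (Fin d) (Fin d) ℂ} {Φ : Ω → Matrix (Fin d) (Fin d) ℂ} {K : ℝ}

/-- A bounded measurable matrix-valued function. -/
structure IsBoundedMatrix (Φ : Ω → Matrix (Fin d) (Fin d) ℂ) (K : ℝ) : Prop where
  measurable : ∀ i j, Measurable fun z => Φ z i j
  bound : ∀ i j z, ‖Φ z i j‖ ≤ K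

/-- The correlation `𝔼 tr [X(Z_t) Φ(Z_0)]`. -/
noncomputable def corr (κ : ℝ≥0 → Kernel Ω Ω) (μ : Measure Ω) (t : ℝ≥0)
    (X Φ : Ω → Matrix (Fin d) (Fin d) ℂ) : ℝ :=
  ∫ p, (X p.2 * Φ p.1).trace.re ∂(jointLaw κ μ t)

theorem trace_mul_re_eq_sum (X Y : Matrix (Fin d) (Fin d) ℂ) :
    (X * Y).trace.re = ∑ i, ∑ j, (X i j * Y j i).re := by
  simp [Matrix.trace, Matrix.mul_apply]

theorem integrable_trace_mul {α : Type*} [MeasurableSpace α] {ν : Measure α}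
    {X Y : α → Matrix (Fin d) (Fin d) ℂ} (hX : ∀ i j, Integrable (fun p => X p i j) ν)
    (hY : ∀ i j, AEStronglyMeasurable (fun p => Y p i j) ν) {C : ℝ} (hC : ∀ i j p, ‖Y p i j‖ ≤ C) :
    Integrable (fun p => (X p * Y p).trace.re) ν := by
  simp_rw [trace_mul_re_eq_sum]
  refine integrable_finsetSum _ fun i _ => integrable_finsetSum _ fun j _ => ?_
  exact ((hX i j).mul_bdd (c := C) (hY j i) (ae_of_all _ fun p => hC j i p)).re

theorem integral_trace_mul {α : Type*} [MeasurableSpace α] {ν : Measure α}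
    {X Y : α → Matrix (Fin d) (Fin d) ℂ} (hi : ∀ i j, Integrable (fun p => X p i j * Y p j i) ν) :
    ∫ p, (X p * Y p).trace.re ∂ν = ∑ i, ∑ j, (∫ p, X p i j * Y p j i ∂ν).re := by
  have hr : ∀ i j, Integrable (fun p => (X p i j * Y p j i).re) ν := fun i j => (hi i j).re
  simp_rw [trace_mul_re_eq_sum]
  rw [integral_finsetSum _ fun i _ => integrable_finsetSum _ fun j _ => hr i j]
  refine Finset.sum_congr rfl fun i _ => ?_
  rw [integral_finsetSum _ fun j _ => hr i j]
  exact Finset.sum_congr rfl fun j _ => integral_re (hi i j)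

namespace ReversibleAlgebra

theorem integrable_corr (h : ReversibleAlgebra κ μ 𝒜) (t : ℝ≥0) {X : Ω → Matrix (Fin d) (Fin d) ℂ}
    (hX : HasEntries 𝒜 X) (hΦ : IsBoundedMatrix Φ K) :
    Integrable (fun p : Ω × Ω => (X p.2 * Φ p.1).trace.re) (jointLaw κ μ t) :=
  have := h.isProbabilityMeasure_jointLaw t
  integrable_trace_mul (fun i j => (h.memLp_snd t (hX.entry i j)).integrable (by norm_num))
    (fun i j => ((hΦ.measurable i j).comp measurable_fst).aestronglyMeasurable)
    fun i j p => hΦ.bound i j p.1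

theorem corr_eq_sum (h : ReversibleAlgebra κ μ 𝒜) (t : ℝ≥0) {X : Ω → Matrix (Fin d) (Fin d) ℂ}
    (hX : HasEntries 𝒜 X) (hΦ : IsBoundedMatrix Φ K) :
    corr κ μ t X Φ = ∑ i, ∑ j, (pairing μ (fun z => Φ z j i) (hΦ.measurable j i) (hΦ.bound j i)
      (h.semiL1 t (hX.entry i j))).re := by
  have hi := fun i j => h.integrable_snd_mul t (hX.entry i j) (hΦ.measurable j i) (hΦ.bound j i)
  rw [corr, integral_trace_mul (X := fun p : Ω × Ω => X p.2) (Y := fun p => Φ p.1) hi]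
  simp_rw [h.pairing_semiL1]
  rfl

theorem corr_matSemigroup (h : ReversibleAlgebra κ μ 𝒜) (s t : ℝ≥0) (hf : HasEntries 𝒜 f)
    (hΦ : IsBoundedMatrix Φ K) :
    corr κ μ s (matSemigroup κ t f) Φ = corr κ μ (s + t) f Φ := by
  rw [h.corr_eq_sum s (h.hasEntries_matSemigroup t hf) hΦ, h.corr_eq_sum (s + t) hf hΦ]
  simp_rw [← semiL1_P]
  rfl

theorem corr_zero (h : ReversibleAlgebra κ μ 𝒜) (hf : HasEntries 𝒜 f)
    (hΦ : IsBoundedMatrix Φ K) : corr κ μ 0 f Φ = ∫ z, (f z * Φ z).trace.re ∂μ := by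
  rw [h.corr_eq_sum 0 hf hΦ]
  have hi : ∀ i j, Integrable (fun z => (hf.entry i j : Ω → ℂ) z * Φ z j i) μ := fun i j =>
    (h.integrable (hf.entry i j)).mul_bdd (c := K) (hΦ.measurable j i).aestronglyMeasurable
      (ae_of_all _ (hΦ.bound j i))
  rw [integral_trace_mul (X := f) hi]
  simp_rw [← toL1_P, toL2_P_zero, h.pairing_toL1]
  rfl

/-! ### Local ergodicity -/

theorem corr_carre_eq_sum (h : ReversibleAlgebra κ μ 𝒜) (t : ℝ≥0) (hf : HasEntries 𝒜 f)
    (hΦ : IsBoundedMatrix Φ K) :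
    corr κ μ t (carre κ f f) Φ = ∑ i, ∑ j, ∑ k, (pairing μ (fun z => Φ z j i) (hΦ.measurable j i)
      (hΦ.bound j i) (h.semiL1 t (h.Gam (hf.entry i k) (hf.entry k j)))).re := by
  rw [h.corr_eq_sum t (h.hasEntries_carre hf hf) hΦ]
  refine Finset.sum_congr rfl fun i _ => Finset.sum_congr rfl fun j _ => ?_
  have : h.semiL1 t ((h.hasEntries_carre hf hf).entry i j) =
      h.semiL1 t (∑ k, h.Gam (hf.entry i k) (hf.entry k j)) := by
    refine h.semiL1_congr t ?_
    rw [toL1_carre, map_sum]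
    rfl
  rw [this, map_sum, map_sum, Complex.re_sum]

theorem corr_carre₂_eq_sum (h : ReversibleAlgebra κ μ 𝒜) (t : ℝ≥0) (hf : HasEntries 𝒜 f)
    (hΦ : IsBoundedMatrix Φ K) :
    corr κ μ t (carre₂ κ f f) Φ = ∑ i, ∑ j, ∑ k, (pairing μ (fun z => Φ z j i) (hΦ.measurable j i)
      (hΦ.bound j i) (h.semiL1 t (h.Gam₂ (hf.entry i k) (hf.entry k j)))).re := by
  rw [h.corr_eq_sum t (h.hasEntries_carre₂ hf hf) hΦ]
  refine Finset.sum_congr rfl fun i _ => Finset.sum_congr rfl fun j _ => ?_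
  have : h.semiL1 t ((h.hasEntries_carre₂ hf hf).entry i j) =
      h.semiL1 t (∑ k, h.Gam₂ (hf.entry i k) (hf.entry k j)) := by
    refine h.semiL1_congr t ?_
    rw [toL1_carre₂, map_sum]
  rw [this, map_sum, map_sum, Complex.re_sum]

/-- The criterion holds μ-almost everywhere and Z_t has law μ, so it may be used at Z_t and tested
against the positive weight Φ(Z_0). -/
theorem corr_carre_le_carre₂ (h : ReversibleAlgebra κ μ 𝒜) {c : ℝ} (hBE : BakryEmery κ μ 𝒜 d c)
    (t : ℝ≥0) (hf : IsSuitable 𝒜 f) (hΦ : IsBoundedMatrix Φ K)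
    (hpos : ∀ z (X : Matrix (Fin d) (Fin d) ℂ), X.PosSemidef → 0 ≤ (X * Φ z).trace.re) :
    corr κ μ t (carre κ f f) Φ ≤ c * corr κ μ t (carre₂ κ f f) Φ := by
  rw [corr, corr, ← integral_const_mul]
  refine integral_mono_ae (h.integrable_corr t (h.hasEntries_carre hf.2 hf.2) hΦ)
    ((h.integrable_corr t (h.hasEntries_carre₂ hf.2 hf.2) hΦ).const_mul c) ?_
  filter_upwards [(h.measurePreserving_snd t).quasiMeasurePreserving.ae (hBE f hf)] with p hp
  have := hpos p.1 _ hp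
  rw [Matrix.sub_mul, Matrix.trace_sub, Matrix.smul_mul, Matrix.trace_smul, Complex.sub_re,
    smul_eq_mul, Complex.re_ofReal_mul] at this
  linarith

/-- Weak form of the local ergodicity bound `Γ(P_t f) ≼ e^{-2t/c} P_t Γ(f)`. -/
theorem corr_carre_matSemigroup_le (h : ReversibleAlgebra κ μ 𝒜) {c : ℝ} (hc : 0 < c)
    (hBE : BakryEmery κ μ 𝒜 d c) (t : ℝ≥0) (hf : IsSuitable 𝒜 f) (hΦ : IsBoundedMatrix Φ K)
    (hpos : ∀ z (X : Matrix (Fin d) (Fin d) ℂ), X.PosSemidef → 0 ≤ (X * Φ z).trace.re) :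
    corr κ μ 0 (carre κ (matSemigroup κ t f) (matSemigroup κ t f)) Φ ≤
      Real.exp (-(2 / c) * t) * corr κ μ t (carre κ f f) Φ := by
  -- F(s) = E tr[Γ(P_s f)(Z_{t-s}) Φ(Z_0)] joins the correlation of Γ(f) at time t, for s = 0, to
  -- that of Γ(P_t f) at time 0, for s = t.
  let F : ℝ → ℝ := fun s => ∑ i, ∑ j, ∑ k, (pairing μ (fun z => Φ z j i) (hΦ.measurable j i)
      (hΦ.bound j i) (h.interp t (hf.hasEntries.entry i k) (hf.hasEntries.entry k j) s)).re
  have hF : ∀ s : ℝ, F s = corr κ μ ((t : ℝ) - s).toNNReal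
      (carre κ (matSemigroup κ s.toNNReal f) (matSemigroup κ s.toNNReal f)) Φ := fun s =>
    (h.corr_carre_eq_sum _ (h.hasEntries_matSemigroup _ hf.hasEntries) hΦ).symm
  have hcont : Continuous F := by
    refine continuous_finsetSum _ fun i _ => continuous_finsetSum _ fun j _ =>
      continuous_finsetSum _ fun k _ => ?_
    exact Complex.continuous_re.comp ((ContinuousLinearMap.continuous _).comp
      (h.continuous_interp t _ _))
  let F' : ℝ → ℝ := fun s => -(2 * corr κ μ ((t : ℝ) - s).toNNReal
      (carre₂ κ (matSemigroup κ s.toNNReal f) (matSemigroup κ s.toNNReal f)) Φ)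
  have hderiv : ∀ s ∈ Set.Ico (0 : ℝ) t, HasDerivWithinAt F (F' s) (Set.Ici s) s := by
    intro s hs
    have e : F' s = ∑ i, ∑ j, ∑ k, (pairing μ (fun z => Φ z j i) (hΦ.measurable j i)
      (hΦ.bound j i) (-((2 : ℂ) • h.semiL1 ((t : ℝ) - s).toNNReal
        (h.Gam₂ (h.P s.toNNReal (hf.hasEntries.entry i k))
          (h.P s.toNNReal (hf.hasEntries.entry k j)))))).re := by
      change -(2 * corr κ μ ((t : ℝ) - s).toNNReal
        (carre₂ κ (matSemigroup κ s.toNNReal f) (matSemigroup κ s.toNNReal f)) Φ) = _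
      rw [h.corr_carre₂_eq_sum _ (h.hasEntries_matSemigroup _ hf.hasEntries) hΦ, Finset.mul_sum,
        ← Finset.sum_neg_distrib]
      refine Finset.sum_congr rfl fun i _ => ?_
      rw [Finset.mul_sum, ← Finset.sum_neg_distrib]
      refine Finset.sum_congr rfl fun j _ => ?_
      rw [Finset.mul_sum, ← Finset.sum_neg_distrib]
      refine Finset.sum_congr rfl fun k _ => ?_
      rw [two_smul ℂ, map_neg, map_add, Complex.neg_re, Complex.add_re, ← two_mul]
      rfl
    rw [e]
    refine HasDerivWithinAt.fun_sum fun i _ => HasDerivWithinAt.fun_sum fun j _ =>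
      HasDerivWithinAt.fun_sum fun k _ => ?_
    exact (Complex.reCLM.comp (pairing μ (fun z => Φ z j i) (hΦ.measurable j i)
      (hΦ.bound j i))).hasFDerivAt.comp_hasDerivWithinAt s (h.hasDerivWithinAt_interp t _ _ hs)
  -- The criterion for P_s f gives F' ≤ -(2/c) F.
  have key := le_gronwallBound_of_liminf_deriv_right_le (f := F) (f' := F') (δ := F 0)
    (K := -(2 / c)) (ε := 0) (a := 0) (b := t) hcont.continuousOn
    (fun s hs r hr => (hderiv s hs).liminf_right_slope_le hr) le_rfl (fun s hs => ?_) t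
    ⟨t.2, le_rfl⟩
  · rw [gronwallBound_ε0, hF, hF] at key
    simp only [sub_self, sub_zero, Real.toNNReal_zero, Real.toNNReal_coe] at key
    rw [h.corr_carre_eq_sum t (h.hasEntries_matSemigroup 0 hf.hasEntries) hΦ] at key
    have e0 : ∀ i k, (h.hasEntries_matSemigroup 0 hf.hasEntries).entry i k =
        hf.hasEntries.entry i k := fun i k => h.toL2_P_zero (hf.hasEntries.entry i k)
    simp_rw [e0] at key
    rw [← h.corr_carre_eq_sum t hf.hasEntries hΦ] at key
    linarith
  · have := h.corr_carre_le_carre₂ hBE ((t : ℝ) - s).toNNReal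
      (h.isSuitable_matSemigroup s.toNNReal hf) hΦ hpos
    rw [← hF] at this
    simp only [F', add_zero]
    rw [neg_mul, neg_le_neg_iff, div_mul_eq_mul_div, div_le_iff₀ hc]
    linarith

end ReversibleAlgebra

end MatrixMarkov

/-! ### Energies of increments and the covariance bound -/

namespace MatrixMarkov

variable {Ω : Type*} [MeasurableSpace Ω] {d : ℕ}
variable {κ : ℝ≥0 → Kernel Ω Ω} {μ : Measure Ω} {𝒜 : StarSubalgebra ℂ (Ω → ℂ)}
variable {f H : Ω → Matrix (Fin d) (Fin d) ℂ} {Φ : Ω → Matrix (Fin d) (Fin d) ℂ} {K : ℝ}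

namespace ReversibleAlgebra

/-- The weighted energy of the increments of `f`. -/
noncomputable def energy (κ : ℝ≥0 → Kernel Ω Ω) (μ : Measure Ω) (t : ℝ≥0)
    (f Ψ : Ω → Matrix (Fin d) (Fin d) ℂ) : ℝ :=
  ∫ p, ((f p.2 - f p.1) * (f p.2 - f p.1) * Ψ p.1).trace.re ∂(jointLaw κ μ t)

theorem integrable_increment_sq (h : ReversibleAlgebra κ μ 𝒜) (t : ℝ≥0) (hf : HasEntries 𝒜 f)
    (i j : Fin d) :
    Integrable (fun p : Ω × Ω => ((f p.2 - f p.1) * (f p.2 - f p.1)) i j) (jointLaw κ μ t) := by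
  simp only [Matrix.mul_apply, Matrix.sub_apply]
  exact integrable_finsetSum _ fun k _ =>
    (h.memLp_sub t (hf.entry i k)).integrable_mul (h.memLp_sub t (hf.entry k j))

theorem energy_eq_sum (h : ReversibleAlgebra κ μ 𝒜) (t : ℝ≥0) (hf : HasEntries 𝒜 f)
    (hΦ : IsBoundedMatrix Φ K) :
    energy κ μ t f Φ = ∑ i, ∑ j, ∑ k, (pairing μ (fun z => Φ z j i) (hΦ.measurable j i)
      (hΦ.bound j i) (h.toL1 (h.incr t (hf.entry i k) (hf.entry k j)))).re := by
  have := h.isProbabilityMeasure_jointLaw t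
  have hi : ∀ i j, Integrable (fun p : Ω × Ω => ((f p.2 - f p.1) * (f p.2 - f p.1)) i j *
      Φ p.1 j i) (jointLaw κ μ t) := fun i j =>
    (h.integrable_increment_sq t hf i j).mul_bdd (c := K)
      ((hΦ.measurable j i).comp measurable_fst).aestronglyMeasurable
      (ae_of_all _ fun p => hΦ.bound j i p.1)
  have hk : ∀ i j k, Integrable (fun p : Ω × Ω => ((hf.entry i k : Ω → ℂ) p.2 -
      (hf.entry i k : Ω → ℂ) p.1) * ((hf.entry k j : Ω → ℂ) p.2 - (hf.entry k j : Ω → ℂ) p.1) *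
        Φ p.1 j i) (jointLaw κ μ t) := fun i j k =>
    ((h.memLp_sub t (hf.entry i k)).integrable_mul (h.memLp_sub t (hf.entry k j))).mul_bdd (c := K)
      ((hΦ.measurable j i).comp measurable_fst).aestronglyMeasurable
      (ae_of_all _ fun p => hΦ.bound j i p.1)
  rw [energy, integral_trace_mul (X := fun p : Ω × Ω => (f p.2 - f p.1) * (f p.2 - f p.1))
    (Y := fun p => Φ p.1) hi]
  refine Finset.sum_congr rfl fun i _ => Finset.sum_congr rfl fun j _ => ?_
  simp_rw [h.pairing_toL1, fun k => h.integral_incr_mul t (hf.entry i k) (hf.entry k j)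
    (hΦ.measurable j i) (hΦ.bound j i)]
  rw [← Complex.re_sum, ← integral_finsetSum _ fun k _ => hk i j k]
  congr 1
  refine integral_congr_ae (ae_of_all _ fun p => ?_)
  simp only [Matrix.mul_apply, Matrix.sub_apply, Finset.sum_mul]
  rfl

/-- Given Z_0, the energy is a finite sum of `incr` terms paired with a bounded weight, and such
pairings are continuous on L₁. -/
theorem tendsto_energy (h : ReversibleAlgebra κ μ 𝒜) (hf : HasEntries 𝒜 f)
    (hΦ : IsBoundedMatrix Φ K) :
    Tendsto (fun t : ℝ≥0 => (2 * t : ℝ)⁻¹ * energy κ μ t f Φ) (𝓝[>] 0)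
      (𝓝 (corr κ μ 0 (carre κ f f) Φ)) := by
  rw [h.corr_carre_eq_sum 0 hf hΦ]
  simp_rw [h.energy_eq_sum _ hf hΦ, Finset.mul_sum]
  refine tendsto_finsetSum _ fun i _ => tendsto_finsetSum _ fun j _ => tendsto_finsetSum _
    fun k _ => ?_
  have h1 := ((Complex.continuous_re.comp (pairing μ (fun z => Φ z j i) (hΦ.measurable j i)
      (hΦ.bound j i)).continuous).tendsto _).comp
        (h.tendsto_incr (hf.entry i k) (hf.entry k j))
  rw [← toL1_P, toL2_P_zero]
  refine h1.congr fun t => ?_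
  have e : ∀ (a : ℝ) (x : Lp ℂ 1 μ), (a : ℂ) • x = a • x := fun a x => algebraMap_smul ℂ a x
  rw [Function.comp_apply, Function.comp_apply, ← Complex.ofReal_inv, e, map_smul, Complex.real_smul,
    Complex.re_ofReal_mul]

/-- Of the four terms of the product, the two diagonal ones agree by stationarity and the two mixed
ones by the symmetry of the joint law. -/
theorem corr_zero_sub_corr (h : ReversibleAlgebra κ μ 𝒜) (t : ℝ≥0)
    {g : Ω → Matrix (Fin d) (Fin d) ℂ} (hg : HasEntries 𝒜 g) (hΦ : IsBoundedMatrix Φ K) :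
    2 * (corr κ μ 0 g Φ - corr κ μ t g Φ) =
      ∫ p, ((g p.2 - g p.1) * (Φ p.2 - Φ p.1)).trace.re ∂(jointLaw κ μ t) := by
  have := h.isProbabilityMeasure_jointLaw t
  have i1 : ∀ a b : Ω × Ω → Ω, MeasurePreserving a (jointLaw κ μ t) μ →
      MeasurePreserving b (jointLaw κ μ t) μ →
      Integrable (fun p => (g (a p) * Φ (b p)).trace.re) (jointLaw κ μ t) := fun a b ha hb =>
    integrable_trace_mul (fun i j => ((h.memLp_two (hg.entry i j)).comp_measurePreserving
        ha).integrable (by norm_num))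
      (fun i j => ((hΦ.measurable i j).comp hb.measurable).aestronglyMeasurable)
      fun i j p => hΦ.bound i j _
  have hf1 := h.measurePreserving_fst t
  have hf2 := h.measurePreserving_snd t
  have hm : AEStronglyMeasurable (fun z => (g z * Φ z).trace.re) μ := by
    simp_rw [trace_mul_re_eq_sum]
    refine Measurable.aestronglyMeasurable (Finset.measurable_fun_sum _ fun i _ =>
      Finset.measurable_fun_sum _ fun j _ => Complex.measurable_re.comp
        ((h.measurable (hg.entry i j)).mul (hΦ.measurable j i)))
  have e : ∀ p : Ω × Ω, ((g p.2 - g p.1) * (Φ p.2 - Φ p.1)).trace.re =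
      (g p.2 * Φ p.2).trace.re - (g p.2 * Φ p.1).trace.re - (g p.1 * Φ p.2).trace.re +
        (g p.1 * Φ p.1).trace.re := by
    intro p
    simp only [Matrix.sub_mul, Matrix.mul_sub, Matrix.trace_sub, Complex.sub_re]
    ring
  have i22 := i1 _ _ hf2 hf2
  have i21 := i1 _ _ hf2 hf1
  have i12 := i1 _ _ hf1 hf2
  have i11 := i1 _ _ hf1 hf1
  have ia : Integrable (fun p : Ω × Ω => (g p.2 * Φ p.2).trace.re - (g p.2 * Φ p.1).trace.re)
    (jointLaw κ μ t) := i22.sub i21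
  have ib : Integrable (fun p : Ω × Ω => (g p.2 * Φ p.2).trace.re - (g p.2 * Φ p.1).trace.re -
    (g p.1 * Φ p.2).trace.re) (jointLaw κ μ t) := ia.sub i12
  have e1 := h.integral_swap t fun p : Ω × Ω => (g p.2 * Φ p.1).trace.re
  simp only [Prod.fst_swap, Prod.snd_swap] at e1
  simp_rw [e]
  rw [integral_add ib i11, integral_sub ia i12, integral_sub i22 i21,
    h.integral_comp_snd t hm, h.integral_comp_fst t hm, e1, ← h.corr_zero hg hΦ]
  simp only [corr]
  ring

/-- The step estimate that combines reversibility with the mean value trace inequality. -/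
theorem corr_zero_sub_corr_le (h : ReversibleAlgebra κ μ 𝒜) (t : ℝ≥0)
    {g : Ω → Matrix (Fin d) (Fin d) ℂ} (hg : IsSuitable 𝒜 g) (hf : HasEntries 𝒜 f)
    (hH : ∀ z, (H z).IsHermitian) (hHf : ∀ y z, H y - H z = f y - f z) {φ ψ : ℝ → ℝ}
    (hψ : ∀ a, 0 ≤ ψ a) (hφ : ∀ a b, |φ a - φ b| ≤ |a - b| * ((ψ a + ψ b) / 2))
    (hΦ : IsBoundedMatrix (fun z => (hH z).cfc φ) K) {K' : ℝ}
    (hΨ : IsBoundedMatrix (fun z => (hH z).cfc ψ) K') {σ : ℝ} (hσ : 0 < σ) :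
    corr κ μ 0 g (fun z => (hH z).cfc φ) - corr κ μ t g (fun z => (hH z).cfc φ) ≤
      σ / 4 * energy κ μ t f (fun z => (hH z).cfc ψ) +
        σ⁻¹ / 4 * energy κ μ t g (fun z => (hH z).cfc ψ) := by
  have := h.isProbabilityMeasure_jointLaw t
  have i1 : ∀ {f : Ω → Matrix (Fin d) (Fin d) ℂ}, HasEntries 𝒜 f → Integrable (fun p : Ω × Ω =>
      ((f p.2 - f p.1) * (f p.2 - f p.1) * (hH p.1).cfc ψ).trace.re) (jointLaw κ μ t) := fun hf =>
    integrable_trace_mul (h.integrable_increment_sq t hf)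
      (fun i j => ((hΨ.measurable i j).comp measurable_fst).aestronglyMeasurable)
      fun i j p => hΨ.bound i j p.1
  have i2 : ∀ {f : Ω → Matrix (Fin d) (Fin d) ℂ}, HasEntries 𝒜 f → Integrable (fun p : Ω × Ω =>
      ((f p.2 - f p.1) * (f p.2 - f p.1) * (hH p.2).cfc ψ).trace.re) (jointLaw κ μ t) := fun hf =>
    integrable_trace_mul (h.integrable_increment_sq t hf)
      (fun i j => ((hΨ.measurable i j).comp measurable_snd).aestronglyMeasurable)
      fun i j p => hΨ.bound i j p.2
  -- The squared increment is unchanged by the swap, so the weight may sit at Z_t or at Z_0.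
  have e1 : ∀ f : Ω → Matrix (Fin d) (Fin d) ℂ, ∫ p : Ω × Ω,
      ((f p.2 - f p.1) * (f p.2 - f p.1) * (hH p.2).cfc ψ).trace.re ∂(jointLaw κ μ t) =
        energy κ μ t f (fun z => (hH z).cfc ψ) := by
    intro f
    rw [energy, ← h.integral_swap t]
    refine integral_congr_ae (ae_of_all _ fun p => ?_)
    simp only [Prod.fst_swap, Prod.snd_swap]
    rw [← neg_sub (f p.1) (f p.2), neg_mul_neg]
  have i3 : ∀ {f : Ω → Matrix (Fin d) (Fin d) ℂ}, HasEntries 𝒜 f → ∀ a : ℝ, Integrable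
      (fun p : Ω × Ω => a * (((f p.2 - f p.1) * (f p.2 - f p.1) * (hH p.2).cfc ψ).trace.re +
        ((f p.2 - f p.1) * (f p.2 - f p.1) * (hH p.1).cfc ψ).trace.re)) (jointLaw κ μ t) :=
    fun hf a => ((i2 hf).add (i1 hf)).const_mul a
  have e2 : ∀ {f : Ω → Matrix (Fin d) (Fin d) ℂ}, HasEntries 𝒜 f → ∀ a : ℝ,
      ∫ p : Ω × Ω, a * (((f p.2 - f p.1) * (f p.2 - f p.1) * (hH p.2).cfc ψ).trace.re +
        ((f p.2 - f p.1) * (f p.2 - f p.1) * (hH p.1).cfc ψ).trace.re) ∂(jointLaw κ μ t) =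
        a * (2 * energy κ μ t f (fun z => (hH z).cfc ψ)) := by
    intro f hf a
    rw [integral_const_mul, integral_add (i2 hf) (i1 hf), e1, energy]
    ring
  have i4 : Integrable (fun p : Ω × Ω => ((g p.2 - g p.1) * ((hH p.2).cfc φ -
      (hH p.1).cfc φ)).trace.re) (jointLaw κ μ t) :=
    integrable_trace_mul (C := K + K)
      (fun i j => ((h.memLp_sub t (hg.hasEntries.entry i j))).integrable (by norm_num))
      (fun i j => (((hΦ.measurable i j).comp measurable_snd).sub
        ((hΦ.measurable i j).comp measurable_fst)).aestronglyMeasurable)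
      fun i j p => (norm_sub_le _ _).trans (add_le_add (hΦ.bound i j _) (hΦ.bound i j _))
  -- The trace inequality is used pointwise with A = H(Z_t), B = H(Z_0) and C the increment of g; A
  -- - B is then the increment of f.
  have key := integral_mono i4 ((i3 hf (σ / 4)).add (i3 hg.hasEntries (σ⁻¹ / 4))) fun p => by
    have := (hH p.2).trace_mul_cfc_sub_cfc_le (hH p.1) ((hg.1 p.2).sub (hg.1 p.1)) hψ hφ hσ
    rw [hHf] at this
    exact this
  have e3 := h.corr_zero_sub_corr t hg.hasEntries hΦ
  simp only [Pi.add_apply] at key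
  rw [integral_add (i3 hf (σ / 4)) (i3 hg.hasEntries (σ⁻¹ / 4)), e2 hf, e2 hg.hasEntries] at key
  linarith

/-! ### Ergodicity -/

theorem tendsto_semiL1_of_star_eq (h : ReversibleAlgebra κ μ 𝒜) (herg : IsErgodic κ μ) {u : 𝒜}
    (hu : star u = u) :
    Tendsto (fun t : ℝ≥0 => h.semiL1 t u) atTop
      (𝓝 (h.toL1 (algebraMap ℂ 𝒜 (∫ z, (u : Ω → ℂ) z ∂μ)))) := by
  have := h.prob
  set v : Ω → ℝ := fun z => ((u : Ω → ℂ) z).re with hv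
  have huv : (u : Ω → ℂ) = fun z => (v z : ℂ) := by
    ext z
    have : star ((u : Ω → ℂ) z) = (u : Ω → ℂ) z := congrFun (congrArg Subtype.val hu) z
    exact (Complex.conj_eq_iff_re.1 this).symm
  have hmem : MemLp v 2 μ := (h.memLp_two u).re
  have h1 := (ENNReal.tendsto_toReal ENNReal.zero_ne_top).comp (herg v hmem)
  rw [tendsto_iff_norm_sub_tendsto_zero]
  refine squeeze_zero (fun _ => norm_nonneg _) (fun t => ?_) h1
  rw [← toL1_P, ← map_sub]
  refine (h.norm_toL1_le _).trans (le_of_eq ?_)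
  rw [norm_toL2_eq, Function.comp_apply]
  congr 1
  refine eLpNorm_congr_norm_ae (ae_of_all _ fun z => ?_)
  have e1 : (h.P t u : Ω → ℂ) z = ((semigroup κ t v z : ℝ) : ℂ) := by
    rw [coe_P, huv]
    exact integral_ofReal
  have e2 : ∫ z, (u : Ω → ℂ) z ∂μ = ((∫ y, v y ∂μ : ℝ) : ℂ) := by
    rw [huv]
    exact integral_ofReal
  have e3 : ((h.P t u - algebraMap ℂ 𝒜 (∫ z, (u : Ω → ℂ) z ∂μ) : 𝒜) : Ω → ℂ) z =
      (h.P t u : Ω → ℂ) z - ∫ z, (u : Ω → ℂ) z ∂μ := rfl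
  rw [e3, e1, e2, ← Complex.ofReal_sub, Complex.norm_real]

/-- Ergodicity is assumed for real functions; u is split as a + i b with a and b self-adjoint, which
stay in the algebra. -/
theorem tendsto_semiL1 (h : ReversibleAlgebra κ μ 𝒜) (herg : IsErgodic κ μ) (u : 𝒜) :
    Tendsto (fun t : ℝ≥0 => h.semiL1 t u) atTop
      (𝓝 (h.toL1 (algebraMap ℂ 𝒜 (∫ z, (u : Ω → ℂ) z ∂μ)))) := by
  set a : 𝒜 := (1 / 2 : ℂ) • (u + star u) with ha
  set b : 𝒜 := (-Complex.I / 2) • (u - star u) with hb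
  have hu : u = a + Complex.I • b := by
    rw [ha, hb, smul_smul, show Complex.I * (-Complex.I / 2) = 1 / 2 by
      linear_combination (-1 / 2 : ℂ) * Complex.I_mul_I, ← smul_add]
    rw [show u + star u + (u - star u) = (2 : ℂ) • u by rw [two_smul]; abel, smul_smul]
    norm_num
  have hsa : star a = a := by
    rw [ha, star_smul, star_add, star_star, add_comm]
    simp
  have hsb : star b = b := by
    rw [hb, star_smul, star_sub, star_star, ← neg_sub u, smul_neg, ← neg_smul]
    congr 1
    simp
    ring
  have e : ∫ z, (u : Ω → ℂ) z ∂μ = ∫ z, (a : Ω → ℂ) z ∂μ + Complex.I * ∫ z, (b : Ω → ℂ) z ∂μ := by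
    rw [← integral_const_mul, ← integral_add (h.integrable a) ((h.integrable b).const_mul _)]
    conv_lhs => rw [hu]
    rfl
  have := (h.tendsto_semiL1_of_star_eq herg hsa).add
    ((h.tendsto_semiL1_of_star_eq herg hsb).const_smul Complex.I)
  rw [← map_smul, ← map_add] at this
  rw [e, map_add, ← smul_eq_mul, show algebraMap ℂ 𝒜 (Complex.I • ∫ z, (b : Ω → ℂ) z ∂μ) =
    Complex.I • algebraMap ℂ 𝒜 (∫ z, (b : Ω → ℂ) z ∂μ) by
      rw [Algebra.algebraMap_eq_smul_one, Algebra.algebraMap_eq_smul_one, smul_assoc]]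
  refine this.congr fun t => ?_
  rw [← map_smul, ← map_add, ← hu]

theorem tendsto_corr (h : ReversibleAlgebra κ μ 𝒜) (herg : IsErgodic κ μ) (hf : HasEntries 𝒜 f)
    (hΦ : IsBoundedMatrix Φ K) :
    Tendsto (fun t : ℝ≥0 => corr κ μ t f Φ) atTop
      (𝓝 (∫ z, (matMean μ f * Φ z).trace.re ∂μ)) := by
  have := h.prob
  have hi : ∀ i j, Integrable (fun z => matMean μ f i j * Φ z j i) μ := fun i j =>
    (integrable_const _).mul_bdd (c := K) (hΦ.measurable j i).aestronglyMeasurable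
      (ae_of_all _ (hΦ.bound j i))
  rw [integral_trace_mul (X := fun _ => matMean μ f) hi]
  simp_rw [h.corr_eq_sum _ hf hΦ]
  refine tendsto_finsetSum _ fun i _ => tendsto_finsetSum _ fun j _ => ?_
  have h1 := ((Complex.continuous_re.comp (pairing μ (fun z => Φ z j i) (hΦ.measurable j i)
      (hΦ.bound j i)).continuous).tendsto _).comp (h.tendsto_semiL1 herg (hf.entry i j))
  simp only [Function.comp_def, h.pairing_toL1] at h1
  exact h1

theorem continuous_corr (h : ReversibleAlgebra κ μ 𝒜) (hf : HasEntries 𝒜 f)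
    (hΦ : IsBoundedMatrix Φ K) : Continuous fun s : ℝ => corr κ μ s.toNNReal f Φ := by
  simp_rw [h.corr_eq_sum _ hf hΦ]
  refine continuous_finsetSum _ fun i _ => continuous_finsetSum _ fun j _ =>
    Complex.continuous_re.comp ((ContinuousLinearMap.continuous _).comp ?_)
  rw [continuous_iff_continuousAt]
  intro s
  rw [ContinuousAt, tendsto_iff_norm_sub_tendsto_zero]
  have hlim : Tendsto (fun y : ℝ => |y - s| * ‖h.toL2 (h.gen (hf.entry i j))‖) (𝓝 s) (𝓝 0) :=
    Continuous.tendsto' (by fun_prop) _ _ (by simp)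
  refine squeeze_zero (fun _ => norm_nonneg _) (fun y => ?_) hlim
  exact (h.norm_semiL1_sub_semiL1_le _ _ _).trans
    (mul_le_mul_of_nonneg_right (abs_toNNReal_sub_le _ _) (norm_nonneg _))

/-- The covariance bound. -/
theorem corr_zero_sub_le (h : ReversibleAlgebra κ μ 𝒜) (herg : IsErgodic κ μ) {c : ℝ} (hc : 0 < c)
    (hBE : BakryEmery κ μ 𝒜 d c) (hf : IsSuitable 𝒜 f)
    (hH : ∀ z, (H z).IsHermitian) (hHf : ∀ y z, H y - H z = f y - f z) {φ ψ : ℝ → ℝ}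
    (hψ : ∀ a, 0 ≤ ψ a) (hφ : ∀ a b, |φ a - φ b| ≤ |a - b| * ((ψ a + ψ b) / 2))
    (hΦ : IsBoundedMatrix (fun z => (hH z).cfc φ) K) {K' : ℝ}
    (hΨ : IsBoundedMatrix (fun z => (hH z).cfc ψ) K') {B : ℝ}
    (hB : ∀ r, corr κ μ r (carre κ f f) (fun z => (hH z).cfc ψ) ≤ B) :
    ∫ z, (f z * (hH z).cfc φ).trace.re ∂μ - ∫ z, (matMean μ f * (hH z).cfc φ).trace.re ∂μ ≤
      c * B := by
  set Φ : Ω → Matrix (Fin d) (Fin d) ℂ := fun z => (hH z).cfc φ with hΦdef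
  set Ψ : Ω → Matrix (Fin d) (Fin d) ℂ := fun z => (hH z).cfc ψ with hΨdef
  let D : ℝ → ℝ := fun s => -corr κ μ s.toNNReal f Φ
  have hD : Continuous D := (h.continuous_corr hf.hasEntries hΦ).neg
  -- The barrier with slope B e^{-s/c}; its total rise over [0, ∞) is c B.
  let b : ℝ → ℝ := fun s => D 0 + c * B * (1 - Real.exp (-s / c))
  let b' : ℝ → ℝ := fun s => B * Real.exp (-s / c)
  have hb : ∀ s, HasDerivAt b (b' s) s := by
    intro s
    have h1 : HasDerivAt (fun s : ℝ => -s / c) (-1 / c) s := ((hasDerivAt_id s).neg).div_const c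
    have h2 := ((h1.exp.const_sub 1).const_mul (c * B)).const_add (D 0)
    refine h2.congr_deriv ?_
    simp only [b']
    field_simp
  have hbound : ∀ s : ℝ, 0 ≤ s → ∀ r, b' s < r → ∃ᶠ y in 𝓝[>] s, slope D s y < r := by
    intro s hs r hr
    -- The energy of P_s f carries the factor e^{-2s/c} = σ², so the weights σ/2 and σ⁻¹/2 make both
    -- contributions equal to σB/2.
    set σ := Real.exp (-s / c) with hσ
    have hσ0 : 0 < σ := Real.exp_pos _
    set g := matSemigroup κ s.toNNReal f with hg
    have hgs : IsSuitable 𝒜 g := h.isSuitable_matSemigroup _ hf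
    have e1 := (((h.tendsto_energy hf.hasEntries hΨ).const_mul (σ / 2)).add
      ((h.tendsto_energy hgs.hasEntries hΨ).const_mul (σ⁻¹ / 2))).comp (tendsto_toNNReal_sub s)
    have e2 : σ / 2 * corr κ μ 0 (carre κ f f) Ψ + σ⁻¹ / 2 * corr κ μ 0 (carre κ g g) Ψ < r := by
      refine lt_of_le_of_lt ?_ hr
      have l1 := hB 0
      have l2 := h.corr_carre_matSemigroup_le hc hBE s.toNNReal hf hΨ
        (fun z X hX => (hH z).trace_mul_cfc_re_nonneg hX hψ)
      have l3 := hB s.toNNReal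
      have l4 : Real.exp (-(2 / c) * (s.toNNReal : ℝ)) = σ * σ := by
        rw [hσ, ← Real.exp_add, Real.coe_toNNReal _ hs]
        congr 1
        ring
      rw [l4] at l2
      have l5 : corr κ μ 0 (carre κ g g) Ψ ≤ σ * σ * B :=
        l2.trans (mul_le_mul_of_nonneg_left l3 (by positivity))
      calc _ ≤ σ / 2 * B + σ⁻¹ / 2 * (σ * σ * B) := by gcongr
        _ = b' s := by
          change _ = B * σ
          field_simp
          ring
    refine Eventually.frequently ?_
    filter_upwards [e1.eventually_lt_const e2, self_mem_nhdsWithin] with y hy hys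
    refine lt_of_le_of_lt ?_ hy
    have hys : 0 < y - s := sub_pos.2 hys
    have hc1 : ((y - s).toNNReal : ℝ) = y - s := Real.coe_toNNReal _ hys.le
    have e3 : y.toNNReal = (y - s).toNNReal + s.toNNReal := by
      rw [← Real.toNNReal_add hys.le hs]
      congr 1
      ring
    -- The step from s to y is a step from time 0 for g = P_s f, by the semigroup law; only the
    -- slope at s is needed.
    have e4 := h.corr_zero_sub_corr_le (y - s).toNNReal hgs hf.hasEntries hH hHf hψ hφ hΦ hΨ hσ0
    rw [h.corr_matSemigroup _ _ hf.hasEntries hΦ, h.corr_matSemigroup _ _ hf.hasEntries hΦ,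
      zero_add, ← e3] at e4
    simp only [Function.comp_apply, hc1]
    rw [slope_def_field, div_le_iff₀ hys]
    simp only [D]
    have e5 : (σ / 2 * ((2 * (y - s))⁻¹ * energy κ μ (y - s).toNNReal f Ψ) +
        σ⁻¹ / 2 * ((2 * (y - s))⁻¹ * energy κ μ (y - s).toNNReal g Ψ)) * (y - s) =
        σ / 4 * energy κ μ (y - s).toNNReal f Ψ + σ⁻¹ / 4 * energy κ μ (y - s).toNNReal g Ψ := by
      field_simp
      ring
    rw [e5]
    linarith
  have hle : ∀ s : ℝ, 0 ≤ s → D s ≤ b s := fun s hs =>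
    image_le_of_liminf_slope_right_le_deriv_boundary (a := 0) (b := s) hD.continuousOn
      (by simp [b]) (fun y _ => (hb y).continuousAt.continuousWithinAt)
      (fun y _ => (hb y).hasDerivWithinAt) (fun y hy => hbound y hy.1) ⟨hs, le_rfl⟩
  -- Ergodicity identifies the end value of D with the product of means, so letting s tend to
  -- infinity yields the covariance.
  have hlim1 : Tendsto D atTop (𝓝 (-∫ z, (matMean μ f * Φ z).trace.re ∂μ)) :=
    ((h.tendsto_corr herg hf.hasEntries hΦ).comp Real.tendsto_toNNReal_atTop).neg
  have hlim2 : Tendsto b atTop (𝓝 (D 0 + c * B * (1 - 0))) := by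
    refine Tendsto.const_add _ (Tendsto.const_mul _ (Tendsto.const_sub _ ?_))
    refine Real.tendsto_exp_atBot.comp ?_
    simp_rw [neg_div]
    exact tendsto_neg_atTop_atBot.comp (tendsto_id.atTop_div_const hc)
  have hfin := le_of_tendsto_of_tendsto hlim1 hlim2
    ((eventually_ge_atTop 0).mono fun s hs => hle s hs)
  have hD0 : D 0 = -∫ z, (f z * Φ z).trace.re ∂μ := by
    simp only [D, Real.toNNReal_zero]
    rw [h.corr_zero hf.hasEntries hΦ]
  rw [hD0] at hfin
  linarith

end ReversibleAlgebra

end MatrixMarkov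

/-! ### Truncated exponentials and the entropic bound -/

namespace Matrix.IsHermitian

variable {n : Type*} [Fintype n] [DecidableEq n] {A : Matrix n n ℂ}

theorem cfc_mul_cfc (hA : A.IsHermitian) (p q : ℝ → ℝ) :
    hA.cfc p * hA.cfc q = hA.cfc fun x => p x * q x := by
  simp only [cfc_eq_mul, Matrix.mul_assoc]
  rw [← Matrix.mul_assoc (star _) (hA.eigenvectorUnitary : Matrix n n ℂ),
    star_mul_eigenvectorUnitary, Matrix.one_mul, ← Matrix.mul_assoc (Matrix.diagonal _),
    Matrix.diagonal_mul_diagonal]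
  simp

theorem cfc_const_mul (hA : A.IsHermitian) (a : ℝ) (φ : ℝ → ℝ) :
    hA.cfc (fun x => a * φ x) = (a : ℂ) • hA.cfc φ := by
  rw [cfc_eq_mul, cfc_eq_mul, ← Matrix.smul_mul, ← Matrix.mul_smul, ← Matrix.diagonal_smul]
  congr 3
  ext j
  simp

theorem trace_cfc_re (hA : A.IsHermitian) (φ : ℝ → ℝ) :
    (hA.cfc φ).trace.re = ∑ j, φ (hA.eigenvalues j) := by
  rw [trace_cfc, Complex.ofReal_re]

theorem trace_mul_cfc_self_re (hA : A.IsHermitian) (φ : ℝ → ℝ) :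
    (A * hA.cfc φ).trace.re = ∑ j, hA.eigenvalues j * φ (hA.eigenvalues j) := by
  have : A * hA.cfc φ = hA.cfc fun x => x * φ x := by
    rw [← hA.cfc_mul_cfc (fun x => x) φ]
    congr 1
    exact hA.cfc_id_eq.symm
  rw [this, trace_cfc_re]

theorem trace_mul_self_re (hA : A.IsHermitian) :
    (A * A).trace.re = ∑ j, hA.eigenvalues j ^ 2 := by
  have h1 := hA.trace_mul_cfc_self_re id
  rw [cfc_id_eq] at h1
  rw [h1]
  exact Finset.sum_congr rfl fun j _ => by rw [id, sq]

theorem trace_re (hA : A.IsHermitian) : A.trace.re = ∑ j, hA.eigenvalues j := by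
  have h1 := hA.trace_cfc_re id
  rwa [cfc_id_eq] at h1

end Matrix.IsHermitian

namespace MatrixMarkov

/-- The trapezoid bound for the convex function exp. It is the scalar mean value hypothesis of the
trace inequality. -/
theorem exp_sub_exp_le (x y : ℝ) :
    |Real.exp x - Real.exp y| ≤ |x - y| * ((Real.exp x + Real.exp y) / 2) := by
  wlog hxy : y ≤ x generalizing x y
  · rw [abs_sub_comm, abs_sub_comm x, add_comm]
    exact this y x (le_of_not_ge hxy)
  have key : ∀ t : ℝ, 0 ≤ t → Real.exp t - 1 ≤ t * ((Real.exp t + 1) / 2) := by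
    intro t ht
    let g : ℝ → ℝ := fun t => t * ((Real.exp t + 1) / 2) - Real.exp t
    have hg : ∀ t, HasDerivAt g ((1 - Real.exp t + t * Real.exp t) / 2) t := by
      intro t
      have := ((hasDerivAt_id t).mul (((Real.hasDerivAt_exp t).add_const 1).div_const 2)).sub
        (Real.hasDerivAt_exp t)
      refine this.congr_deriv ?_
      simp only [id]
      ring
    have hmono : Monotone g := monotone_of_deriv_nonneg (fun t => (hg t).differentiableAt) fun t => by
      rw [(hg t).deriv]
      have h1 := Real.add_one_le_exp (-t)
      have h2 := mul_le_mul_of_nonneg_right h1 (Real.exp_pos t).le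
      rw [← Real.exp_add, neg_add_cancel, Real.exp_zero] at h2
      linarith
    have := hmono ht
    simp only [g, Real.exp_zero] at this
    linarith
  rw [abs_of_nonneg (sub_nonneg.2 (Real.exp_le_exp.2 hxy)), abs_of_nonneg (sub_nonneg.2 hxy)]
  have h1 := mul_le_mul_of_nonneg_right (key (x - y) (sub_nonneg.2 hxy)) (Real.exp_pos y).le
  have h2 : Real.exp (x - y) * Real.exp y = Real.exp x := by rw [← Real.exp_add]; ring_nf
  calc Real.exp x - Real.exp y = (Real.exp (x - y) - 1) * Real.exp y := by rw [sub_mul, h2]; ring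
    _ ≤ _ := h1
    _ = (x - y) * ((Real.exp (x - y) * Real.exp y + Real.exp y) / 2) := by ring
    _ = _ := by rw [h2]

/-- The truncated exponential `x ↦ e^{θ min(x, N)}`. -/
noncomputable def truncExp (θ N x : ℝ) : ℝ := Real.exp (θ * min x N)

theorem continuous_truncExp (θ N : ℝ) : Continuous (truncExp θ N) := by
  unfold truncExp; fun_prop

theorem truncExp_pos (θ N x : ℝ) : 0 < truncExp θ N x := Real.exp_pos _

theorem truncExp_le {θ : ℝ} (hθ : 0 ≤ θ) (N x : ℝ) : truncExp θ N x ≤ Real.exp (θ * N) :=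
  Real.exp_le_exp.2 (mul_le_mul_of_nonneg_left (min_le_right _ _) hθ)

/-- Truncation x ↦ min(x, N) is 1-Lipschitz, so the trapezoid bound survives with weight ψ = θφ even
though φ is neither smooth nor convex for θ > 0. -/
theorem abs_truncExp_sub_le {θ : ℝ} (hθ : 0 ≤ θ) (N a b : ℝ) :
    |truncExp θ N a - truncExp θ N b| ≤
      |a - b| * ((θ * truncExp θ N a + θ * truncExp θ N b) / 2) := by
  refine (exp_sub_exp_le _ _).trans ?_
  have h1 : |θ * min a N - θ * min b N| ≤ θ * |a - b| := by
    rw [← mul_sub, abs_mul, abs_of_nonneg hθ]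
    refine mul_le_mul_of_nonneg_left ?_ hθ
    simpa using abs_min_sub_min_le_max a N b N
  refine (mul_le_mul_of_nonneg_right h1 (by positivity)).trans (le_of_eq ?_)
  unfold truncExp
  ring

variable {Ω : Type*} [MeasurableSpace Ω] {d : ℕ}
variable {κ : ℝ≥0 → Kernel Ω Ω} {μ : Measure Ω} {𝒜 : StarSubalgebra ℂ (Ω → ℂ)}
variable {f H : Ω → Matrix (Fin d) (Fin d) ℂ}

theorem isBoundedMatrix_cfc (hHm : ∀ i j, Measurable fun z => H z i j)
    (hH : ∀ z, (H z).IsHermitian) {φ : ℝ → ℝ} (hφ : Continuous φ) {M : ℝ} (hM : ∀ x, |φ x| ≤ M) :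
    IsBoundedMatrix (fun z => (hH z).cfc φ) (d * M) where
  measurable i j := measurable_cfc_apply hHm hH hφ i j
  bound i j z := by
    have := (hH z).norm_cfc_apply_le (fun j => hM ((hH z).eigenvalues j)) i j
    rwa [Fintype.card_fin] at this

theorem measurable_sum_eigenvalues (hHm : ∀ i j, Measurable fun z => H z i j)
    (hH : ∀ z, (H z).IsHermitian) {φ : ℝ → ℝ} (hφ : Continuous φ) :
    Measurable fun z => ∑ j, φ ((hH z).eigenvalues j) := by
  simp_rw [← fun z => (hH z).trace_cfc_re φ, Matrix.trace, Complex.re_sum]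
  exact Finset.measurable_fun_sum _ fun i _ =>
    Complex.measurable_re.comp (measurable_cfc_apply hHm hH hφ i i)

namespace ReversibleAlgebra

theorem measurable_entry (h : ReversibleAlgebra κ μ 𝒜) (hf : HasEntries 𝒜 f) (i j : Fin d) :
    Measurable fun z => f z i j := h.measurable (hf.entry i j)

theorem integrable_sum_sq_eigenvalues (h : ReversibleAlgebra κ μ 𝒜) (hH : IsSuitable 𝒜 H) :
    Integrable (fun z => ∑ j, (hH.1 z).eigenvalues j ^ 2) μ := by
  simp_rw [← fun z => (hH.1 z).trace_mul_self_re, trace_mul_re_eq_sum]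
  exact integrable_finsetSum _ fun i _ => integrable_finsetSum _ fun j _ =>
    (h.integrable (hH.hasEntries.entry i j * hH.hasEntries.entry j i)).re

/-- Quadratic growth is allowed because tr H² is integrable when the entries are in L₂. -/
theorem integrable_sum_eigenvalues (h : ReversibleAlgebra κ μ 𝒜) (hH : IsSuitable 𝒜 H)
    {φ : ℝ → ℝ} (hφ : Continuous φ) {a : ℝ} (ha : ∀ x, |φ x| ≤ a * (1 + x ^ 2)) :
    Integrable (fun z => ∑ j, φ ((hH.1 z).eigenvalues j)) μ := by
  have := h.prob
  refine Integrable.mono' (((integrable_const (d : ℝ)).add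
    (h.integrable_sum_sq_eigenvalues hH)).const_mul a)
    (measurable_sum_eigenvalues (h.measurable_entry hH.hasEntries) hH.1 hφ).aestronglyMeasurable
    (ae_of_all _ fun z => ?_)
  refine (Finset.abs_sum_le_sum_abs _ _).trans ?_
  refine (Finset.sum_le_sum fun j _ => ha ((hH.1 z).eigenvalues j)).trans (le_of_eq ?_)
  rw [← Finset.mul_sum, Finset.sum_add_distrib]
  simp

/-- The entropic bound on the correlations of the carré du champ. -/
theorem mul_corr_carre_le (h : ReversibleAlgebra κ μ 𝒜) (hf : IsSuitable 𝒜 f)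
    (hH : IsSuitable 𝒜 H) {θ : ℝ} (hθ : 0 ≤ θ) (N : ℝ) {β : ℝ}
    (hint : Integrable (fun z => ∑ j, Real.exp (β * (isHermitian_carre (κ := κ) hf.1 z).eigenvalues j)) μ)
    (hint1 : Integrable (fun z => ∑ j, min ((hH.1 z).eigenvalues j) N *
      truncExp θ N ((hH.1 z).eigenvalues j)) μ)
    (hint0 : Integrable (fun z => ∑ j, truncExp θ N ((hH.1 z).eigenvalues j)) μ)
    (ρ : ℝ) (t : ℝ≥0) :
    β * corr κ μ t (carre κ f f) (fun z => (hH.1 z).cfc (truncExp θ N)) ≤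
      Real.exp (-ρ) * (∫ z, ∑ j, Real.exp (β * (isHermitian_carre (κ := κ) hf.1 z).eigenvalues j) ∂μ) +
      (θ * (∫ z, ∑ j, min ((hH.1 z).eigenvalues j) N * truncExp θ N ((hH.1 z).eigenvalues j) ∂μ) +
        (ρ - 1) * ∫ z, ∑ j, truncExp θ N ((hH.1 z).eigenvalues j) ∂μ) := by
  have hΦ : IsBoundedMatrix (fun z => (hH.1 z).cfc (truncExp θ N)) (d * Real.exp (θ * N)) :=
    isBoundedMatrix_cfc (h.measurable_entry hH.hasEntries) hH.1 (continuous_truncExp θ N) fun x => by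
      rw [abs_of_pos (truncExp_pos _ _ _)]
      exact truncExp_le hθ N x
  have hs1 := (h.measurePreserving_fst t)
  have hs2 := (h.measurePreserving_snd t)
  have j1 := (hs2.integrable_comp hint.1).2 hint
  have j2 := (hs1.integrable_comp hint1.1).2 hint1
  have j3 := (hs1.integrable_comp hint0.1).2 hint0
  simp only [Function.comp_def] at j1 j2 j3
  have key : ∀ p : Ω × Ω, β * (carre κ f f p.2 * (hH.1 p.1).cfc (truncExp θ N)).trace.re ≤
      Real.exp (-ρ) * ∑ j, Real.exp (β * (isHermitian_carre (κ := κ) hf.1 p.2).eigenvalues j) +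
      (θ * (∑ j, min ((hH.1 p.1).eigenvalues j) N * truncExp θ N ((hH.1 p.1).eigenvalues j)) +
        (ρ - 1) * ∑ j, truncExp θ N ((hH.1 p.1).eigenvalues j)) := by
    intro p
    have k1 := (isHermitian_carre (κ := κ) hf.1 p.2).trace_cfc_mul_cfc_le (hH.1 p.1)
      (p := fun a => β * a) (q := truncExp θ N) (r := fun a => Real.exp (-ρ) * Real.exp (β * a))
      (s := fun b => θ * (min b N * truncExp θ N b) + (ρ - 1) * truncExp θ N b) (fun a b => by
        -- Scalar Young inequality between exp and the entropy: x + 1 ≤ e^x at this x, multiplied by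
        -- e^{θ min(b, N)}. Klein's inequality lifts it to traces; ρ is to be optimised later.
        have e1 := Real.add_one_le_exp (β * a - ρ - θ * min b N)
        have e2 := mul_le_mul_of_nonneg_right e1 (truncExp_pos θ N b).le
        have e3 : Real.exp (β * a - ρ - θ * min b N) * truncExp θ N b =
            Real.exp (-ρ) * Real.exp (β * a) := by
          rw [truncExp, ← Real.exp_add, ← Real.exp_add]
          ring_nf
        rw [e3] at e2
        linarith)
    have k2 : (isHermitian_carre (κ := κ) hf.1 p.2).cfc (fun a => β * a) =
        (β : ℂ) • carre κ f f p.2 := by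
      have := (isHermitian_carre (κ := κ) hf.1 p.2).cfc_const_mul β id
      rw [Matrix.IsHermitian.cfc_id_eq] at this
      exact this
    rw [k2, Matrix.smul_mul, Matrix.trace_smul, smul_eq_mul, Complex.re_ofReal_mul,
      Matrix.IsHermitian.trace_cfc_re, Matrix.IsHermitian.trace_cfc_re, Finset.sum_add_distrib,
      ← Finset.mul_sum, ← Finset.mul_sum, ← Finset.mul_sum] at k1
    exact k1
  have jc := (h.integrable_corr t (h.hasEntries_carre hf.hasEntries hf.hasEntries) hΦ).const_mul β
  have j23 : Integrable (fun p : Ω × Ω =>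
      θ * (∑ j, min ((hH.1 p.1).eigenvalues j) N * truncExp θ N ((hH.1 p.1).eigenvalues j)) +
        (ρ - 1) * ∑ j, truncExp θ N ((hH.1 p.1).eigenvalues j)) (jointLaw κ μ t) :=
    (j2.const_mul θ).add (j3.const_mul (ρ - 1))
  have hm := integral_mono jc ((j1.const_mul (Real.exp (-ρ))).add j23) key
  simp only [Pi.add_apply] at hm
  rw [integral_const_mul, integral_add (j1.const_mul (Real.exp (-ρ))) j23,
    integral_add (j2.const_mul θ) (j3.const_mul (ρ - 1)),
    integral_const_mul, integral_const_mul, integral_const_mul] at hm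
  rw [h.integral_comp_snd t (F := fun z => ∑ j, Real.exp (β *
    (isHermitian_carre (κ := κ) hf.1 z).eigenvalues j)) hint.1,
    h.integral_comp_fst t (F := fun z => ∑ j, min ((hH.1 z).eigenvalues j) N *
      truncExp θ N ((hH.1 z).eigenvalues j)) hint1.1,
    h.integral_comp_fst t (F := fun z => ∑ j, truncExp θ N ((hH.1 z).eigenvalues j)) hint0.1] at hm
  exact hm

/-- With weight 1 the integral is the limit of E tr (f(Z_t) - f(Z_0))² / (2t), so pointwise
positivity of Γ(f) is not needed. -/
theorem integral_sum_eigenvalues_carre_nonneg (h : ReversibleAlgebra κ μ 𝒜)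
    (hf : IsSuitable 𝒜 f) :
    0 ≤ ∫ z, ∑ j, (isHermitian_carre (κ := κ) hf.1 z).eigenvalues j ∂μ := by
  have h1 : IsBoundedMatrix (fun _ : Ω => (1 : Matrix (Fin d) (Fin d) ℂ)) 1 :=
    ⟨fun i j => measurable_const, fun i j _ => by
      rw [Matrix.one_apply]
      split_ifs <;> simp⟩
  have h2 : ∫ z, ∑ j, (isHermitian_carre (κ := κ) hf.1 z).eigenvalues j ∂μ =
      corr κ μ 0 (carre κ f f) (fun _ => 1) := by
    rw [h.corr_zero (h.hasEntries_carre hf.hasEntries hf.hasEntries) h1]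
    refine integral_congr_ae (ae_of_all _ fun z => ?_)
    simp only [Matrix.mul_one]
    exact ((isHermitian_carre (κ := κ) hf.1 z).trace_re).symm
  rw [h2]
  refine ge_of_tendsto (h.tendsto_energy hf.hasEntries h1) (Eventually.of_forall fun t => ?_)
  refine mul_nonneg (by positivity) (integral_nonneg fun p => ?_)
  simp only [Matrix.mul_one]
  rw [((hf.1 p.2).sub (hf.1 p.1)).trace_mul_self_re, Pi.zero_apply]
  positivity

end ReversibleAlgebra

end MatrixMarkov

/-! ### The differential inequality for the truncated moment generating function -/

namespace MatrixMarkov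

variable {Ω : Type*} [MeasurableSpace Ω] {d : ℕ}
variable {κ : ℝ≥0 → Kernel Ω Ω} {μ : Measure Ω} {𝒜 : StarSubalgebra ℂ (Ω → ℂ)}
variable {f H : Ω → Matrix (Fin d) (Fin d) ℂ}

theorem isHermitian_matMean (hf : ∀ z, (f z).IsHermitian) : (matMean μ f).IsHermitian := by
  ext i j
  simp only [Matrix.conjTranspose_apply, matMean, Matrix.of_apply]
  rw [← starRingEnd_apply, ← integral_conj]
  refine integral_congr_ae (ae_of_all _ fun z => ?_)
  exact (hf z).apply i j

theorem IsSuitable.sub_matMean (hf : IsSuitable 𝒜 f) :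
    IsSuitable 𝒜 (fun z => f z - matMean μ f) :=
  ⟨fun z => (hf.1 z).sub (isHermitian_matMean hf.1), fun i j =>
    𝒜.sub_mem (hf.2 i j) (𝒜.algebraMap_mem (matMean μ f i j))⟩

omit [MeasurableSpace Ω] in
theorem IsSuitable.neg (hf : IsSuitable 𝒜 f) : IsSuitable 𝒜 (-f) :=
  ⟨fun z => (hf.1 z).neg, fun i j => 𝒜.neg_mem (hf.2 i j)⟩

theorem matMean_neg : matMean μ (-f) = -matMean μ f := by
  ext i j
  simp only [matMean, Matrix.of_apply, Pi.neg_apply, Matrix.neg_apply, integral_neg]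

theorem logTraceMgf_neg (θ : ℝ) : logTraceMgf μ (-f) (-θ) = logTraceMgf μ f θ := by
  simp only [logTraceMgf, matMean_neg, Pi.neg_apply]
  congr 2
  ext z
  push_cast
  rw [show -f z - -matMean μ f = -(f z - matMean μ f) by abel, neg_smul_neg]

theorem corr_ofReal_smul (t : ℝ≥0) (a : ℝ) (X Φ : Ω → Matrix (Fin d) (Fin d) ℂ) :
    corr κ μ t X (fun z => (a : ℂ) • Φ z) = a * corr κ μ t X Φ := by
  rw [corr, corr, ← integral_const_mul]
  refine integral_congr_ae (ae_of_all _ fun p => ?_)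
  simp only [Matrix.mul_smul, Matrix.trace_smul, smul_eq_mul, Complex.re_ofReal_mul]

theorem abs_min_mul_truncExp_le {θ N : ℝ} (hθ : 0 ≤ θ) (hN : 0 ≤ N) (x : ℝ) :
    |min x N * truncExp θ N x| ≤ Real.exp (θ * N) * (1 + x ^ 2) := by
  have h1 : |min x N| ≤ 1 + x ^ 2 := by
    rw [abs_le]
    refine ⟨le_min (by nlinarith [sq_nonneg (x + 1)]) (by nlinarith [sq_nonneg x]),
      (min_le_left _ _).trans (by nlinarith [sq_nonneg (x - 1)])⟩
  rw [abs_mul, abs_of_pos (truncExp_pos _ _ _), mul_comm]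
  exact mul_le_mul (truncExp_le hθ N x) h1 (abs_nonneg _) (Real.exp_pos _).le

theorem abs_truncExp_le {θ : ℝ} (hθ : 0 ≤ θ) (N x : ℝ) :
    |truncExp θ N x| ≤ Real.exp (θ * N) * (1 + x ^ 2) := by
  rw [abs_of_pos (truncExp_pos _ _ _)]
  exact (truncExp_le hθ N x).trans
    (le_mul_of_one_le_right (Real.exp_pos _).le (by nlinarith [sq_nonneg x]))

/-- With s = √u this follows from 2s² ≤ 1 + s for 0 < s ≤ 1. It weakens the exact solution of the
differential inequality to the rational form of the theorem. -/
theorem one_sub_sqrt_le {u : ℝ} (hu : 0 < u) (hu1 : u ≤ 1) :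
    1 - Real.sqrt u ≤ (1 - u) / (2 * u) := by
  rw [le_div_iff₀ (by positivity)]
  have h1 := Real.sq_sqrt hu.le
  have h2 := Real.sqrt_nonneg u
  have h3 : Real.sqrt u ≤ 1 := Real.sqrt_le_one.2 hu1
  set s := Real.sqrt u
  rw [← h1]
  nlinarith [mul_nonneg (mul_nonneg h2 h2) (sub_nonneg.2 h3), mul_nonneg h2 (sub_nonneg.2 h3)]

/-- Integration of the differential inequality `(1 - aθ²) y' + aθ y ≤ 0`. -/
theorem le_sqrt_mul_of_deriv_le {y y' : ℝ → ℝ} {a T : ℝ} (hT : 0 ≤ T) (ha : 0 ≤ a)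
    (haT : a * T ^ 2 < 1) (hc : ContinuousOn y (Set.Icc 0 T))
    (hy : ∀ θ ∈ Set.Ioo 0 T, HasDerivAt y (y' θ) θ)
    (hle : ∀ θ ∈ Set.Ioo 0 T, (1 - a * θ ^ 2) * y' θ + a * θ * y θ ≤ 0) :
    y T ≤ Real.sqrt (1 - a * T ^ 2) * y 0 := by
  have hpos : ∀ θ ∈ Set.Icc 0 T, 0 < 1 - a * θ ^ 2 := fun θ hθ => by
    have : a * θ ^ 2 ≤ a * T ^ 2 := by gcongr; exacts [hθ.1, hθ.2]
    linarith
  let s : ℝ → ℝ := fun θ => Real.sqrt (1 - a * θ ^ 2)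
  have hs : ∀ θ ∈ Set.Icc 0 T, 0 < s θ := fun θ hθ => Real.sqrt_pos.2 (hpos θ hθ)
  have hsd : ∀ θ ∈ Set.Icc 0 T, HasDerivAt s (-(a * θ) / s θ) θ := fun θ hθ => by
    have h1 : HasDerivAt (fun θ : ℝ => 1 - a * θ ^ 2) (-(a * (2 * θ))) θ := by
      simpa using ((hasDerivAt_pow 2 θ).const_mul a).const_sub 1
    refine (h1.sqrt (hpos θ hθ).ne').congr_deriv ?_
    change _ / (2 * s θ) = _
    have := (hs θ hθ).ne'
    field_simp
  -- Since s' = -aθ/s, the derivative of y/s is (s² y' + aθ y)/s³, whose numerator is the left side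
  -- of the hypothesis.
  have hanti : AntitoneOn (fun θ => y θ / s θ) (Set.Icc 0 T) := by
    have hd : ∀ θ ∈ Set.Ioo 0 T, HasDerivAt (fun θ => y θ / s θ)
        ((y' θ * s θ - y θ * (-(a * θ) / s θ)) / s θ ^ 2) θ := fun θ hθ =>
      (hy θ hθ).div (hsd θ (Set.Ioo_subset_Icc_self hθ)) (hs θ (Set.Ioo_subset_Icc_self hθ)).ne'
    refine antitoneOn_of_deriv_nonpos (convex_Icc 0 T)
      (hc.div (fun θ hθ => (hsd θ hθ).continuousAt.continuousWithinAt) fun θ hθ => (hs θ hθ).ne')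
      ?_ ?_
    · rw [interior_Icc]
      exact fun θ hθ => (hd θ hθ).differentiableAt.differentiableWithinAt
    · rw [interior_Icc]
      intro θ hθ
      rw [(hd θ hθ).deriv]
      have h1 := hs θ (Set.Ioo_subset_Icc_self hθ)
      have h2 : s θ ^ 2 = 1 - a * θ ^ 2 := Real.sq_sqrt (hpos θ (Set.Ioo_subset_Icc_self hθ)).le
      refine div_nonpos_of_nonpos_of_nonneg ?_ (by positivity)
      have h3 : y' θ * s θ - y θ * (-(a * θ) / s θ) =
          (s θ ^ 2 * y' θ + a * θ * y θ) / s θ := by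
        field_simp
        ring
      rw [h3, h2]
      exact div_nonpos_of_nonpos_of_nonneg (hle θ hθ) h1.le
  have := hanti (Set.left_mem_Icc.2 hT) (Set.right_mem_Icc.2 hT) hT
  have h0 : s 0 = 1 := by simp [s]
  simp only [h0, div_one] at this
  rw [div_le_iff₀ (hs T (Set.right_mem_Icc.2 hT))] at this
  rw [mul_comm]
  exact this

namespace ReversibleAlgebra

variable {θ N : ℝ}

theorem integrable_sum_truncExp (h : ReversibleAlgebra κ μ 𝒜) (hH : IsSuitable 𝒜 H)
    (hθ : 0 ≤ θ) (N : ℝ) :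
    Integrable (fun z => ∑ j, truncExp θ N ((hH.1 z).eigenvalues j)) μ :=
  h.integrable_sum_eigenvalues hH (continuous_truncExp θ N) (abs_truncExp_le hθ N)

theorem integrable_sum_min_mul_truncExp (h : ReversibleAlgebra κ μ 𝒜) (hH : IsSuitable 𝒜 H)
    (hθ : 0 ≤ θ) (hN : 0 ≤ N) :
    Integrable (fun z => ∑ j, min ((hH.1 z).eigenvalues j) N *
      truncExp θ N ((hH.1 z).eigenvalues j)) μ :=
  h.integrable_sum_eigenvalues hH (φ := fun x => min x N * truncExp θ N x)
    ((continuous_id.min continuous_const).mul (continuous_truncExp θ N))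
    (abs_min_mul_truncExp_le hθ hN)

theorem hasDerivAt_integral_truncExp (h : ReversibleAlgebra κ μ 𝒜) (hH : IsSuitable 𝒜 H)
    (hθ : 0 < θ) (hN : 0 ≤ N) :
    HasDerivAt (fun θ => ∫ z, ∑ j, truncExp θ N ((hH.1 z).eigenvalues j) ∂μ)
      (∫ z, ∑ j, min ((hH.1 z).eigenvalues j) N * truncExp θ N ((hH.1 z).eigenvalues j) ∂μ) θ := by
  have := h.prob
  have hm := h.measurable_entry hH.hasEntries
  -- A ball of radius θ about θ keeps the parameter in (0, 2θ), so the exponentials are bounded by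
  -- e^{2θN} and the factor min(x, N) by 1 + x².
  refine (hasDerivAt_integral_of_dominated_loc_of_deriv_le (s := Metric.ball θ θ)
    (bound := fun z => Real.exp (2 * θ * N) * (d + ∑ j, (hH.1 z).eigenvalues j ^ 2))
    (F' := fun θ z => ∑ j, min ((hH.1 z).eigenvalues j) N * truncExp θ N ((hH.1 z).eigenvalues j))
    (Metric.ball_mem_nhds θ hθ)
    (Eventually.of_forall fun x =>
      (measurable_sum_eigenvalues hm hH.1 (continuous_truncExp x N)).aestronglyMeasurable)
    (h.integrable_sum_truncExp hH hθ.le N)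
    (h.integrable_sum_min_mul_truncExp hH hθ.le hN).1 (ae_of_all _ fun z x hx => ?_)
    (((integrable_const (d : ℝ)).add (h.integrable_sum_sq_eigenvalues hH)).const_mul _)
    (ae_of_all _ fun z x _ => ?_)).2
  · rw [Metric.mem_ball, Real.dist_eq, abs_lt] at hx
    refine (Finset.abs_sum_le_sum_abs _ _).trans ?_
    refine (Finset.sum_le_sum fun j _ => (abs_min_mul_truncExp_le (θ := x) (by linarith) hN
      ((hH.1 z).eigenvalues j)).trans (mul_le_mul_of_nonneg_right
      (Real.exp_le_exp.2 (mul_le_mul_of_nonneg_right (by linarith : x ≤ 2 * θ) hN))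
      (by positivity))).trans (le_of_eq ?_)
    rw [← Finset.mul_sum, Finset.sum_add_distrib]
    simp
  · refine HasDerivAt.fun_sum fun j _ => ?_
    have := ((hasDerivAt_id x).mul_const (min ((hH.1 z).eigenvalues j) N)).exp
    refine this.congr_deriv ?_
    simp only [id, one_mul, truncExp]
    ring

theorem continuousOn_integral_truncExp (h : ReversibleAlgebra κ μ 𝒜) (hH : IsSuitable 𝒜 H)
    (hN : 0 ≤ N) (T : ℝ) :
    ContinuousOn (fun θ => ∫ z, ∑ j, truncExp θ N ((hH.1 z).eigenvalues j) ∂μ) (Set.Icc 0 T) := by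
  have := h.prob
  have hm := h.measurable_entry hH.hasEntries
  refine continuousOn_of_dominated (bound := fun _ => d * Real.exp (T * N))
    (fun x _ =>
      (measurable_sum_eigenvalues hm hH.1 (continuous_truncExp x N)).aestronglyMeasurable)
    (fun x hx => ae_of_all _ fun z => ?_) (integrable_const _)
    (ae_of_all _ fun z => Continuous.continuousOn ?_)
  · refine (Finset.abs_sum_le_sum_abs _ _).trans ?_
    calc ∑ j, |truncExp x N ((hH.1 z).eigenvalues j)|
        ≤ ∑ _j : Fin d, Real.exp (T * N) := Finset.sum_le_sum fun j _ => by
          rw [abs_of_pos (truncExp_pos _ _ _)]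
          exact (truncExp_le hx.1 N _).trans
            (Real.exp_le_exp.2 (mul_le_mul_of_nonneg_right hx.2 hN))
      _ = d * Real.exp (T * N) := by simp
  · unfold truncExp
    fun_prop

theorem integral_sum_truncExp_pos (h : ReversibleAlgebra κ μ 𝒜) (hd : 0 < d)
    (hH : IsSuitable 𝒜 H) (hθ : 0 ≤ θ) (N : ℝ) :
    0 < ∫ z, ∑ j, truncExp θ N ((hH.1 z).eigenvalues j) ∂μ := by
  have := h.prob
  have : NeZero d := ⟨hd.ne'⟩
  have hpos : ∀ z, 0 < ∑ j, truncExp θ N ((hH.1 z).eigenvalues j) := fun z =>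
    Finset.sum_pos (fun j _ => truncExp_pos _ _ _) Finset.univ_nonempty
  rw [integral_pos_iff_support_of_nonneg (fun z => (hpos z).le) (h.integrable_sum_truncExp hH hθ N),
    Set.eq_univ_of_forall (s := Function.support _) fun z => (hpos z).ne', measure_univ]
  exact one_pos

variable {c β : ℝ}

/-- The differential inequality for the truncated moment generating function. -/
theorem integral_min_mul_truncExp_le (h : ReversibleAlgebra κ μ 𝒜) (herg : IsErgodic κ μ)
    (hd : 0 < d) (hc : 0 < c) (hBE : BakryEmery κ μ 𝒜 d c) (hf : IsSuitable 𝒜 f)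
    (hH : IsSuitable 𝒜 H) {m : Matrix (Fin d) (Fin d) ℂ} (hm : m = matMean μ f)
    (hHf : ∀ z, H z = f z - m) (hβ : 0 < β)
    (hint : Integrable
      (fun z => ∑ j, Real.exp (β * (isHermitian_carre (κ := κ) hf.1 z).eigenvalues j)) μ)
    {Z M M' : ℝ} (hZ : Z = ∫ z, ∑ j, Real.exp (β * (isHermitian_carre (κ := κ) hf.1 z).eigenvalues j) ∂μ)
    (hZ0 : 0 < Z) (hθ : 0 ≤ θ) (hN : 0 ≤ N)
    (hM : M = ∫ z, ∑ j, truncExp θ N ((hH.1 z).eigenvalues j) ∂μ)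
    (hM' : M' = ∫ z, ∑ j, min ((hH.1 z).eigenvalues j) N *
      truncExp θ N ((hH.1 z).eigenvalues j) ∂μ) :
    M' ≤ c * (θ / β * (M * (Real.log Z - Real.log M) + θ * M')) := by
  have hM0 : 0 < M := hM ▸ h.integral_sum_truncExp_pos hd hH hθ N
  have hme := h.measurable_entry hH.hasEntries
  have hbd : ∀ x, |truncExp θ N x| ≤ Real.exp (θ * N) := fun x => by
    rw [abs_of_pos (truncExp_pos _ _ _)]
    exact truncExp_le hθ N x
  have hΦ := isBoundedMatrix_cfc hme hH.1 (continuous_truncExp θ N) hbd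
  have hΨ := isBoundedMatrix_cfc hme hH.1 (φ := fun x => θ * truncExp θ N x)
    (continuous_const.mul (continuous_truncExp θ N)) (M := θ * Real.exp (θ * N)) fun x => by
      rw [abs_mul, abs_of_nonneg hθ]
      exact mul_le_mul_of_nonneg_left (hbd x) hθ
  have hcov := h.corr_zero_sub_le herg hc hBE hf hH.1
    (fun y z => by rw [hHf, hHf]; abel)
    (fun a => mul_nonneg hθ (truncExp_pos θ N a).le) (abs_truncExp_sub_le hθ N) hΦ hΨ
    (B := θ / β * (M * (Real.log Z - Real.log M) + θ * M')) (fun r => by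
      simp_rw [fun z => (hH.1 z).cfc_const_mul θ (truncExp θ N)]
      rw [corr_ofReal_smul]
      -- The choice ρ = log Z - log M gives e^{-ρ} Z = M, which cancels the -M in (ρ - 1) M. The
      -- bound does not involve the time r, as the covariance estimate requires.
      have key := h.mul_corr_carre_le hf hH hθ N hint
        (h.integrable_sum_min_mul_truncExp hH hθ hN) (h.integrable_sum_truncExp hH hθ N)
        (Real.log Z - Real.log M) r
      rw [← hM, ← hM', ← hZ, neg_sub, Real.exp_sub, Real.exp_log hM0, Real.exp_log hZ0,
        div_mul_cancel₀ _ hZ0.ne'] at key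
      rw [div_mul_eq_mul_div, mul_div_assoc]
      refine mul_le_mul_of_nonneg_left ?_ hθ
      rw [le_div_iff₀ hβ, mul_comm]
      linarith)
  refine le_trans ?_ hcov
  have i1 : Integrable (fun z => (f z * (hH.1 z).cfc (truncExp θ N)).trace.re) μ :=
    integrable_trace_mul (fun i j => h.integrable (hf.hasEntries.entry i j))
      (fun i j => (hΦ.measurable i j).aestronglyMeasurable) hΦ.bound
  have := h.prob
  have i2 : Integrable (fun z => (matMean μ f * (hH.1 z).cfc (truncExp θ N)).trace.re) μ :=
    integrable_trace_mul (X := fun _ => matMean μ f) (fun i j => integrable_const _)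
     
      (fun i j => (hΦ.measurable i j).aestronglyMeasurable) hΦ.bound
  rw [← integral_sub i1 i2, hM']
  -- The covariance is E tr[H φ(H)], and replacing an eigenvalue x by min(x, N) only lowers it since
  -- φ > 0.
  refine integral_mono (h.integrable_sum_min_mul_truncExp hH hθ hN) (i1.sub i2) fun z => ?_
  simp only
  rw [← Complex.sub_re, ← Matrix.trace_sub, ← Matrix.sub_mul, ← hm, ← hHf,
    Matrix.IsHermitian.trace_mul_cfc_self_re]
  exact Finset.sum_le_sum fun j _ =>
    mul_le_mul_of_nonneg_right (min_le_left _ _) (truncExp_pos _ _ _).le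

end ReversibleAlgebra

end MatrixMarkov

/-! ### Removal of the truncation and conclusion -/

theorem Matrix.IsHermitian.eigenvalues_le_norm {n : Type*} [Fintype n] [DecidableEq n]
    {A : Matrix n n ℂ} (hA : A.IsHermitian) (j : n) :
    hA.eigenvalues j ≤ ‖Matrix.toEuclideanCLM (𝕜 := ℂ) A‖ := by
  have h1 : Matrix.toEuclideanCLM (𝕜 := ℂ) A (hA.eigenvectorBasis j) =
      (hA.eigenvalues j : ℂ) • hA.eigenvectorBasis j := by
    ext i
    have := congrFun (hA.mulVec_eigenvectorBasis j) i
    simpa [Matrix.ofLp_toEuclideanCLM] using this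
  have h2 := (Matrix.toEuclideanCLM (𝕜 := ℂ) A).le_opNorm (hA.eigenvectorBasis j)
  rw [h1, norm_smul, hA.eigenvectorBasis.orthonormal.1 j, mul_one, mul_one, Complex.norm_real] at h2
  exact (le_abs_self _).trans h2

namespace MatrixMarkov

variable {Ω : Type*} [MeasurableSpace Ω] {d : ℕ}
variable {κ : ℝ≥0 → Kernel Ω Ω} {μ : Measure Ω} {𝒜 : StarSubalgebra ℂ (Ω → ℂ)}
variable {f H : Ω → Matrix (Fin d) (Fin d) ℂ} {c β θ : ℝ}

theorem expMoment_eq (hH : ∀ z, (H z).IsHermitian) (t : ℝ) :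
    expMoment μ (fun z => (t : ℂ) • H z) =
      ∫⁻ z, ENNReal.ofReal ((∑ j, Real.exp (t * (hH z).eigenvalues j)) / d) ∂μ := by
  unfold expMoment normTrace
  refine lintegral_congr fun z => ?_
  rw [(hH z).exp_smul_eq_cfc, (hH z).trace_cfc_re]

theorem expMoment_zero_smul [IsProbabilityMeasure μ] (hd : 0 < d) :
    expMoment μ (fun z => ((0 : ℝ) : ℂ) • H z) = 1 := by
  have hd' : (d : ℝ) ≠ 0 := by positivity
  simp [expMoment, normTrace, hd']

namespace ReversibleAlgebra

theorem measurable_sum_exp_carre (h : ReversibleAlgebra κ μ 𝒜) (hf : IsSuitable 𝒜 f) (β : ℝ) :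
    Measurable fun z => ∑ j, Real.exp (β * (isHermitian_carre (κ := κ) hf.1 z).eigenvalues j) :=
  measurable_sum_eigenvalues (h.measurable_entry (h.hasEntries_carre hf.hasEntries hf.hasEntries))
    (isHermitian_carre hf.1) (φ := fun x => Real.exp (β * x)) (by fun_prop)

theorem integrable_sum_exp_carre (h : ReversibleAlgebra κ μ 𝒜) (hd : 0 < d)
    (hf : IsSuitable 𝒜 f) (hfin : expMoment μ (fun z => (β : ℂ) • carre κ f f z) ≠ ∞) :
    Integrable
      (fun z => ∑ j, Real.exp (β * (isHermitian_carre (κ := κ) hf.1 z).eigenvalues j)) μ := by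
  have hd' : (d : ℝ) ≠ 0 := by positivity
  rw [expMoment_eq (isHermitian_carre hf.1)] at hfin
  have h1 : Integrable (fun z => (∑ j, Real.exp (β *
      (isHermitian_carre (κ := κ) hf.1 z).eigenvalues j)) / d) μ := by
    refine ⟨((h.measurable_sum_exp_carre hf β).div_const _).aestronglyMeasurable, ?_⟩
    rw [hasFiniteIntegral_iff_ofReal (ae_of_all _ fun z => by positivity)]
    exact hfin.lt_top
  refine (h1.mul_const (d : ℝ)).congr (ae_of_all _ fun z => ?_)
  exact div_mul_cancel₀ _ hd'

theorem expMoment_carre (h : ReversibleAlgebra κ μ 𝒜) (hd : 0 < d)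
    (hf : IsSuitable 𝒜 f) (hfin : expMoment μ (fun z => (β : ℂ) • carre κ f f z) ≠ ∞) :
    expMoment μ (fun z => (β : ℂ) • carre κ f f z) = ENNReal.ofReal
      ((∫ z, ∑ j, Real.exp (β * (isHermitian_carre (κ := κ) hf.1 z).eigenvalues j) ∂μ) / d) := by
  rw [expMoment_eq (isHermitian_carre hf.1), ← integral_div, ofReal_integral_eq_lintegral_ofReal
    ((h.integrable_sum_exp_carre hd hf hfin).div_const _) (ae_of_all _ fun z => by positivity)]

/-- From e^x ≥ 1 + x and E tr Γ(f) ≥ 0. It makes log Z - log d nonnegative, so that its coefficient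
may be enlarged. -/
theorem card_le_integral_sum_exp_carre (h : ReversibleAlgebra κ μ 𝒜) (hf : IsSuitable 𝒜 f)
    (hβ : 0 ≤ β) (hint : Integrable
      (fun z => ∑ j, Real.exp (β * (isHermitian_carre (κ := κ) hf.1 z).eigenvalues j)) μ) :
    (d : ℝ) ≤
      ∫ z, ∑ j, Real.exp (β * (isHermitian_carre (κ := κ) hf.1 z).eigenvalues j) ∂μ := by
  have := h.prob
  have hG : IsSuitable 𝒜 (carre κ f f) :=
    ⟨isHermitian_carre hf.1, h.hasEntries_carre hf.hasEntries hf.hasEntries⟩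
  have i1 : Integrable (fun z => ∑ j, (hG.1 z).eigenvalues j) μ :=
    h.integrable_sum_eigenvalues hG continuous_id (a := 1) fun x => by
      rw [id, abs_le]
      exact ⟨by nlinarith [sq_nonneg (x + 1)], by nlinarith [sq_nonneg (x - 1)]⟩
  have i2 : ∫ z, ((d : ℝ) + β * ∑ j, (hG.1 z).eigenvalues j) ∂μ ≤
      ∫ z, ∑ j, Real.exp (β * (hG.1 z).eigenvalues j) ∂μ := by
    refine integral_mono ((integrable_const _).add (i1.const_mul β)) hint fun z => ?_
    calc (d : ℝ) + β * ∑ j, (hG.1 z).eigenvalues j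
        = ∑ j, (β * (hG.1 z).eigenvalues j + 1) := by
          rw [Finset.sum_add_distrib, ← Finset.mul_sum]
          simp [add_comm]
      _ ≤ _ := Finset.sum_le_sum fun j _ => Real.add_one_le_exp _
  refine le_trans ?_ i2
  rw [integral_add (integrable_const _) (i1.const_mul β), integral_const_mul]
  have := mul_nonneg hβ (h.integral_sum_eigenvalues_carre_nonneg hf)
  simpa using this

theorem log_integral_truncExp_le (h : ReversibleAlgebra κ μ 𝒜) (herg : IsErgodic κ μ)
    (hd : 0 < d) (hc : 0 < c) (hBE : BakryEmery κ μ 𝒜 d c) (hf : IsSuitable 𝒜 f) (hβ : 0 < β)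
    (hint : Integrable
      (fun z => ∑ j, Real.exp (β * (isHermitian_carre (κ := κ) hf.1 z).eigenvalues j)) μ)
    {Z : ℝ} (hZ : Z = ∫ z, ∑ j, Real.exp (β * (isHermitian_carre (κ := κ) hf.1 z).eigenvalues j) ∂μ)
    (hθ : 0 ≤ θ) (hθβ : c / β * θ ^ 2 < 1) {N : ℝ} (hN : 0 ≤ N) :
    Real.log (∫ z, ∑ j, truncExp θ N ((hf.sub_matMean (μ := μ).1 z).eigenvalues j) ∂μ) -
        Real.log d ≤
      c / β * θ ^ 2 / (2 * (1 - c / β * θ ^ 2)) * (Real.log Z - Real.log d) := by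
  have := h.prob
  have hH := hf.sub_matMean (μ := μ)
  have hd0 : (0 : ℝ) < d := by positivity
  have hZd : (d : ℝ) ≤ Z := hZ ▸ h.card_le_integral_sum_exp_carre hf hβ.le hint
  have hZ0 : 0 < Z := hd0.trans_le hZd
  have ha : 0 ≤ c / β := by positivity
  let M : ℝ → ℝ := fun θ => ∫ z, ∑ j, truncExp θ N ((hH.1 z).eigenvalues j) ∂μ
  let M' : ℝ → ℝ := fun θ => ∫ z, ∑ j, min ((hH.1 z).eigenvalues j) N *
    truncExp θ N ((hH.1 z).eigenvalues j) ∂μ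
  have hM0 : ∀ t, 0 ≤ t → 0 < M t := fun t ht => h.integral_sum_truncExp_pos hd hH ht N
  have hMd : M 0 = d := by simp [M, truncExp]
  -- For y = log M - log Z and a = c/β the inequality for M' reads (1 - aθ²) y' + aθ y ≤ 0, with
  -- y(0) = log d - log Z.
  have key := le_sqrt_mul_of_deriv_le (y := fun t => Real.log (M t) - Real.log Z)
    (y' := fun t => M' t / M t) hθ ha hθβ
    (((h.continuousOn_integral_truncExp hH hN θ).log fun t ht => (hM0 t ht.1).ne').sub
      continuousOn_const)
    (fun t ht => ((h.hasDerivAt_integral_truncExp hH ht.1 hN).log (hM0 t ht.1.le).ne').sub_const _)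
    (fun t ht => by
      have h1 := h.integral_min_mul_truncExp_le herg hd hc hBE hf hH rfl (fun z => rfl) hβ hint
        hZ hZ0 ht.1.le hN (M := M t) (M' := M' t) rfl rfl
      have h2 := hM0 t ht.1.le
      have h3 : (1 - c / β * t ^ 2) * (M' t / M t) + c / β * t * (Real.log (M t) - Real.log Z) =
          (M' t - c * (t / β * (M t * (Real.log Z - Real.log (M t)) + t * M' t))) / M t := by
        field_simp
        ring
      rw [h3]
      exact div_nonpos_of_nonpos_of_nonneg (by linarith) h2.le)
  simp only [hMd] at key
  have hu := one_sub_sqrt_le (u := 1 - c / β * θ ^ 2) (by linarith)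
    (by have := mul_nonneg ha (sq_nonneg θ); linarith)
  rw [sub_sub_cancel] at hu
  have hl : 0 ≤ Real.log Z - Real.log d := sub_nonneg.2 (Real.log_le_log hd0 hZd)
  have := mul_le_mul_of_nonneg_right hu hl
  change Real.log (M θ) - _ ≤ _
  linarith

/-- The truncated bound does not depend on N, and for θ ≥ 0 the truncated exponentials increase with
N, so monotone convergence applies without assuming that the limit is finite. -/
theorem expMoment_sub_matMean_le (h : ReversibleAlgebra κ μ 𝒜) (herg : IsErgodic κ μ)
    (hd : 0 < d) (hc : 0 < c) (hBE : BakryEmery κ μ 𝒜 d c) (hf : IsSuitable 𝒜 f) (hβ : 0 < β)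
    (hint : Integrable
      (fun z => ∑ j, Real.exp (β * (isHermitian_carre (κ := κ) hf.1 z).eigenvalues j)) μ)
    {Z : ℝ} (hZ : Z = ∫ z, ∑ j, Real.exp (β * (isHermitian_carre (κ := κ) hf.1 z).eigenvalues j) ∂μ)
    (hθ : 0 ≤ θ) (hθβ : c / β * θ ^ 2 < 1) :
    expMoment μ (fun z => (θ : ℂ) • (f z - matMean μ f)) ≤ ENNReal.ofReal (Real.exp
      (c / β * θ ^ 2 / (2 * (1 - c / β * θ ^ 2)) * (Real.log Z - Real.log d))) := by
  have hH := hf.sub_matMean (μ := μ)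
  have hme := h.measurable_entry hH.hasEntries
  have hd0 : (0 : ℝ) < d := by positivity
  rw [expMoment_eq hH.1]
  have hlim := lintegral_tendsto_of_tendsto_of_monotone (μ := μ)
    (f := fun (n : ℕ) z => ENNReal.ofReal ((∑ j, truncExp θ n ((hH.1 z).eigenvalues j)) / d))
    (F := fun z => ENNReal.ofReal ((∑ j, Real.exp (θ * (hH.1 z).eigenvalues j)) / d))
    (fun n => ((measurable_sum_eigenvalues hme hH.1
      (continuous_truncExp θ n)).div_const _).ennreal_ofReal.aemeasurable)
    (ae_of_all _ fun z m n hmn => ENNReal.ofReal_le_ofReal (div_le_div_of_nonneg_right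
      (Finset.sum_le_sum fun j _ => Real.exp_le_exp.2 (mul_le_mul_of_nonneg_left
        (min_le_min_left _ (Nat.cast_le.2 hmn)) hθ)) hd0.le))
    (ae_of_all _ fun z => by
      refine ENNReal.tendsto_ofReal (Tendsto.div_const (tendsto_finsetSum _ fun j _ => ?_) _)
      refine tendsto_const_nhds.congr' ?_
      filter_upwards [tendsto_natCast_atTop_atTop.eventually_ge_atTop ((hH.1 z).eigenvalues j)]
        with n hn
      rw [truncExp, min_eq_left hn])
  refine le_of_tendsto' hlim fun n => ?_
  have i1 := h.integrable_sum_truncExp hH hθ n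
  rw [← ofReal_integral_eq_lintegral_ofReal (i1.div_const _)
    (ae_of_all _ fun z => div_nonneg (Finset.sum_nonneg fun j _ => (truncExp_pos _ _ _).le) hd0.le)]
  refine ENNReal.ofReal_le_ofReal ?_
  have hpos := h.integral_sum_truncExp_pos hd hH hθ n
  rw [integral_div, ← Real.log_le_iff_le_exp (by positivity), Real.log_div hpos.ne' hd0.ne']
  exact h.log_integral_truncExp_le herg hd hc hBE hf hβ hint hZ hθ hθβ n.cast_nonneg

theorem logTraceMgf_le (h : ReversibleAlgebra κ μ 𝒜) (herg : IsErgodic κ μ)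
    (hd : 0 < d) (hc : 0 < c) (hBE : BakryEmery κ μ 𝒜 d c) (hf : IsSuitable 𝒜 f) (hβ : 0 < β)
    (hθβ : c * θ ^ 2 / β < 1) :
    logTraceMgf μ f θ ≤
      ((c * θ ^ 2 / (2 * (1 - c * θ ^ 2 / β)) : ℝ) : EReal) * expMean κ μ f β := by
  have := h.prob
  have hd0 : (0 : ℝ) < d := by positivity
  -- The pair (-f, -θ) has the same moment generating function and the same Γ.
  wlog hθ : 0 ≤ θ generalizing θ f
  · have h1 := this hf.neg (θ := -θ) (by rwa [neg_sq]) (by linarith)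
    rw [logTraceMgf_neg, neg_sq] at h1
    simpa only [expMean, carre_neg] using h1
  by_cases hfin : expMoment μ (fun z => (β : ℂ) • carre κ f f z) = ∞
  -- When r_f(β) is infinite the right side is infinite, except at θ = 0, where 0 · ∞ = 0 and the
  -- left side is log 1.
  · rcases hθ.eq_or_lt with rfl | hθ
    · rw [logTraceMgf, expMoment_zero_smul hd]
      simp
    · have hpos : 0 < c * θ ^ 2 / (2 * (1 - c * θ ^ 2 / β)) := by
        have : 0 < 1 - c * θ ^ 2 / β := by linarith
        positivity
      rw [expMean, hfin, ENNReal.log_top, EReal.coe_mul_top_of_pos (inv_pos.2 hβ),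
        EReal.coe_mul_top_of_pos hpos]
      exact le_top
  · have hint := h.integrable_sum_exp_carre hd hf hfin
    have hZd := h.card_le_integral_sum_exp_carre hf hβ.le hint
    have hE := h.expMoment_carre hd hf hfin
    have hm := h.expMoment_sub_matMean_le herg hd hc hBE hf hβ hint rfl hθ
      (by rwa [div_mul_eq_mul_div])
    set Z := ∫ z, ∑ j, Real.exp (β * (isHermitian_carre (κ := κ) hf.1 z).eigenvalues j) ∂μ
    have hZ0 : 0 < Z := hd0.trans_le hZd
    rw [expMean, hE, ENNReal.log_ofReal_of_pos (by positivity), logTraceMgf, ← EReal.coe_mul,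
      ← EReal.coe_mul]
    refine (ENNReal.log_monotone hm).trans ?_
    rw [ENNReal.log_ofReal_of_pos (Real.exp_pos _), Real.log_exp, Real.log_div hZ0.ne' hd0.ne']
    refine EReal.coe_le_coe_iff.2 (le_of_eq ?_)
    rw [div_mul_eq_mul_div]
    ring

theorem expMean_le_varianceProxy (h : ReversibleAlgebra κ μ 𝒜) (hd : 0 < d)
    (hf : IsSuitable 𝒜 f) (hβ : 0 < β) (hv : varianceProxy κ μ f < ∞) :
    expMean κ μ f β ≤ ((varianceProxy κ μ f).toReal : EReal) := by
  have := h.prob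
  have hd0 : (0 : ℝ) < d := by positivity
  set v := (varianceProxy κ μ f).toReal with hvdef
  have hae : ∀ᵐ z ∂μ, ‖Matrix.toEuclideanCLM (𝕜 := ℂ) (carre κ f f z)‖ ≤ v := by
    have h1 := ae_le_eLpNormEssSup (f := fun z =>
      ‖Matrix.toEuclideanCLM (𝕜 := ℂ) (carre κ f f z)‖) (μ := μ)
    filter_upwards [h1] with z hz
    rw [← eLpNorm_exponent_top, ← ofReal_norm, norm_norm] at hz
    exact (ENNReal.ofReal_le_iff_le_toReal hv.ne).1 hz
  have hm : expMoment μ (fun z => (β : ℂ) • carre κ f f z) ≤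
      ENNReal.ofReal (Real.exp (β * v)) := by
    rw [expMoment_eq (isHermitian_carre hf.1)]
    calc _ ≤ ∫⁻ _, ENNReal.ofReal (Real.exp (β * v)) ∂μ := by
          refine lintegral_mono_ae ?_
          filter_upwards [hae] with z hz
          refine ENNReal.ofReal_le_ofReal ?_
          rw [div_le_iff₀ hd0]
          calc _ ≤ ∑ _j : Fin d, Real.exp (β * v) := Finset.sum_le_sum fun j _ =>
                Real.exp_le_exp.2 (mul_le_mul_of_nonneg_left
                  (((isHermitian_carre hf.1 z).eigenvalues_le_norm j).trans hz) hβ.le)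
            _ = _ := by simp [mul_comm]
      _ = _ := by simp
  have h2 := ENNReal.log_monotone hm
  rw [ENNReal.log_ofReal_of_pos (Real.exp_pos _), Real.log_exp] at h2
  calc expMean κ μ f β ≤ ((β⁻¹ : ℝ) : EReal) * ((β * v : ℝ) : EReal) :=
        mul_le_mul_of_nonneg_left h2 (EReal.coe_nonneg.2 (inv_nonneg.2 hβ.le))
    _ = (v : EReal) := by
        rw [← EReal.coe_mul, inv_mul_cancel_left₀ hβ.ne']

/-- For fixed θ every large β is admissible. Since r_f(β) ≤ v_f for all of them, the factor 1 -
cθ²/β tends to 1 while v_f stays fixed. -/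
theorem logTraceMgf_le_varianceProxy (h : ReversibleAlgebra κ μ 𝒜) (herg : IsErgodic κ μ)
    (hd : 0 < d) (hc : 0 < c) (hBE : BakryEmery κ μ 𝒜 d c) (hf : IsSuitable 𝒜 f)
    (hv : varianceProxy κ μ f < ∞) (θ : ℝ) :
    logTraceMgf μ f θ ≤ ((c * (varianceProxy κ μ f).toReal * θ ^ 2 / 2 : ℝ) : EReal) := by
  set v := (varianceProxy κ μ f).toReal
  have hlim0 : Tendsto (fun β : ℝ => c * θ ^ 2 / β) atTop (𝓝 0) :=
    tendsto_const_nhds.div_atTop tendsto_id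
  have hlim : Tendsto (fun β : ℝ => c * θ ^ 2 / (2 * (1 - c * θ ^ 2 / β)) * v) atTop
      (𝓝 (c * v * θ ^ 2 / 2)) := by
    have := ((tendsto_const_nhds (x := c * θ ^ 2)).div
      ((hlim0.const_sub 1).const_mul 2) (by norm_num)).mul_const v
    rw [show c * v * θ ^ 2 / 2 = c * θ ^ 2 / (2 * (1 - 0)) * v by rw [sub_zero]; ring]
    exact this
  refine ge_of_tendsto ((continuous_coe_real_ereal.tendsto _).comp hlim) ?_
  filter_upwards [hlim0.eventually_lt_const one_pos, eventually_gt_atTop 0] with β h1 hβ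
  refine (h.logTraceMgf_le herg hd hc hBE hf hβ h1).trans ?_
  simp only [Function.comp_apply]
  rw [EReal.coe_mul]
  refine mul_le_mul_of_nonneg_left (h.expMean_le_varianceProxy hd hf hβ hv) ?_
  have : 0 < 1 - c * θ ^ 2 / β := by linarith
  exact EReal.coe_nonneg.2 (by positivity)

end ReversibleAlgebra

end MatrixMarkov

theorem mainTheorem3 {Ω : Type*} [TopologicalSpace Ω] [PolishSpace Ω] [MeasurableSpace Ω]
    [BorelSpace Ω] (μ : Measure Ω) [IsProbabilityMeasure μ]
    (κ : ℝ≥0 → Kernel Ω Ω) (hκ : MatrixMarkov.IsMarkovSemigroup κ)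
    (hstat : MatrixMarkov.IsStationary κ μ) (hrev : MatrixMarkov.IsReversible κ μ)
    (herg : MatrixMarkov.IsErgodic κ μ)
    (𝒜 : StarSubalgebra ℂ (Ω → ℂ)) (h𝒜 : MatrixMarkov.IsSuitableAlgebra κ μ 𝒜)
    (d : ℕ) (hd : 0 < d) (c : ℝ) (hc : 0 < c) (hBE : MatrixMarkov.BakryEmery κ μ 𝒜 d c)
    (f : Ω → Matrix (Fin d) (Fin d) ℂ) (hf : MatrixMarkov.IsSuitable 𝒜 f) :
    (∀ β : ℝ, 0 < β → ∀ θ : ℝ, -Real.sqrt (β / c) < θ → θ < Real.sqrt (β / c) →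
      MatrixMarkov.logTraceMgf μ f θ ≤
        ((c * θ ^ 2 / (2 * (1 - c * θ ^ 2 / β)) : ℝ) : EReal) * MatrixMarkov.expMean κ μ f β) ∧
    (MatrixMarkov.varianceProxy κ μ f < ∞ → ∀ θ : ℝ,
      MatrixMarkov.logTraceMgf μ f θ ≤
        ((c * (MatrixMarkov.varianceProxy κ μ f).toReal * θ ^ 2 / 2 : ℝ) : EReal)) := by
  have h : MatrixMarkov.ReversibleAlgebra κ μ 𝒜 := ⟨inferInstance, hκ, hstat, hrev, h𝒜⟩
  refine ⟨fun β hβ θ h1 h2 => h.logTraceMgf_le herg hd hc hBE hf hβ ?_,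
    fun hv θ => h.logTraceMgf_le_varianceProxy herg hd hc hBE hf hv θ⟩
  have h3 : θ ^ 2 < β / c := by
    rw [← Real.sq_sqrt (div_pos hβ hc).le]
    exact sq_lt_sq' h1 h2
  rw [div_lt_one hβ, mul_comm]
  exact (lt_div_iff₀ hc).1 h3
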